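/- **Conventions.** An algorithm is a randomized algorithm in a standard model of computation (all reasonable models are polynomially related, which does not affect the bounds below); it is run with a time bound $T$, and on an $n$-vertex graph it gives an answer only if it halts within $T(n)$ steps. $\mathcal G(n,\frac12)$ denotes the Erdős–Rényi distribution on graphs with $n$ labelled vertices, each edge being present independently with probability $\frac12$; $\mathcal G(n,\frac12,\kappa)$ denotes the same distribution with a clique added on an independent, uniformly random set of $\kappa$ vertices. **Strongish Planted Clique Hypothesis (SPCH).** There is a constant $\delta\in(0,\frac12)$ such that no algorithm $\mathcal A$ with time bound $n^{o(\log n)}$ satisfies, for all sufficiently large $n$, both $\Pr_{G\sim\mathcal G(n,\frac12,\lceil n^\delta\rceil)}[\mathcal A(G)=1]\ge \frac23$ and $\Pr_{G\sim\mathcal G(n,\frac12)}[\mathcal A(G)=1]\le\frac13$ (probabilities over $G$ and the coin tosses of $\mathcal A$; $\mathcal A(G)=1$ means that $\mathcal A$ halts on $G$ within the time bound with answer $1$). **Pattern detection.** For a fixed graph $H$ on $k$ vertices, an algorithm solves the not-necessarily-induced pattern detection problem for $H$ in time $T(n)$ if for every $n\ge1$ and every graph $G$ on $n$ vertices, with probability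 at least $\frac23$ it halts within $T(n)$ steps and answers correctly whether $G$ contains a (not necessarily induced) subgraph isomorphic to $H$. **Statement.** Assume SPCH. Let $f:\mathbb N\to\mathbb R$ be any function and let $g:\mathbb N\to\mathbb R$ satisfy $g(k)=o(k)$ as $k\to\infty$. Then $$\Pr_{H\sim\mathcal G(k,\frac12)}\bigl[\text{no algorithm solves not-necessarily-induced pattern detection for } H \text{ in time } f(k)\cdot n^{g(k)}\bigr]\longrightarrow 1\qquad (k\to\infty).$$ -/

import Mathlib

open Filter Topology Asymptotics
open scoped ENNReal

noncomputable section

namespace PatternDetection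

/-! ### Model of computation: randomized WHILE programs on binary trees

This is the textbook WHILE language (one program variable, holding a binary tree) with a coin-flip
instruction. Every step inspects or builds only a bounded number of tree nodes; subtrees are
shared pointers, and the only test is whether a tree is a leaf. Running times are therefore
polynomially related to those of randomized Turing machines and RAMs, so bounds of the form
`n ^ o(log n)` and `f k * n ^ o(k)` do not depend on which of these models is used. -/

/-- The data of the programs: unlabelled binary trees. -/
inductive BTree : Type
  | leaf : BTree
  | node : BTree → BTree → BTree

namespace BTree

/-- Left subtree (a leaf for a leaf). -/
def left : BTree → BTree
  | leaf => leaf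
  | node l _ => l

/-- Right subtree (a leaf for a leaf). -/
def right : BTree → BTree
  | leaf => leaf
  | node _ r => r

/-- The truth value of a tree: leaves are false, all other trees are true. -/
def truth : BTree → Bool
  | leaf => false
  | node _ _ => true

/-- The two bits as trees. -/
def ofBool : Bool → BTree
  | false => leaf
  | true => node leaf leaf

/-- Lists as trees. -/
def ofList : List BTree → BTree
  | [] => leaf
  | a :: l => node a (ofList l)

end BTree

/-- Expressions in the program variable. -/
inductive Expr : Type
  | var : Expr
  | leaf : Expr
  | node : Expr → Expr → Expr
  | left : Expr → Expr
  | right : Expr → Expr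

/-- The value of an expression when the program variable holds `s`. -/
def Expr.eval (s : BTree) : Expr → BTree
  | .var => s
  | .leaf => .leaf
  | .node a b => .node (a.eval s) (b.eval s)
  | .left a => (a.eval s).left
  | .right a => (a.eval s).right

/-- Programs (finite objects, independent of the input). -/
inductive Prog : Type
  /-- Replace the content of the program variable by the value of an expression. -/
  | assign : Expr → Prog
  /-- Toss a fair coin and attach the resulting bit on the left of the current tree. -/
  | flip : Prog
  | seq : Prog → Prog → Prog
  | ite : Expr → Prog → Prog → Prog
  /-- Repeat the body as long as the expression is true. -/
  | loop : Expr → Prog → Prog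

/-- A configuration: the programs that remain to be executed, in order, and the current value of
the program variable. The machine has halted when nothing remains to be executed. -/
abbrev Config : Type := List Prog × BTree

/-- One step of the computation, as a probability distribution on the next configuration. -/
def step : Config → PMF Config
  | ([], s) => PMF.pure ([], s)
  | (.assign e :: c, s) => PMF.pure (c, e.eval s)
  | (.flip :: c, s) =>
      (PMF.uniformOfFintype Bool).map fun b => (c, BTree.node (BTree.ofBool b) s)
  | (.seq p q :: c, s) => PMF.pure (p :: q :: c, s)
  | (.ite e p q :: c, s) =>
      PMF.pure (if (e.eval s).truth then (p :: c, s) else (q :: c, s))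
  | (.loop e p :: c, s) =>
      PMF.pure (if (e.eval s).truth then (p :: .loop e p :: c, s) else (c, s))

/-- The distribution of the configuration after `t` steps. -/
def run : ℕ → Config → PMF Config
  | 0, c => PMF.pure c
  | t + 1, c => (step c).bind (run t)

/-- The answer given in a configuration: none if the machine has not halted. -/
def answer : Config → Option Bool
  | ([], s) => some s.truth
  | (_ :: _, _) => none

/-- The distribution of the answer of the program `P` on the input `x` within `t` steps:
`some b` if `P` halts on `x` within `t` steps with answer `b`, and `none` if it has not halted. -/
def output (P : Prog) (t : ℕ) (x : BTree) : PMF (Option Bool) :=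
  (run t ([P], x)).map answer

/-! ### Graphs, random graphs and the planted clique hypothesis -/

open Classical in
/-- A graph on `n` labelled vertices as an input: the list of the rows of its adjacency matrix. -/
def encode {n : ℕ} (G : SimpleGraph (Fin n)) : BTree :=
  BTree.ofList (List.ofFn fun i : Fin n =>
    BTree.ofList (List.ofFn fun j : Fin n => BTree.ofBool (decide (G.Adj i j))))

/-- The Erdős–Rényi distribution with edge probability `1/2`: the uniform distribution on the
graphs on `n` labelled vertices. -/
def erdosRenyi (n : ℕ) : PMF (SimpleGraph (Fin n)) :=
  PMF.uniformOfFintype (SimpleGraph (Fin n))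

/-- The graph `G` with all edges inside the vertex set `S` added. -/
def addClique {n : ℕ} (G : SimpleGraph (Fin n)) (S : Finset (Fin n)) : SimpleGraph (Fin n) :=
  G ⊔ SimpleGraph.fromRel fun u v => u ∈ S ∧ v ∈ S

/-- The Erdős–Rényi distribution with edge probability `1/2` and a clique planted on an
independent, uniformly random set of `κ` vertices. -/
def plantedClique (n κ : ℕ) (h : κ ≤ n) : PMF (SimpleGraph (Fin n)) :=
  (erdosRenyi n).bind fun G =>
    (PMF.uniformOfFinset ((Finset.univ : Finset (Fin n)).powersetCard κ)
      (Finset.powersetCard_nonempty.2 (by simpa using h))).map (addClique G)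

theorem ceil_rpow_le (n : ℕ) {δ : ℝ} (h₀ : 0 < δ) (h₁ : δ < 1 / 2) :
    ⌈(n : ℝ) ^ δ⌉₊ ≤ n := by
  rw [Nat.ceil_le]
  rcases Nat.eq_zero_or_pos n with rfl | hn
  · simp [Real.zero_rpow h₀.ne']
  · calc (n : ℝ) ^ δ ≤ (n : ℝ) ^ (1 : ℝ) :=
          Real.rpow_le_rpow_of_exponent_le (by exact_mod_cast hn) (by linarith)
      _ = n := Real.rpow_one _

/-- The Strongish Planted Clique Hypothesis: for some constant `δ ∈ (0, 1/2)`, no randomized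
algorithm `A` with time bound `T n = n ^ h n`, `h n = o(log n)`, distinguishes, for all large `n`,
the two distributions in the sense that `A` answers `1` with probability at least `2/3` under the
planted and at most `1/3` under the Erdős–Rényi distribution. The computation of `A` is cut off
after `T n` steps: `A` answers `1` if it halts with that answer within `T n` steps. -/
def SPCH : Prop :=
  ∃ (δ : ℝ) (h₀ : 0 < δ) (h₁ : δ < 1 / 2),
    ¬ ∃ (A : Prog) (h : ℕ → ℝ), h =o[atTop] (fun n : ℕ => Real.log n) ∧
      ∀ᶠ n : ℕ in atTop,
        2 / 3 ≤ ((plantedClique n ⌈(n : ℝ) ^ δ⌉₊ (ceil_rpow_le n h₀ h₁)).bind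
          fun G => output A ⌊(n : ℝ) ^ h n⌋₊ (encode G)) (some true) ∧
        ((erdosRenyi n).bind
          fun G => output A ⌊(n : ℝ) ^ h n⌋₊ (encode G)) (some true) ≤ 1 / 3

/-! ### Pattern detection -/

open Classical in
/-- The randomized algorithm `P` solves the not-necessarily-induced pattern detection problem for
the fixed pattern `H` in time `T`: for every `n ≥ 1` and every host graph `G` on `n` vertices, with
probability at least `2/3` it halts within `T n` steps and answers correctly whether `G` contains a
(not necessarily induced) subgraph isomorphic to `H`. -/
def SolvesPattern {k : ℕ} (P : Prog) (H : SimpleGraph (Fin k)) (T : ℕ → ℝ) : Prop :=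
  ∀ n : ℕ, 1 ≤ n → ∀ G : SimpleGraph (Fin n),
    2 / 3 ≤ output P ⌊T n⌋₊ (encode G) (some (decide (H.IsContained G)))

end PatternDetection

end

/-! The theorem is proved by turning fast detectors for dense patterns into one fast algorithm for
planted cliques.

Stage `t` of this algorithm guesses, by coin tosses, the code of a program `P`, the parameters of
the construction, and many random blocks of vertices. It runs an interpreter on the graph whose
vertices are the blocks, two blocks being adjacent if they are completely joined, and asks `P`, with
a majority vote, whether this graph contains the pattern. Dropping blocks as long as the answer
remains positive leaves the blocks of one copy of the pattern. The stage succeeds only if the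
completely joined pairs of these blocks cover far more pairs of vertices than it takes bits to
describe the blocks. Such a certificate hardly ever exists in a random graph, by a union bound over
all families of blocks, so nothing else about the guessed program has to be verified.

If the graph has a clique of size `n ^ δ`, then some of the blocks lie in disjoint parts of the
clique and form a copy of every pattern. If the pattern is dense, as almost all patterns are, then
any copy is a certificate. Hence a correct guess succeeds, and correct guesses have probability at
least `2 ^ (-O(size))`, where the size of the blocks is about `log n / k + 1`. A detector that runs
in time `f k * n ^ g k` thus finds cliques in time `n ^ (O((1 + |g k|) / k) * log n)`. One algorithm
serves all patterns and detectors, so infinitely many of them with `g k = o(k)` make it run in time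
`n ^ o(log n)`, against the hypothesis. -/

namespace PatternDetection

/-! ### Uniform probability on finite types -/

open Classical in
/-- The probability of an event under the uniform distribution on a finite type. -/
noncomputable def prob {Ω : Type*} [Fintype Ω] (p : Ω → Prop) : ℝ :=
  (Finset.univ.filter p).card / Fintype.card Ω

/-- The expectation under the uniform distribution on a finite type. -/
noncomputable def mean {Ω : Type*} [Fintype Ω] (f : Ω → ℝ≥0∞) : ℝ≥0∞ :=
  (∑ ω, f ω) / Fintype.card Ω

section Prob

variable {Ω Ω' : Type*} [Fintype Ω] [Fintype Ω'] {p q : Ω → Prop}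

theorem prob_eq_card_div_card (p : Ω → Prop) [DecidablePred p] :
    prob p = (Finset.univ.filter p).card / Fintype.card Ω := by
  unfold prob
  congr

theorem prob_nonneg (p : Ω → Prop) : 0 ≤ prob p := by unfold prob; positivity

theorem prob_le_one (p : Ω → Prop) : prob p ≤ 1 :=
  div_le_one_of_le₀ (by exact_mod_cast Finset.card_le_univ _) (by positivity)

theorem prob_mono (h : ∀ ω, p ω → q ω) : prob p ≤ prob q := by
  unfold prob
  gcongr with ω
  exact h _

theorem prob_congr (h : ∀ ω, p ω ↔ q ω) : prob p = prob q :=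
  le_antisymm (prob_mono fun ω => (h ω).1) (prob_mono fun ω => (h ω).2)

theorem prob_true [Nonempty Ω] : prob (fun _ : Ω => True) = 1 := by simp [prob]

theorem prob_false : prob (fun _ : Ω => False) = 0 := by simp [prob]

theorem prob_eq_const (y : Ω) : prob (fun ω => ω = y) = 1 / Fintype.card Ω := by
  classical
  rw [prob_eq_card_div_card, Finset.filter_eq' Finset.univ y]
  simp

theorem prob_mem (C : Finset Ω) : prob (fun ω => ω ∈ C) = C.card / Fintype.card Ω := by
  classical
  simp [prob_eq_card_div_card]

theorem prob_not [Nonempty Ω] (p : Ω → Prop) : prob (fun ω => ¬ p ω) = 1 - prob p := by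
  classical
  simp only [prob_eq_card_div_card]
  rw [eq_sub_iff_add_eq, ← add_div, div_eq_one_iff_eq (by simp), add_comm]
  exact_mod_cast Finset.card_filter_add_card_filter_not (s := Finset.univ) p

theorem one_sub_le_prob_of_prob_not_le [Nonempty Ω] {a : ℝ} (h : prob (fun ω => ¬ p ω) ≤ a) :
    1 - a ≤ prob p := by
  rw [prob_not] at h
  linarith

theorem prob_or_le (p q : Ω → Prop) : prob (fun ω => p ω ∨ q ω) ≤ prob p + prob q := by
  classical
  simp only [prob_eq_card_div_card]
  rw [← add_div, Finset.filter_or]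
  gcongr
  exact_mod_cast Finset.card_union_le _ _

theorem prob_exists_le {ι : Type*} (s : Finset ι) (p : ι → Ω → Prop) :
    prob (fun ω => ∃ i ∈ s, p i ω) ≤ ∑ i ∈ s, prob (p i) := by
  classical
  induction s using Finset.induction_on with
  | empty => simp [prob_false]
  | insert a s ha ih =>
    simp only [Finset.sum_insert ha, Finset.exists_mem_insert]
    exact (prob_or_le _ _).trans (by gcongr)

theorem prob_equiv (e : Ω ≃ Ω') (p : Ω' → Prop) : prob (fun ω => p (e ω)) = prob p := by
  classical
  simp only [prob_eq_card_div_card]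
  rw [Fintype.card_congr e]
  congr 2
  exact Finset.card_equiv e (by simp)

theorem prob_mul_le_prob_and {q : Ω → Ω' → Prop} {a : ℝ} (h : ∀ ω, p ω → a ≤ prob (q ω)) :
    prob p * a ≤ prob (fun ω : Ω × Ω' => p ω.1 ∧ q ω.1 ω.2) := by
  classical
  simp only [prob_eq_card_div_card] at h ⊢
  have hcard : ((Finset.univ.filter fun ω : Ω × Ω' => p ω.1 ∧ q ω.1 ω.2).card : ℝ) =
      ∑ ω ∈ Finset.univ.filter p, ((Finset.univ.filter (q ω)).card : ℝ) := by
    norm_cast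
    rw [← Finset.card_sigma]
    refine Finset.card_bij' (fun ω _ => ⟨ω.1, ω.2⟩) (fun ω _ => (ω.1, ω.2)) ?_ ?_ ?_ ?_ <;> simp
  rw [hcard, Fintype.card_prod, Nat.cast_mul, mul_comm (Fintype.card Ω : ℝ), ← div_div,
    Finset.sum_div, div_mul_eq_mul_div, ← nsmul_eq_mul]
  gcongr
  exact Finset.card_nsmul_le_sum _ _ _ fun ω hω => h ω (by simpa using hω)

theorem prob_forall_pi {ι : Type*} [Fintype ι] [DecidableEq ι] (p : ι → Ω → Prop) :
    prob (fun ω : ι → Ω => ∀ i, p i (ω i)) = ∏ i, prob (p i) := by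
  classical
  simp only [prob_eq_card_div_card, Finset.prod_div_distrib]
  congr 1
  · norm_cast
    rw [← Fintype.card_piFinset]
    congr 1
    ext ω
    simp
  · simp

theorem mean_const [Nonempty Ω] (a : ℝ≥0∞) : mean (fun _ : Ω => a) = a := by
  simp only [mean, Finset.sum_const, Finset.card_univ, nsmul_eq_mul]
  rw [mul_comm]
  exact ENNReal.mul_div_cancel_right (by simp) (by simp)

theorem mean_bool (f : Bool → ℝ≥0∞) : mean f = (f true + f false) / 2 := by simp [mean]

theorem mean_mono {f g : Ω → ℝ≥0∞} (h : ∀ ω, f ω ≤ g ω) : mean f ≤ mean g := by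
  unfold mean
  gcongr with ω
  exact h ω

theorem mean_equiv (e : Ω ≃ Ω') (f : Ω' → ℝ≥0∞) : mean (fun ω => f (e ω)) = mean f := by
  unfold mean
  rw [Fintype.card_congr e, e.sum_comp]

theorem mean_mean (f : Ω × Ω' → ℝ≥0∞) : (mean fun ω => mean fun ω' => f (ω, ω')) = mean f := by
  simp only [mean, div_eq_mul_inv, Fintype.sum_prod_type, Fintype.card_prod, ← Finset.sum_mul]
  rw [Nat.cast_mul, ENNReal.mul_inv (by simp) (by simp), mul_assoc, mul_comm (_⁻¹ : ℝ≥0∞)]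

open Classical in
theorem mean_indicator [Nonempty Ω] (p : Ω → Prop) :
    mean (fun ω => if p ω then 1 else 0) = ENNReal.ofReal (prob p) := by
  rw [mean, prob_eq_card_div_card, ENNReal.ofReal_div_of_pos (by exact_mod_cast Fintype.card_pos)]
  simp

open Classical in
theorem mean_ite_one [Nonempty Ω] (p : Ω → Prop) {a : ℝ} (ha : 0 ≤ a) :
    mean (fun ω => ENNReal.ofReal (if p ω then 1 else a)) =
      ENNReal.ofReal (prob p + (1 - prob p) * a) := by
  have hcard : (0 : ℝ) < Fintype.card Ω := by exact_mod_cast Fintype.card_pos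
  rw [mean, ← ENNReal.ofReal_sum_of_nonneg (fun ω _ => by split_ifs <;> positivity),
    ← ENNReal.ofReal_natCast, ← ENNReal.ofReal_div_of_pos hcard, ← prob_not,
    prob_eq_card_div_card p, prob_eq_card_div_card fun ω => ¬ p ω, Finset.sum_ite]
  simp only [Finset.sum_const, nsmul_eq_mul, mul_one]
  congr 1
  ring

end Prob

section IsUniform

variable {Ω Ω' Ω'' : Type*} [Fintype Ω] [Fintype Ω'] [Fintype Ω'']

/-- The map `φ` takes the uniform distribution to the uniform distribution. -/
def IsUniform (φ : Ω → Ω') : Prop := ∀ y, prob (fun ω => φ ω = y) = 1 / Fintype.card Ω'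

namespace IsUniform

theorem prob_comp {φ : Ω → Ω'} (h : IsUniform φ) (p : Ω' → Prop) :
    prob (fun ω => p (φ ω)) = prob p := by
  classical
  simp only [IsUniform, prob_eq_card_div_card] at h ⊢
  have hfibers : (Finset.univ.filter fun ω => p (φ ω)).card =
      ∑ y ∈ Finset.univ.filter p, (Finset.univ.filter fun ω => φ ω = y).card := by
    rw [Finset.card_eq_sum_card_fiberwise (f := φ) (t := Finset.univ.filter p)
      fun ω hω => by simpa using hω]
    refine Finset.sum_congr rfl fun y hy => ?_
    rw [Finset.filter_filter]
    congr 1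
    grind
  rw [hfibers, Nat.cast_sum, Finset.sum_div, Finset.sum_congr rfl fun y _ => h y]
  simp [div_eq_mul_inv]

theorem comp {ψ : Ω' → Ω''} {φ : Ω → Ω'} (hψ : IsUniform ψ) (hφ : IsUniform φ) :
    IsUniform fun ω => ψ (φ ω) :=
  fun y => (hφ.prob_comp fun z => ψ z = y).trans (hψ y)

theorem of_bijective {φ : Ω → Ω'} (h : Function.Bijective φ) : IsUniform φ := fun y =>
  (prob_equiv (Equiv.ofBijective φ h) fun z => z = y).trans (prob_eq_const y)

theorem pi {ι : Type*} [Fintype ι] [DecidableEq ι] {φ : Ω → Ω'} (h : IsUniform φ) :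
    IsUniform fun (ω : ι → Ω) i => φ (ω i) := fun y => by
  simp only [funext_iff]
  rw [prob_forall_pi fun i ω => φ ω = y i]
  simp [h _]

theorem restrict {ι ι' : Type*} [Fintype ι] [DecidableEq ι] [Fintype ι'] [DecidableEq ι']
    [Nonempty Ω] {f : ι' → ι} (hf : Function.Injective f) :
    IsUniform fun (ω : ι → Ω) i => ω (f i) := fun y => by
  have hcoord : ∀ ω : ι → Ω, (fun i => ω (f i)) = y ↔ ∀ j, ∀ i, f i = j → ω j = y i := by grind
  have hmem : ∀ i, prob (fun ω : Ω => ∀ i', f i' = f i → ω = y i') = 1 / Fintype.card Ω :=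
    fun i => by
      rw [← prob_eq_const (y i)]
      exact prob_congr fun ω => ⟨fun h => h i rfl, fun h j hj => hf hj ▸ h⟩
  have hnotMem : ∀ j ∉ Finset.univ.image f, prob (fun ω : Ω => ∀ i, f i = j → ω = y i) = 1 :=
    fun j hj => by
      rw [← prob_true (Ω := Ω)]
      exact prob_congr fun ω => iff_of_true (by grind) trivial
  rw [prob_congr hcoord, prob_forall_pi fun j ω => ∀ i, f i = j → ω = y i,
    ← Finset.prod_subset (Finset.subset_univ (Finset.univ.image f)) fun j _ => hnotMem j,
    Finset.prod_image fun _ _ _ _ h => hf h, Finset.prod_congr rfl fun i _ => hmem i]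
  simp

end IsUniform

end IsUniform

/-! ### Independent trials and random blocks -/

theorem exists_subset_image_univ {Ω : Type*} [DecidableEq Ω] [Nonempty Ω] {U : Finset Ω}
    {u : ℕ} (hU : U.card ≤ u) : ∃ σ : Fin u → Ω, U ⊆ Finset.univ.image σ := by
  refine ⟨fun i => U.toList.getD i (Classical.arbitrary Ω), fun z hz => ?_⟩
  obtain ⟨i, hi, rfl⟩ := List.getElem_of_mem (Finset.mem_toList.2 hz)
  exact Finset.mem_image.2 ⟨⟨i, (by simpa using hi : i < U.card).trans_le hU⟩, Finset.mem_univ _,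
    by simp only [List.getD_eq_getElem _ _ hi]⟩

section Independence

variable {ι Ω : Type*} [Fintype ι] [DecidableEq ι] [Fintype Ω]

theorem prob_le_prod_le (g : ι → Ω → ℝ) (hg : ∀ i x, 0 ≤ g i x) {a : ℝ} (ha : 0 < a) :
    prob (fun ω : ι → Ω => a ≤ ∏ i, g i (ω i)) ≤ (∏ i, (∑ x, g i x) / Fintype.card Ω) / a := by
  classical
  rw [prob_eq_card_div_card, Finset.prod_div_distrib, le_div_iff₀ ha, div_mul_eq_mul_div]
  simp only [Fintype.card_pi, Finset.prod_const, Finset.card_univ, Nat.cast_pow]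
  gcongr
  rw [Fintype.prod_sum, ← nsmul_eq_mul]
  refine (Finset.card_nsmul_le_sum _ _ _ fun ω hω => (Finset.mem_filter.1 hω).2).trans ?_
  exact Finset.sum_le_sum_of_subset_of_nonneg (Finset.filter_subset _ _)
    fun ω _ _ => Finset.prod_nonneg fun i _ => hg _ _

theorem mean_vote_le [Nonempty Ω] {p : Ω → Prop} [DecidablePred p] (h : 2 / 3 ≤ prob p) :
    (∑ x, if p x then (2 / 3 : ℝ) else 3 / 2) / Fintype.card Ω ≤ 17 / 18 := by
  have hΩ : (0 : ℝ) < Fintype.card Ω := by exact_mod_cast Fintype.card_pos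
  have hsplit : ((Finset.univ.filter p).card : ℝ) + (Finset.univ.filter fun x => ¬ p x).card =
      Fintype.card Ω := by
    exact_mod_cast Finset.card_filter_add_card_filter_not (s := Finset.univ) p
  rw [prob_eq_card_div_card, le_div_iff₀ hΩ] at h
  rw [div_le_iff₀ hΩ, Finset.sum_ite, Finset.sum_const, Finset.sum_const, nsmul_eq_mul,
    nsmul_eq_mul]
  linarith

theorem prob_majority_wrong_le [Nonempty Ω] {p : Ω → Prop} [DecidablePred p]
    (h : 2 / 3 ≤ prob p) :
    prob (fun ω : ι → Ω => (Finset.univ.filter fun i => p (ω i)).card ≤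
      (Finset.univ.filter fun i => ¬ p (ω i)).card) ≤ (17 / 18) ^ Fintype.card ι := by
  -- A wrong vote counts `3 / 2` and a right one `2 / 3`; a wrong majority has product at least `1`.
  have hmarkov := prob_le_prod_le (ι := ι) (fun _ x => if p x then 2 / 3 else 3 / 2)
    (fun _ x => by split_ifs <;> norm_num) one_pos
  refine (prob_mono fun ω hω => ?_).trans (hmarkov.trans ?_)
  · rw [Finset.prod_ite, Finset.prod_const, Finset.prod_const]
    calc (1 : ℝ) = (2 / 3) ^ (Finset.univ.filter fun i => p (ω i)).card *
          (3 / 2) ^ (Finset.univ.filter fun i => p (ω i)).card := by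
          rw [← mul_pow]; norm_num
      _ ≤ _ := by
          gcongr
          norm_num
  · rw [div_one, Finset.prod_const, Finset.card_univ]
    refine pow_le_pow_left₀ (div_nonneg (Finset.sum_nonneg fun x _ => ?_) (by positivity))
      (mean_vote_le h) _
    split_ifs <;> norm_num

theorem prob_forall_mem (C : Finset Ω) :
    prob (fun x : ι → Ω => ∀ i, x i ∈ C) = ((C.card : ℝ) / Fintype.card Ω) ^ Fintype.card ι := by
  rw [prob_forall_pi fun _ x => x ∈ C]
  simp only [prob_mem, Finset.prod_const, Finset.card_univ]

theorem one_sub_pow_mul_le {q : ℝ} (h₀ : 0 ≤ q) (h₁ : q ≤ 1) (N : ℕ) :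
    (1 - q) ^ N * (1 + N * q) ≤ 1 := by
  calc (1 - q) ^ N * (1 + N * q) ≤ (1 - q) ^ N * (1 + q) ^ N := by
        refine mul_le_mul_of_nonneg_left ?_ (pow_nonneg (by linarith) _)
        exact one_add_mul_le_pow (by linarith) N
    _ = ((1 - q) * (1 + q)) ^ N := (mul_pow _ _ _).symm
    _ ≤ 1 := pow_le_one₀ (mul_nonneg (by linarith) (by linarith)) (by nlinarith)

variable {κ : Type*} [Fintype κ] [DecidableEq κ]

theorem prob_forall_not_block_subset_mul_le [Nonempty Ω] (C : Finset Ω) :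
    prob (fun x : κ → ι → Ω => ¬ ∃ i, ∀ j, x i j ∈ C) *
      (1 + Fintype.card κ * ((C.card : ℝ) / Fintype.card Ω) ^ Fintype.card ι) ≤ 1 := by
  rw [← prob_forall_mem (ι := ι)]
  simp only [not_exists]
  rw [prob_forall_pi fun _ (y : ι → Ω) => ¬ ∀ j, y j ∈ C]
  simp only [prob_not, Finset.prod_const, Finset.card_univ]
  exact one_sub_pow_mul_le (prob_nonneg _) (prob_le_one _) _

theorem prob_forall_blocks_mem {ν : Type*} [Fintype ν] [Nonempty Ω] {f : ν → κ}
    (hf : Function.Injective f) (C : Finset Ω) :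
    prob (fun x : κ → ι → Ω => ∀ i j, x (f i) j ∈ C) =
      ((C.card : ℝ) / Fintype.card Ω) ^ (Fintype.card ι * Fintype.card ν) := by
  classical
  rw [(IsUniform.restrict (Ω := ι → Ω) hf).prob_comp fun y => ∀ i j, y i j ∈ C,
    prob_forall_pi fun _ (y : ι → Ω) => ∀ j, y j ∈ C, prob_forall_mem, Finset.prod_const,
    Finset.card_univ, pow_mul]

theorem prob_exists_card_union_le_le [DecidableEq Ω] [Nonempty Ω] (k u : ℕ) :
    prob (fun x : κ → ι → Ω => ∃ f : Fin k → κ, Function.Injective f ∧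
      (Finset.univ.biUnion fun i => Finset.univ.image (x (f i))).card ≤ u) ≤
      (Fintype.card κ : ℝ) ^ k * Fintype.card Ω ^ u *
        ((u : ℝ) / Fintype.card Ω) ^ (Fintype.card ι * k) := by
  have hcover : ∀ x : κ → ι → Ω, (∃ f : Fin k → κ, Function.Injective f ∧
      (Finset.univ.biUnion fun i => Finset.univ.image (x (f i))).card ≤ u) →
      ∃ y ∈ (Finset.univ : Finset ((Fin k → κ) × (Fin u → Ω))), Function.Injective y.1 ∧
        ∀ i j, x (y.1 i) j ∈ Finset.univ.image y.2 := by
    rintro x ⟨f, hf, hfu⟩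
    obtain ⟨σ, hσ⟩ := exists_subset_image_univ hfu
    exact ⟨(f, σ), Finset.mem_univ _, hf, fun i j => hσ (by simp)⟩
  have hbound : ∀ y : (Fin k → κ) × (Fin u → Ω), prob (fun x : κ → ι → Ω =>
      Function.Injective y.1 ∧ ∀ i j, x (y.1 i) j ∈ Finset.univ.image y.2) ≤
        ((u : ℝ) / Fintype.card Ω) ^ (Fintype.card ι * k) := by
    rintro ⟨f, σ⟩
    by_cases hf : Function.Injective f
    · refine (prob_mono fun x hx => hx.2).trans ((prob_forall_blocks_mem hf _).trans_le ?_)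
      rw [Fintype.card_fin]
      gcongr
      exact Finset.card_image_le.trans (by simp)
    · simp only [hf, false_and, prob_false]
      positivity
  refine (prob_mono hcover).trans ((prob_exists_le _ _).trans
    ((Finset.sum_le_sum fun y _ => hbound y).trans_eq ?_))
  simp

end Independence

/-! ### Random graphs have no certificates -/

section RandomGraph

variable {V : Type*}

open Classical in
/-- Graphs as independent choices of the edges. -/
noncomputable def edgeEquiv (V : Type*) :
    SimpleGraph V ≃ ({e : Sym2 V // ¬ e.IsDiag} → Bool) where
  toFun G e := decide (e.1 ∈ G.edgeSet)
  invFun f := SimpleGraph.fromEdgeSet {e | ∃ h, f ⟨e, h⟩ = true}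
  left_inv G := by
    ext u v
    simp only [decide_eq_true_eq, SimpleGraph.fromEdgeSet_adj, Set.mem_ofPred_eq,
      SimpleGraph.mem_edgeSet, Sym2.mk_isDiag_iff, exists_prop]
    exact ⟨fun h => h.1.2, fun h => ⟨⟨h.ne, h⟩, h.ne⟩⟩
  right_inv f := by
    funext ⟨e, he⟩
    have hmem : e ∈ (SimpleGraph.fromEdgeSet {e | ∃ h, f ⟨e, h⟩ = true}).edgeSet ↔
        f ⟨e, he⟩ = true := by
      rw [SimpleGraph.edgeSet_fromEdgeSet]
      exact ⟨fun h => h.1.2, fun h => ⟨⟨he, h⟩, he⟩⟩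
    simp only [hmem, Bool.decide_eq_true]

theorem edgeEquiv_apply (G : SimpleGraph V) (e : {e : Sym2 V // ¬ e.IsDiag}) :
    edgeEquiv V G e = true ↔ e.1 ∈ G.edgeSet := by
  simp [edgeEquiv]

theorem card_le_two_mul_card_image_mk [DecidableEq V] (F : Finset (V × V)) :
    F.card ≤ 2 * (F.image fun x => s(x.1, x.2)).card := by
  refine Finset.card_le_mul_card_image F 2 fun e _ => ?_
  induction e using Sym2.ind with
  | _ u v =>
    refine (Finset.card_le_card (t := {(u, v), (v, u)}) fun x hx => ?_).trans Finset.card_le_two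
    simp only [Finset.mem_filter, Sym2.eq_iff] at hx
    simpa only [Finset.mem_insert, Finset.mem_singleton, Prod.ext_iff] using hx.2

variable [Fintype V]

theorem prob_subset_edgeSet_le [DecidableEq V] (E : Finset (Sym2 V)) :
    prob (fun G : SimpleGraph V => (E : Set (Sym2 V)) ⊆ G.edgeSet) ≤ (1 / 2) ^ E.card := by
  classical
  by_cases hdiag : ∃ e ∈ E, e.IsDiag
  · obtain ⟨e, he, hdiag⟩ := hdiag
    refine (prob_mono (q := fun _ => False) fun G hG => ?_).trans (by rw [prob_false]; positivity)
    exact G.not_isDiag_of_mem_edgeSet (hG he) hdiag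
  push Not at hdiag
  let p : {e : Sym2 V // ¬ e.IsDiag} → Bool → Prop := fun e b => e.1 ∈ E → b = true
  have hcoin : ∀ e, prob (p e) = if e.1 ∈ E then 1 / 2 else 1 := by
    intro e
    split_ifs with he <;> simp [p, prob_eq_card_div_card, he, Finset.filter_insert,
      Finset.filter_singleton]
  have hcard : (Finset.univ.filter fun e : {e : Sym2 V // ¬ e.IsDiag} => e.1 ∈ E).card =
      E.card := by
    rw [← Fintype.card_subtype, ← Fintype.card_coe E]
    exact Fintype.card_congr ⟨fun e => ⟨e.1.1, e.2⟩, fun e => ⟨⟨e.1, hdiag _ e.2⟩, e.2⟩,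
      fun _ => rfl, fun _ => rfl⟩
  calc prob (fun G : SimpleGraph V => (E : Set (Sym2 V)) ⊆ G.edgeSet)
      ≤ prob (fun G : SimpleGraph V => ∀ e, p e (edgeEquiv V G e)) :=
        prob_mono fun G hG e he => (edgeEquiv_apply G e).2 (hG he)
    _ = (1 / 2) ^ E.card := by
        rw [prob_equiv (edgeEquiv V) fun f => ∀ e, p e (f e), prob_forall_pi,
          Finset.prod_congr rfl fun e _ => hcoin e, Finset.prod_ite, Finset.prod_const_one,
          mul_one, Finset.prod_const, hcard]

theorem prob_forall_adj_le [DecidableEq V] (F : Finset (V × V)) {e : ℕ} (he : 2 * e ≤ F.card) :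
    prob (fun G : SimpleGraph V => ∀ x ∈ F, G.Adj x.1 x.2) ≤ (1 / 2) ^ e := by
  classical
  have hcard := card_le_two_mul_card_image_mk F
  refine (prob_mono fun G hG => ?_).trans
    ((prob_subset_edgeSet_le (F.image fun x => s(x.1, x.2))).trans
      (pow_le_pow_of_le_one (by norm_num) (by norm_num) (by omega)))
  rw [Finset.coe_image]
  rintro _ ⟨x, hx, rfl⟩
  exact hG x hx

end RandomGraph

section Certificate

variable {V : Type*} [Fintype V]

open Classical in
/-- The pairs of vertices in adjacent blocks. -/
noncomputable def blockPairs {ι : Type*} (G : SimpleGraph V) (B : ι → Finset V) :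
    Finset (V × V) :=
  Finset.univ.filter fun x => ∃ i j, x.1 ∈ B i ∧ x.2 ∈ B j ∧ ∀ u ∈ B i, ∀ v ∈ B j, G.Adj u v

/-- A certificate that `G` is not a typical random graph: describing the blocks `B` and which of
them are adjacent takes fewer bits than the pairs in adjacent blocks have entropy. -/
def HasCertificate (G : SimpleGraph V) : Prop :=
  ∃ (b r : ℕ) (B : Fin r → Finset V), Fintype.card V ≤ 2 ^ b ∧
    8 * (b * ∑ i, (B i).card + r ^ 2) < (blockPairs G B).card

theorem mem_blockPairs {ι : Type*} {G : SimpleGraph V} {B : ι → Finset V} {x : V × V} :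
    x ∈ blockPairs G B ↔ ∃ i j, x.1 ∈ B i ∧ x.2 ∈ B j ∧ ∀ u ∈ B i, ∀ v ∈ B j, G.Adj u v := by
  simp only [blockPairs, Finset.mem_filter, Finset.mem_univ, true_and]

theorem blockPairs_eq_empty {ι : Type*} [Fintype ι] (G : SimpleGraph V) {B : ι → Finset V}
    (hB : ∑ i, (B i).card = 0) : blockPairs G B = ∅ := by
  refine Finset.eq_empty_of_forall_notMem fun x hx => ?_
  obtain ⟨i, j, hi, -⟩ := mem_blockPairs.1 hx
  exact Finset.card_ne_zero_of_mem hi (Finset.sum_eq_zero_iff.1 hB i (Finset.mem_univ i))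

theorem prob_lt_card_blockPairs_le [DecidableEq V] {ι : Type*} [Fintype ι] (B : ι → Finset V)
    (N : ℕ) :
    prob (fun G : SimpleGraph V => 8 * N < (blockPairs G B).card) ≤
      2 ^ Fintype.card ι ^ 2 * (1 / 2) ^ (4 * N) := by
  classical
  let joined : SimpleGraph V → Finset (ι × ι) := fun G =>
    Finset.univ.filter fun y => ∀ u ∈ B y.1, ∀ v ∈ B y.2, G.Adj u v
  let pairs : Finset (ι × ι) → Finset (V × V) := fun π =>
    Finset.univ.filter fun x => ∃ y ∈ π, x.1 ∈ B y.1 ∧ x.2 ∈ B y.2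
  have hsub : ∀ G, blockPairs G B ⊆ pairs (joined G) := by
    intro G x hx
    obtain ⟨i, j, hi, hj, h⟩ := mem_blockPairs.1 hx
    exact Finset.mem_filter.2 ⟨Finset.mem_univ _, (i, j), Finset.mem_filter.2
      ⟨Finset.mem_univ _, h⟩, hi, hj⟩
  have hadj : ∀ G, ∀ x ∈ pairs (joined G), G.Adj x.1 x.2 := by
    intro G x hx
    obtain ⟨y, hy, h₁, h₂⟩ := (Finset.mem_filter.1 hx).2
    exact (Finset.mem_filter.1 hy).2 _ h₁ _ h₂
  have hbound : ∀ π : Finset (ι × ι), prob (fun G : SimpleGraph V =>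
      2 * (4 * N) ≤ (pairs π).card ∧ ∀ x ∈ pairs π, G.Adj x.1 x.2) ≤ (1 / 2) ^ (4 * N) := by
    intro π
    by_cases hπ : 2 * (4 * N) ≤ (pairs π).card
    · exact (prob_mono fun G hG => hG.2).trans (prob_forall_adj_le _ hπ)
    · simp only [hπ, false_and, prob_false]
      positivity
  have hunion := prob_exists_le Finset.univ fun (π : Finset (ι × ι)) (G : SimpleGraph V) =>
    2 * (4 * N) ≤ (pairs π).card ∧ ∀ x ∈ pairs π, G.Adj x.1 x.2
  refine (prob_mono fun G hG => ?_).trans (hunion.trans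
    ((Finset.sum_le_sum fun π _ => hbound π).trans_eq ?_))
  · exact ⟨joined G, Finset.mem_univ _,
      by have := Finset.card_le_card (hsub G); omega, hadj G⟩
  · simp [sq]

theorem half_pow_mul_le {n b s : ℕ} (hn : 1 ≤ n) (hb : n ≤ 2 ^ b) (hs : 1 ≤ s) :
    (1 / 2 : ℝ) ^ (4 * (b * s)) ≤ (1 / n) ^ s * (1 / n) := by
  have hn' : (1 : ℝ) ≤ n := by exact_mod_cast hn
  have hinv : (1 / 2 : ℝ) ^ b ≤ 1 / n := by
    rw [one_div_pow]
    exact one_div_le_one_div_of_le (by linarith) (by exact_mod_cast hb)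
  calc (1 / 2 : ℝ) ^ (4 * (b * s)) = ((1 / 2) ^ b) ^ (s * 4) := by rw [← pow_mul]; ring_nf
    _ ≤ (1 / n) ^ (s * 4) := by gcongr
    _ ≤ (1 / n) ^ (s + 1) :=
        pow_le_pow_of_le_one (by positivity) ((div_le_one (by linarith)).2 hn') (by omega)
    _ = (1 / n) ^ s * (1 / n) := pow_succ _ _

theorem prob_certificate_le [DecidableEq V] [Nonempty V] {r b : ℕ}
    (hb : Fintype.card V ≤ 2 ^ b) (B : Fin r → Finset V) :
    prob (fun G : SimpleGraph V => 8 * (b * ∑ i, (B i).card + r ^ 2) < (blockPairs G B).card) ≤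
      (1 / 8) ^ r ^ 2 * (∏ i, (1 / (Fintype.card V : ℝ)) ^ (B i).card) *
        (1 / Fintype.card V) := by
  rcases Nat.eq_zero_or_pos (∑ i, (B i).card) with hs | hs
  · simp only [blockPairs_eq_empty _ hs, Finset.card_empty, Nat.not_lt_zero, prob_false]
    positivity
  refine (prob_lt_card_blockPairs_le B _).trans ?_
  rw [Finset.prod_pow_eq_pow_sum, Fintype.card_fin]
  set s := ∑ i, (B i).card
  calc (2 : ℝ) ^ r ^ 2 * (1 / 2) ^ (4 * (b * s + r ^ 2))
      = (2 * (1 / 2) ^ 4) ^ r ^ 2 * (1 / 2) ^ (4 * (b * s)) := by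
        rw [mul_add, pow_add, mul_pow, pow_mul (1 / 2 : ℝ) 4 (r ^ 2)]
        rw [mul_comm ((1 / 2 : ℝ) ^ (4 * (b * s))), mul_assoc]
    _ ≤ (1 / 8) ^ r ^ 2 * ((1 / (Fintype.card V : ℝ)) ^ s * (1 / Fintype.card V)) := by
        rw [show (2 * (1 / 2) ^ 4 : ℝ) = 1 / 8 by norm_num]
        gcongr
        exact half_pow_mul_le Fintype.card_pos hb hs
    _ = _ := (mul_assoc _ _ _).symm

theorem sum_inv_pow_card_le [Nonempty V] :
    ∑ S : Finset V, (1 / (Fintype.card V : ℝ)) ^ S.card ≤ 4 := by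
  have hn : (Fintype.card V : ℝ) ≠ 0 := by exact_mod_cast Fintype.card_ne_zero
  calc ∑ S : Finset V, (1 / (Fintype.card V : ℝ)) ^ S.card
      = (1 / Fintype.card V + 1) ^ Fintype.card V := by
        simpa using Fintype.sum_pow_mul_eq_add_pow V (1 / (Fintype.card V : ℝ)) 1
    _ ≤ Real.exp (1 / Fintype.card V) ^ Fintype.card V := by
        gcongr
        exact Real.add_one_le_exp _
    _ = Real.exp 1 := by rw [← Real.exp_nat_mul, mul_one_div_cancel hn]
    _ ≤ 4 := by linarith [Real.exp_one_lt_d9]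

theorem sum_prod_inv_pow_card_le [Nonempty V] (r : ℕ) :
    ∑ B : Fin r → Finset V, ∏ i, (1 / (Fintype.card V : ℝ)) ^ (B i).card ≤ 4 ^ r := by
  classical
  rw [← Fintype.prod_sum fun (_ : Fin r) (S : Finset V) => (1 / (Fintype.card V : ℝ)) ^ S.card,
    Finset.prod_const, Finset.card_univ, Fintype.card_fin]
  gcongr
  exact sum_inv_pow_card_le

theorem sum_prob_certificate_le [DecidableEq V] [Nonempty V] {r b : ℕ}
    (hb : Fintype.card V ≤ 2 ^ b) :
    ∑ B : Fin r → Finset V, prob (fun G : SimpleGraph V =>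
      8 * (b * ∑ i, (B i).card + r ^ 2) < (blockPairs G B).card) ≤
      (1 / 2) ^ r * (1 / Fintype.card V) := by
  refine (Finset.sum_le_sum fun B _ => prob_certificate_le hb B).trans ?_
  rw [← Finset.sum_mul, ← Finset.mul_sum]
  gcongr
  calc (1 / 8 : ℝ) ^ r ^ 2 * ∑ B : Fin r → Finset V, ∏ i, (1 / (Fintype.card V : ℝ)) ^ (B i).card
      ≤ (1 / 8) ^ r * 4 ^ r := by
        gcongr ?_ * ?_
        · exact pow_le_pow_of_le_one (by norm_num) (by norm_num) (Nat.le_self_pow two_ne_zero r)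
        · exact sum_prod_inv_pow_card_le r
    _ = (1 / 2) ^ r := by rw [← mul_pow]; norm_num

theorem sum_Icc_half_pow_le (n : ℕ) : ∑ r ∈ Finset.Icc 1 n, (1 / 2 : ℝ) ^ r ≤ 1 := by
  have hsum : ∑ r ∈ Finset.Icc 1 n, (1 / 2 : ℝ) ^ r = 1 - (1 / 2) ^ n := by
    induction n with
    | zero => simp
    | succ n ih =>
      rw [Finset.sum_Icc_succ_top (by omega), ih]
      ring
  rw [hsum]
  exact sub_le_self _ (by positivity)

theorem prob_hasCertificate_le [DecidableEq V] [Nonempty V] :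
    prob (fun G : SimpleGraph V => HasCertificate G) ≤ 1 / Fintype.card V := by
  set n := Fintype.card V
  let p : (r : ℕ) → (Fin r → Finset V) → SimpleGraph V → Prop := fun r B G =>
    8 * (Nat.clog 2 n * ∑ i, (B i).card + r ^ 2) < (blockPairs G B).card
  have hp : ∀ G : SimpleGraph V, HasCertificate G →
      ∃ r ∈ Finset.Icc 1 n, ∃ B ∈ (Finset.univ : Finset (Fin r → Finset V)), p r B G := by
    rintro G ⟨b, r, B, hb, hcert⟩
    have hclog : p r B G := hcert.trans_le' (by gcongr; exact Nat.clog_le_of_le_pow hb)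
    refine ⟨r, Finset.mem_Icc.2 ⟨Nat.pos_of_ne_zero ?_, ?_⟩, B, Finset.mem_univ _, hclog⟩
    · rintro rfl
      simp [blockPairs_eq_empty] at hcert
    · have hcard : (blockPairs G B).card ≤ n ^ 2 := by
        simpa [sq] using Finset.card_le_univ (blockPairs G B)
      exact (Nat.pow_le_pow_iff_left two_ne_zero).1 (by omega)
  calc prob (fun G : SimpleGraph V => HasCertificate G)
      ≤ ∑ r ∈ Finset.Icc 1 n, ∑ B : Fin r → Finset V, prob (p r B) :=
        (prob_mono hp).trans ((prob_exists_le _ _).trans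
          (Finset.sum_le_sum fun r _ => prob_exists_le _ _))
    _ ≤ ∑ r ∈ Finset.Icc 1 n, (1 / 2) ^ r * (1 / (n : ℝ)) :=
        Finset.sum_le_sum fun r _ => sum_prob_certificate_le (Nat.le_pow_clog one_lt_two _)
    _ ≤ 1 / n := by
        rw [← Finset.sum_mul]
        exact mul_le_of_le_one_left (by positivity) (sum_Icc_half_pow_le n)

end Certificate

/-! ### Dense patterns -/

theorem card_mul_sq_le_card_biUnion_product {V β : Type*} [DecidableEq β]
    {F : V → Finset β} (hF : Pairwise (Function.onFun Disjoint F)) {s : ℕ} (E : Finset (V × V))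
    (hE : ∀ e ∈ E, s ≤ 2 * (F e.1).card ∧ s ≤ 2 * (F e.2).card) :
    E.card * s ^ 2 ≤ 4 * (E.biUnion fun e => F e.1 ×ˢ F e.2).card := by
  rw [Finset.card_biUnion, Finset.mul_sum, ← smul_eq_mul, ← Finset.sum_const]
  · refine Finset.sum_le_sum fun e he => ?_
    obtain ⟨h₁, h₂⟩ := hE e he
    rw [Finset.card_product]
    nlinarith [Nat.mul_le_mul h₁ h₂]
  · intro e _ e' _ hee'
    rw [Function.onFun, Finset.disjoint_product]
    by_contra! hne
    exact hee' (Prod.ext (by_contra fun h => hne.1 (hF h)) (by_contra fun h => hne.2 (hF h)))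

section Dense

variable {V : Type*} [Fintype V]

open Classical in
/-- Every set of at least `1 / (8 a)` of the vertices spans at least `1 / 16` of the ordered pairs.
Random patterns are dense in this sense, and copies of dense patterns are certificates. -/
def Dense (a : ℕ) (H : SimpleGraph V) : Prop :=
  ∀ W : Finset V, Fintype.card V ≤ 8 * a * W.card → W.card ^ 2 ≤ 16 * (H.interedges W W).card

theorem card_le_mul_card_filter_le {a s : ℕ} (hs : 1 ≤ s) {c : V → ℕ} (hc : ∀ i, c i ≤ 4 * a * s)
    (hsum : Fintype.card V * s ≤ ∑ i, c i) :
    Fintype.card V ≤ 8 * a * (Finset.univ.filter fun i => s ≤ 2 * c i).card := by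
  have hle : ∑ i, 2 * c i ≤ ∑ i, (s + if s ≤ 2 * c i then 8 * a * s else 0) := by
    gcongr with i
    have := hc i
    split_ifs <;> linarith
  rw [Finset.sum_add_distrib, ← Finset.mul_sum, ← Finset.sum_filter] at hle
  simp only [Finset.sum_const, Finset.card_univ, smul_eq_mul] at hle
  refine Nat.le_of_mul_le_mul_right ?_ hs
  linarith

theorem Dense.exists_pairs {a s : ℕ} {H : SimpleGraph V} (hH : Dense a H) (hs : 1 ≤ s)
    {β : Type*} [DecidableEq β] {B : V → Finset β} (hB : ∀ i, (B i).card ≤ 4 * a * s)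
    (hunion : Fintype.card V * s ≤ (Finset.univ.biUnion B).card) :
    ∃ X : Finset (β × β), (∀ x ∈ X, ∃ i j, H.Adj i j ∧ x.1 ∈ B i ∧ x.2 ∈ B j) ∧
      Fintype.card V ^ 2 * s ^ 2 ≤ 4096 * a ^ 2 * X.card := by
  classical
  obtain ⟨F, hFB, hFunion, hF⟩ := Fintype.exists_disjointed_le B
  simp only [Finset.sup_eq_biUnion] at hFunion
  rw [← hFunion, Finset.card_biUnion fun i _ j _ hij => hF hij] at hunion
  set W := Finset.univ.filter fun i => s ≤ 2 * (F i).card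
  have hW : Fintype.card V ≤ 8 * a * W.card := card_le_mul_card_filter_le hs
    (fun i => (Finset.card_le_card (hFB i)).trans (hB i)) hunion
  set E := H.interedges W W
  have hpairs := card_mul_sq_le_card_biUnion_product hF (s := s) E fun e he =>
    have hmem := H.mem_interedges_iff.1 he
    ⟨(Finset.mem_filter.1 hmem.1).2, (Finset.mem_filter.1 hmem.2.1).2⟩
  refine ⟨E.biUnion fun e => F e.1 ×ˢ F e.2, fun x hx => ?_, ?_⟩
  · obtain ⟨e, he, hxe⟩ := Finset.mem_biUnion.1 hx
    obtain ⟨h₁, h₂⟩ := Finset.mem_product.1 hxe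
    exact ⟨e.1, e.2, (H.mem_interedges_iff.1 he).2.2, hFB _ h₁, hFB _ h₂⟩
  · calc Fintype.card V ^ 2 * s ^ 2 ≤ (8 * a * W.card) ^ 2 * s ^ 2 := by gcongr
      _ = 64 * a ^ 2 * W.card ^ 2 * s ^ 2 := by ring
      _ ≤ 64 * a ^ 2 * (16 * E.card) * s ^ 2 := by gcongr; exact hH W hW
      _ = 1024 * a ^ 2 * (E.card * s ^ 2) := by ring
      _ ≤ 1024 * a ^ 2 * (4 * (E.biUnion fun e => F e.1 ×ˢ F e.2).card) := by gcongr
      _ = 4096 * a ^ 2 * (E.biUnion fun e => F e.1 ×ˢ F e.2).card := by ring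

end Dense

section RandomPattern

theorem prob_four_mul_card_filter_le {ι : Type*} [Fintype ι] [DecidableEq ι] (E : Finset ι) :
    prob (fun ω : ι → Bool => 4 * (E.filter fun i => ω i).card ≤ E.card) ≤
      (9 / 10) ^ E.card := by
  -- A present edge counts `(4 / 5) ^ 3` and a missing one `5 / 4`; the mean is less than `9 / 10`.
  let weight : ι → Bool → ℝ := fun i b => if i ∈ E then (if b then (4 / 5) ^ 3 else 5 / 4) else 1
  have hweight : ∀ i b, 0 ≤ weight i b := fun i b => by
    simp only [weight]; split_ifs <;> norm_num
  refine (prob_mono fun ω hω => ?_).trans ((prob_le_prod_le weight hweight one_pos).trans ?_)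
  · have hsplit := Finset.card_filter_add_card_filter_not (s := E) fun i => ω i
    calc (1 : ℝ) = ((4 / 5) ^ 3) ^ (E.filter fun i => ω i).card *
          (5 / 4) ^ (3 * (E.filter fun i => ω i).card) := by
          rw [← pow_mul, ← mul_pow]; norm_num
      _ ≤ ((4 / 5) ^ 3) ^ (E.filter fun i => ω i).card *
          (5 / 4) ^ (E.filter fun i => ¬ ω i).card := by
          gcongr
          · norm_num
          · omega
      _ = ∏ i, weight i (ω i) := by
          rw [Finset.prod_ite_mem, Finset.univ_inter, Finset.prod_ite, Finset.prod_const,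
            Finset.prod_const]
  · have hmean : ∀ i, (∑ b, weight i b) / (Fintype.card Bool : ℝ) ≤
        if i ∈ E then 9 / 10 else 1 := by
      intro i
      simp only [weight, Fintype.sum_bool, Fintype.card_bool]
      split_ifs <;> norm_num
    rw [div_one]
    refine (Finset.prod_le_prod (fun i _ => div_nonneg (Finset.sum_nonneg fun b _ => hweight i b)
      (Nat.cast_nonneg _)) fun i _ => hmean i).trans_eq ?_
    rw [Finset.prod_ite_mem, Finset.univ_inter, Finset.prod_const]

variable {V : Type*} [Fintype V] [DecidableEq V]

theorem card_filter_mem_image_offDiag (W : Finset V) :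
    (Finset.univ.filter fun e : {e : Sym2 V // ¬ e.IsDiag} =>
      e.1 ∈ W.offDiag.image Sym2.mk.uncurry).card = W.card.choose 2 := by
  rw [← Sym2.card_image_offDiag, ← Finset.card_image_of_injective _ Subtype.val_injective]
  congr 1
  ext e
  simp only [Finset.mem_image, Finset.mem_filter, Finset.mem_univ, true_and, Subtype.exists,
    exists_and_right, exists_eq_right]
  refine ⟨fun ⟨_, h⟩ => h, fun h => ⟨?_, h⟩⟩
  obtain ⟨⟨u, v⟩, huv, rfl⟩ := h
  simpa using (Finset.mem_offDiag.1 huv).2.2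

open Classical in
theorem prob_four_mul_card_interedges_le (W : Finset V) :
    prob (fun H : SimpleGraph V => 4 * (H.interedges W W).card ≤ W.card.choose 2) ≤
      (9 / 10) ^ W.card.choose 2 := by
  set E := Finset.univ.filter fun e : {e : Sym2 V // ¬ e.IsDiag} =>
    e.1 ∈ W.offDiag.image Sym2.mk.uncurry
  have hE : E.card = W.card.choose 2 := card_filter_mem_image_offDiag W
  have hedges : ∀ H : SimpleGraph V,
      (E.filter fun e => edgeEquiv V H e).card ≤ (H.interedges W W).card := by
    intro H
    rw [← Finset.card_image_of_injective _ Subtype.val_injective]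
    refine (Finset.card_le_card (t := (H.interedges W W).image Sym2.mk.uncurry)
      fun e he => ?_).trans Finset.card_image_le
    obtain ⟨e', he', rfl⟩ := Finset.mem_image.1 he
    obtain ⟨heE, hadj⟩ := Finset.mem_filter.1 he'
    obtain ⟨x, hx, hxe⟩ := Finset.mem_image.1 (Finset.mem_filter.1 heE).2
    obtain ⟨h₁, h₂, -⟩ := Finset.mem_offDiag.1 hx
    rw [edgeEquiv_apply, ← hxe] at hadj
    exact Finset.mem_image.2 ⟨x, H.mem_interedges_iff.2 ⟨h₁, h₂, hadj⟩, hxe⟩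
  have hcoins := prob_four_mul_card_filter_le E
  rw [← prob_equiv (edgeEquiv V), hE] at hcoins
  exact (prob_mono fun H hH => (Nat.mul_le_mul_left 4 (hedges H)).trans hH).trans hcoins

theorem sq_le_four_mul_choose_two {m : ℕ} (hm : 2 ≤ m) : m ^ 2 ≤ 4 * m.choose 2 := by
  obtain ⟨m, rfl⟩ := Nat.exists_eq_add_of_le' (by omega : 1 ≤ m)
  have hchoose : 2 * (m + 1).choose 2 = (m + 1) * m := by
    rw [Nat.choose_two_right, Nat.mul_div_cancel' (Nat.even_mul_pred_self _).two_dvd,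
      Nat.add_sub_cancel]
  nlinarith

theorem mul_le_choose_two {a k m : ℕ} (ha : 1 ≤ a) (hk : 3584 * a ^ 2 ≤ k) (hm : k ≤ 8 * a * m) :
    14 * k ≤ m.choose 2 ∧ m ^ 2 ≤ 4 * m.choose 2 := by
  have hm2 : 2 ≤ m := by
    by_contra! hlt
    have : 8 * a * m ≤ 8 * a * 1 := by gcongr; omega
    nlinarith
  have hsq := sq_le_four_mul_choose_two hm2
  refine ⟨le_of_mul_le_mul_left (a := 256 * a ^ 2) ?_ (by positivity), hsq⟩
  calc 256 * a ^ 2 * (14 * k) = 3584 * a ^ 2 * k := by ring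
    _ ≤ k * k := by gcongr
    _ ≤ (8 * a * m) * (8 * a * m) := by gcongr
    _ = 64 * a ^ 2 * m ^ 2 := by ring
    _ ≤ 64 * a ^ 2 * (4 * m.choose 2) := by gcongr
    _ = 256 * a ^ 2 * m.choose 2 := by ring

theorem prob_not_dense_le {a : ℕ} (ha : 1 ≤ a) (hV : 3584 * a ^ 2 ≤ Fintype.card V) :
    prob (fun H : SimpleGraph V => ¬ Dense a H) ≤ (1 / 2) ^ Fintype.card V := by
  classical
  set k := Fintype.card V
  calc prob (fun H : SimpleGraph V => ¬ Dense a H)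
      ≤ prob (fun H : SimpleGraph V => ∃ W ∈ Finset.univ.filter fun W : Finset V =>
          k ≤ 8 * a * W.card, 4 * (H.interedges W W).card ≤ W.card.choose 2) :=
        prob_mono fun H hH => by
          simp only [Dense, not_forall, not_le] at hH
          obtain ⟨W, hW, hsparse⟩ := hH
          have := (mul_le_choose_two ha hV hW).2
          exact ⟨W, Finset.mem_filter.2 ⟨Finset.mem_univ _, hW⟩, by omega⟩
    _ ≤ ∑ _W ∈ Finset.univ.filter fun W : Finset V => k ≤ 8 * a * W.card, (1 / 4 : ℝ) ^ k := by
        refine (prob_exists_le _ _).trans (Finset.sum_le_sum fun W hW => ?_)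
        calc _ ≤ ((9 / 10 : ℝ)) ^ W.card.choose 2 := prob_four_mul_card_interedges_le W
          _ ≤ (9 / 10) ^ (14 * k) := pow_le_pow_of_le_one (by norm_num) (by norm_num)
              (mul_le_choose_two ha hV (Finset.mem_filter.1 hW).2).1
          _ = ((9 / 10) ^ 14) ^ k := pow_mul _ _ _
          _ ≤ (1 / 4) ^ k := by gcongr; norm_num
    _ ≤ 2 ^ k * (1 / 4 : ℝ) ^ k := by
        rw [Finset.sum_const, nsmul_eq_mul]
        gcongr
        exact_mod_cast (Finset.card_filter_le _ _).trans_eq Fintype.card_finset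
    _ = (1 / 2) ^ k := by rw [← mul_pow]; norm_num

end RandomPattern

/-! ### Trees as lists -/

namespace BTree

/-- The number of nodes of a tree, leaves included. -/
def size : BTree → ℕ
  | leaf => 1
  | node l r => l.size + r.size + 1

/-- The list encoded by a tree; inverse to `ofList`. -/
def toList : BTree → List BTree
  | leaf => []
  | node a l => a :: toList l

/-- The length of a tree read as a list; trees also serve as unary numbers. -/
def len (x : BTree) : ℕ := x.toList.length

/-- The natural number `i` in unary. -/
def num : ℕ → BTree
  | 0 => leaf
  | i + 1 => node leaf (num i)

@[simp] theorem left_leaf : leaf.left = leaf := rfl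
@[simp] theorem right_leaf : leaf.right = leaf := rfl
@[simp] theorem left_node (a b : BTree) : (node a b).left = a := rfl
@[simp] theorem right_node (a b : BTree) : (node a b).right = b := rfl
@[simp] theorem truth_leaf : leaf.truth = false := rfl
@[simp] theorem truth_node (a b : BTree) : (node a b).truth = true := rfl
@[simp] theorem toList_leaf : leaf.toList = [] := rfl
@[simp] theorem toList_node (a b : BTree) : (node a b).toList = a :: b.toList := rfl
@[simp] theorem ofList_nil : ofList [] = leaf := rfl
@[simp] theorem ofList_cons (a : BTree) (l : List BTree) :
    ofList (a :: l) = node a (ofList l) := rfl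
@[simp] theorem size_leaf : leaf.size = 1 := rfl
@[simp] theorem size_node (a b : BTree) : (node a b).size = a.size + b.size + 1 := rfl
@[simp] theorem len_leaf : leaf.len = 0 := rfl
@[simp] theorem len_node (a b : BTree) : (node a b).len = b.len + 1 := rfl

@[simp] theorem toList_ofList (l : List BTree) : (ofList l).toList = l := by
  induction l with
  | nil => rfl
  | cons a l ih => simp [ih]

@[simp] theorem ofList_toList (x : BTree) : ofList x.toList = x := by
  induction x with
  | leaf => rfl
  | node a l _ ih => simp [ih]

@[simp] theorem len_ofList (l : List BTree) : (ofList l).len = l.length := by simp [len]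

@[simp] theorem truth_ofBool (b : Bool) : (ofBool b).truth = b := by cases b <;> rfl

@[simp] theorem len_num (i : ℕ) : (num i).len = i := by
  induction i with
  | zero => rfl
  | succ i ih => simp [num, ih]

theorem size_num (i : ℕ) : (num i).size = 2 * i + 1 := by
  induction i with
  | zero => rfl
  | succ i ih => simp [num, ih]; omega

theorem toList_num (i : ℕ) : (num i).toList = List.replicate i leaf := by
  induction i with
  | zero => rfl
  | succ i ih => simp [num, ih, List.replicate_succ]

theorem ofList_replicate (i : ℕ) : ofList (List.replicate i leaf) = num i := by
  rw [← toList_num, ofList_toList]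

theorem truth_ofList (l : List BTree) : (ofList l).truth = true ↔ l ≠ [] := by
  cases l <;> simp

theorem one_le_size (x : BTree) : 1 ≤ x.size := by cases x <;> simp

theorem size_ofBool_le (b : Bool) : (ofBool b).size ≤ 3 := by cases b <;> simp [ofBool]

theorem size_left_le (x : BTree) : x.left.size ≤ x.size := by
  cases x <;> simp; omega

theorem size_right_le (x : BTree) : x.right.size ≤ x.size := by
  cases x <;> simp; omega

theorem size_ofList (l : List BTree) : (ofList l).size = (l.map fun a => a.size + 1).sum + 1 := by
  induction l with
  | nil => rfl
  | cons a l ih => simp [ih]; omega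

theorem len_lt_size (x : BTree) : x.len < x.size := by
  induction x with
  | leaf => simp
  | node a b _ ih => simp only [len_node, size_node]; omega

theorem size_lt_of_mem_toList {a x : BTree} (h : a ∈ x.toList) : a.size < x.size := by
  have := List.single_le_sum (fun _ _ => Nat.zero_le _) _
    (List.mem_map_of_mem (f := fun a : BTree => a.size + 1) h)
  rw [← ofList_toList x, size_ofList]
  omega

theorem size_ofList_le_of_sublist {l l' : List BTree} (h : l.Sublist l') :
    (ofList l).size ≤ (ofList l').size := by
  rw [size_ofList, size_ofList]
  exact Nat.succ_le_succ ((h.map _).sum_le_sum fun _ _ => Nat.zero_le _)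

theorem size_ofList_append (l l' : List BTree) :
    (ofList (l ++ l')).size + 1 = (ofList l).size + (ofList l').size := by
  simp only [size_ofList, List.map_append, List.sum_append]
  omega

theorem size_ofList_reverse (l : List BTree) : (ofList l.reverse).size = (ofList l).size := by
  simp [size_ofList]

theorem size_ofList_flatMap_le {F : BTree → BTree} {b : ℕ} {l : List BTree}
    (h : ∀ a ∈ l, (F a).size ≤ b) :
    (ofList (l.flatMap fun a => (F a).toList)).size ≤ l.length * b + 1 := by
  induction l with
  | nil => simp
  | cons a l ih =>
    have htail := ih fun a ha => h a (List.mem_cons_of_mem _ ha)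
    have hhead := h a List.mem_cons_self
    have happend := size_ofList_append (F a).toList (l.flatMap fun a => (F a).toList)
    simp only [ofList_toList, List.flatMap_cons, List.length_cons] at *
    nlinarith

theorem foldl_reverse_append (F : BTree → BTree) (l : List BTree) (acc : BTree) :
    l.foldl (fun acc a => ofList ((F a).toList.reverse ++ acc.toList)) acc =
      ofList ((l.flatMap fun a => (F a).toList).reverse ++ acc.toList) := by
  induction l generalizing acc with
  | nil => simp
  | cons a l ih => simp [ih]

end BTree

open BTree

/-! ### Polynomially bounded functions -/

/-- Monotone functions bounded by a polynomial. Monotonicity makes the class closed under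
composition. -/
def PolyBdd (B : ℕ → ℕ) : Prop := Monotone B ∧ ∃ c, ∀ n, B n ≤ (n + 2) ^ c

namespace PolyBdd

theorem const (a : ℕ) : PolyBdd fun _ => a :=
  ⟨monotone_const, a, fun _ => Nat.lt_two_pow_self.le.trans (Nat.pow_le_pow_left (by omega) _)⟩

theorem id : PolyBdd fun n => n := ⟨monotone_id, 1, fun n => by simp⟩

theorem mul {B C : ℕ → ℕ} (hB : PolyBdd B) (hC : PolyBdd C) : PolyBdd fun n => B n * C n := by
  obtain ⟨hBmono, b, hb⟩ := hB
  obtain ⟨hCmono, c, hc⟩ := hC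
  refine ⟨hBmono.mul hCmono (fun _ => Nat.zero_le _) (fun _ => Nat.zero_le _), b + c, fun n => ?_⟩
  rw [pow_add]
  exact Nat.mul_le_mul (hb n) (hc n)

theorem comp {B C : ℕ → ℕ} (hB : PolyBdd B) (hC : PolyBdd C) : PolyBdd fun n => B (C n) := by
  obtain ⟨hBmono, b, hb⟩ := hB
  obtain ⟨hCmono, c, hc⟩ := hC
  refine ⟨hBmono.comp hCmono, (c + 2) * b, fun n => (hb _).trans ?_⟩
  have hpos : 1 ≤ (n + 2) ^ c := Nat.one_le_pow _ _ (by omega)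
  rw [pow_mul]
  gcongr
  calc C n + 2 ≤ (n + 2) ^ c + 2 := by gcongr; exact hc n
    _ ≤ (n + 2) ^ c * 2 ^ 2 := by omega
    _ ≤ (n + 2) ^ (c + 2) := by rw [pow_add]; gcongr; omega

theorem add {B C : ℕ → ℕ} (hB : PolyBdd B) (hC : PolyBdd C) : PolyBdd fun n => B n + C n := by
  obtain ⟨hBmono, b, hb⟩ := hB
  obtain ⟨hCmono, c, hc⟩ := hC
  refine ⟨hBmono.add hCmono, max b c + 1, fun n => ?_⟩
  have hb' : B n ≤ (n + 2) ^ max b c :=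
    (hb n).trans (Nat.pow_le_pow_right (by omega) (le_max_left _ _))
  have hc' : C n ≤ (n + 2) ^ max b c :=
    (hc n).trans (Nat.pow_le_pow_right (by omega) (le_max_right _ _))
  rw [pow_succ]
  nlinarith

end PolyBdd

/-! ### Deterministic programs -/

/-- Big-step semantics of deterministic runs: the program, started with the first tree, tosses no
coins and halts with the second tree after exactly the given number of steps. -/
inductive BigStep : Prog → BTree → BTree → ℕ → Prop
  | assign (e : Expr) (s : BTree) : BigStep (.assign e) s (e.eval s) 1
  | seq {p q : Prog} {s s₁ s₂ : BTree} {a b : ℕ} (hp : BigStep p s s₁ a)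
      (hq : BigStep q s₁ s₂ b) : BigStep (.seq p q) s s₂ (1 + a + b)
  | ite_true {e : Expr} {p q : Prog} {s s' : BTree} {a : ℕ} (he : (e.eval s).truth = true)
      (hp : BigStep p s s' a) : BigStep (.ite e p q) s s' (1 + a)
  | ite_false {e : Expr} {p q : Prog} {s s' : BTree} {a : ℕ} (he : (e.eval s).truth = false)
      (hq : BigStep q s s' a) : BigStep (.ite e p q) s s' (1 + a)
  | loop_false {e : Expr} {p : Prog} {s : BTree} (he : (e.eval s).truth = false) :
      BigStep (.loop e p) s s 1
  | loop_true {e : Expr} {p : Prog} {s s₁ s₂ : BTree} {a b : ℕ} (he : (e.eval s).truth = true)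
      (hp : BigStep p s s₁ a) (hl : BigStep (.loop e p) s₁ s₂ b) :
      BigStep (.loop e p) s s₂ (1 + a + b)

/-- Substitution of an expression for the program variable. -/
def Expr.subst : Expr → Expr → Expr
  | .var, e' => e'
  | .leaf, _ => .leaf
  | .node a b, e' => .node (a.subst e') (b.subst e')
  | .left a, e' => .left (a.subst e')
  | .right a, e' => .right (a.subst e')

theorem Expr.eval_subst (e e' : Expr) (s : BTree) :
    (e.subst e').eval s = e.eval (e'.eval s) := by
  induction e <;> simp_all [Expr.subst, Expr.eval]

/-- The closed expression denoting a given tree. -/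
def Expr.lit : BTree → Expr
  | .leaf => .leaf
  | .node a b => .node (lit a) (lit b)

theorem Expr.eval_lit (x s : BTree) : (Expr.lit x).eval s = x := by
  induction x <;> simp_all [Expr.lit, Expr.eval]

theorem Expr.exists_size_eval_le (e : Expr) :
    ∃ C, ∀ s : BTree, (e.eval s).size ≤ C * s.size := by
  induction e with
  | var => exact ⟨1, fun s => by simp [Expr.eval]⟩
  | leaf => exact ⟨1, fun s => by simpa [Expr.eval] using s.one_le_size⟩
  | node a b iha ihb =>
    obtain ⟨C, hC⟩ := iha
    obtain ⟨D, hD⟩ := ihb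
    refine ⟨C + D + 1, fun s => ?_⟩
    simp only [Expr.eval, size_node]
    nlinarith [hC s, hD s, s.one_le_size]
  | left a ih =>
    obtain ⟨C, hC⟩ := ih
    exact ⟨C, fun s => (size_left_le _).trans (hC s)⟩
  | right a ih =>
    obtain ⟨C, hC⟩ := ih
    exact ⟨C, fun s => (size_right_le _).trans (hC s)⟩

/-- The program acting as `p` on the left subtree of the program variable. Only deterministic
programs are transformed correctly: a coin would be attached to the whole tree. -/
def Prog.onLeft : Prog → Prog
  | .assign e => .assign (.node (e.subst (.left .var)) (.right .var))
  | .flip => .flip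
  | .seq p q => .seq p.onLeft q.onLeft
  | .ite e p q => .ite (e.subst (.left .var)) p.onLeft q.onLeft
  | .loop e p => .loop (e.subst (.left .var)) p.onLeft

theorem BigStep.onLeft {p : Prog} {s s' : BTree} {τ : ℕ} (h : BigStep p s s' τ) (r : BTree) :
    BigStep p.onLeft (.node s r) (.node s' r) τ := by
  induction h with
  | assign e s =>
    have := BigStep.assign (.node (e.subst (.left .var)) (.right .var)) (.node s r)
    simpa [Expr.eval, Expr.eval_subst, Prog.onLeft] using this
  | seq _ _ ih₁ ih₂ => exact .seq ih₁ ih₂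
  | ite_true he _ ih => exact .ite_true (by simpa [Expr.eval, Expr.eval_subst] using he) ih
  | ite_false he _ ih => exact .ite_false (by simpa [Expr.eval, Expr.eval_subst] using he) ih
  | loop_false he => exact .loop_false (by simpa [Expr.eval, Expr.eval_subst] using he)
  | loop_true he _ _ ih₁ ih₂ =>
    exact .loop_true (by simpa [Expr.eval, Expr.eval_subst] using he) ih₁ ih₂

/-- Iteration of `p` on the left subtree, once for each element of the right subtree. -/
def Prog.iterLeft (p : Prog) : Prog :=
  .loop (.right .var) (.seq p.onLeft (.assign (.node (.left .var) (.right (.right .var)))))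

theorem BigStep.iterLeft {p : Prog} {F : BTree → BTree} {C : ℕ} (c y : BTree)
    (h : ∀ i < c.len, ∃ τ ≤ C, BigStep p (F^[i] y) (F^[i + 1] y) τ) :
    ∃ τ ≤ c.len * (C + 3) + 1, BigStep p.iterLeft (.node y c) (.node (F^[c.len] y) .leaf) τ := by
  induction c generalizing y with
  | leaf => exact ⟨1, by simp, .loop_false rfl⟩
  | node a c _ ih =>
    obtain ⟨τ, hτ, hfirst⟩ := h 0 (by simp)
    obtain ⟨σ, hσ, hrest⟩ := ih (F y) fun i hi => h (i + 1) (by simpa using hi)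
    refine ⟨1 + (1 + τ + 1) + σ, ?_, .loop_true rfl (.seq (hfirst.onLeft _) (.assign _ _)) hrest⟩
    simp only [len_node]
    nlinarith

/-! ### Polynomial time functions on trees -/

/-- The class of functions computable in polynomial time by a deterministic program. Since subtrees
are shared, values may be exponentially larger than the running time, so the size bound on the
values is a separate requirement. -/
def FP (f : BTree → BTree) : Prop :=
  ∃ (p : Prog) (B : ℕ → ℕ), PolyBdd B ∧ ∀ x,
    (∃ τ ≤ B x.size, BigStep p x (f x) τ) ∧ (f x).size ≤ B x.size

namespace FP

theorem exists_size_le {f : BTree → BTree} (hf : FP f) :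
    ∃ B, PolyBdd B ∧ ∀ x, (f x).size ≤ B x.size := by
  obtain ⟨_, B, hB, h⟩ := hf
  exact ⟨B, hB, fun x => (h x).2⟩

theorem expr (e : Expr) : FP e.eval := by
  obtain ⟨C, hC⟩ := e.exists_size_eval_le
  exact ⟨.assign e, fun n => C * n + 1, ((PolyBdd.const C).mul .id).add (.const 1), fun x =>
    ⟨⟨1, by simp, .assign e x⟩, (hC x).trans (by simp)⟩⟩

protected theorem id : FP fun x => x := expr .var

theorem const (y : BTree) : FP fun _ => y := by
  simpa [funext fun s => Expr.eval_lit y s] using expr (Expr.lit y)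

theorem comp {f g : BTree → BTree} (hf : FP f) (hg : FP g) : FP fun x => f (g x) := by
  obtain ⟨p, B, hB, hp⟩ := hf
  obtain ⟨q, C, hC, hq⟩ := hg
  refine ⟨.seq q p, fun n => 1 + C n + B (C n), ((PolyBdd.const 1).add hC).add (hB.comp hC),
    fun x => ?_⟩
  obtain ⟨⟨τ, hτ, hqx⟩, hsize⟩ := hq x
  obtain ⟨⟨σ, hσ, hpx⟩, hsize'⟩ := hp (g x)
  have := hB.1 hsize
  exact ⟨⟨1 + τ + σ, by simp only; omega, .seq hqx hpx⟩, by simp only; omega⟩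

theorem left {f : BTree → BTree} (hf : FP f) : FP fun x => (f x).left :=
  (expr (.left .var)).comp hf

theorem right {f : BTree → BTree} (hf : FP f) : FP fun x => (f x).right :=
  (expr (.right .var)).comp hf

theorem node {f g : BTree → BTree} (hf : FP f) (hg : FP g) : FP fun x => .node (f x) (g x) := by
  obtain ⟨p, B, hB, hp⟩ := hf
  obtain ⟨q, C, hC, hq⟩ := hg
  let swap : Prog := .assign (.node (.right .var) (.left .var))
  refine ⟨.seq (.assign (.node .var .var)) (.seq p.onLeft (.seq swap (.seq q.onLeft swap))),
    fun n => B n + C n + 7, (hB.add hC).add (.const _), fun x => ?_⟩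
  obtain ⟨⟨τ, hτ, hpx⟩, hfx⟩ := hp x
  obtain ⟨⟨σ, hσ, hqx⟩, hgx⟩ := hq x
  exact ⟨⟨_, by simp only; omega, .seq (.assign _ _) (.seq (hpx.onLeft _) (.seq (.assign _ _)
    (.seq (hqx.onLeft _) (.assign _ _))))⟩, by simp only [size_node]; omega⟩

theorem ite_truth {c f g : BTree → BTree} (hc : FP c) (hf : FP f) (hg : FP g) :
    FP fun x => if (c x).truth then f x else g x := by
  obtain ⟨p, B, hB, hp⟩ := hf
  obtain ⟨q, C, hC, hq⟩ := hg
  obtain ⟨r, D, hD, hr⟩ := hc.node FP.id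
  refine ⟨.seq r (.ite (.left .var) (.seq (.assign (.right .var)) p)
    (.seq (.assign (.right .var)) q)), fun n => D n + B n + C n + 7,
    ((hD.add hB).add hC).add (.const _), fun x => ?_⟩
  obtain ⟨⟨τ, hτ, hrx⟩, -⟩ := hr x
  obtain ⟨⟨σ, hσ, hpx⟩, hfx⟩ := hp x
  obtain ⟨⟨ρ, hρ, hqx⟩, hgx⟩ := hq x
  beta_reduce
  by_cases h : (c x).truth = true
  · rw [if_pos h]
    exact ⟨⟨_, by omega, .seq hrx (.ite_true h (.seq (.assign _ _) hpx))⟩, by omega⟩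
  · rw [if_neg h]
    exact ⟨⟨_, by omega, .seq hrx (.ite_false (by simpa [Expr.eval] using h)
      (.seq (.assign _ _) hqx))⟩, by omega⟩

theorem truth {f : BTree → BTree} (hf : FP f) : FP fun x => ofBool (f x).truth := by
  convert hf.ite_truth (const (ofBool true)) (const (ofBool false)) using 2 with x
  cases (f x).truth <;> rfl

theorem ite {c : BTree → Bool} {f g : BTree → BTree} (hc : FP fun x => ofBool (c x)) (hf : FP f)
    (hg : FP g) : FP fun x => if c x then f x else g x := by
  simpa using hc.ite_truth hf hg

theorem not {f : BTree → Bool} (hf : FP fun x => ofBool (f x)) : FP fun x => ofBool !f x := by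
  convert hf.ite (const (ofBool false)) (const (ofBool true)) using 2 with x
  cases f x <;> rfl

theorem and {f g : BTree → Bool} (hf : FP fun x => ofBool (f x)) (hg : FP fun x => ofBool (g x)) :
    FP fun x => ofBool (f x && g x) := by
  convert hf.ite hg (const (ofBool false)) using 2 with x
  cases f x <;> simp

theorem comp₂ {F : BTree → BTree → BTree} {f g : BTree → BTree}
    (hF : FP fun z => F z.left z.right) (hf : FP f) (hg : FP g) : FP fun x => F (f x) (g x) :=
  hF.comp (hf.node hg)

theorem comp₃ {F : BTree → BTree → BTree → BTree} {f g h : BTree → BTree}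
    (hF : FP fun z => F z.left z.right.left z.right.right) (hf : FP f) (hg : FP g) (hh : FP h) :
    FP fun x => F (f x) (g x) (h x) :=
  hF.comp (hf.node (hg.node hh))

theorem iterate {S : BTree → BTree → BTree} {c f : BTree → BTree}
    (hS : FP fun z => S z.left z.right) (hc : FP c) (hf : FP f)
    (hB : ∃ B, PolyBdd B ∧ ∀ x, ∀ i ≤ (c x).len, ((S x)^[i] (f x)).size ≤ B x.size) :
    FP fun x => (S x)^[(c x).len] (f x) := by
  obtain ⟨B, hB, hsize⟩ := hB
  let pairStep : BTree → BTree := fun z => .node z.left (S z.left z.right)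
  obtain ⟨p, C, hC, hp⟩ : FP pairStep := FP.id.left.node hS
  obtain ⟨q, D, hD, hq⟩ := (FP.id.node hf).node hc
  refine ⟨.seq q (.seq p.iterLeft (.assign (.right (.left .var)))),
    fun n => D n + D n * (C (n + B n + 1) + 3) + 4 + B n,
    ((hD.add (hD.mul ((hC.comp ((PolyBdd.id.add hB).add (.const 1))).add (.const 3)))).add
      (.const 4)).add hB, fun x => ?_⟩
  obtain ⟨⟨τ, hτ, hqx⟩, hstart⟩ := hq x
  have hpair : ∀ i, pairStep^[i] (.node x (f x)) = .node x ((S x)^[i] (f x)) := fun i =>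
    (Function.Semiconj.iterate_right (f := BTree.node x) (ga := S x) (fun _ => rfl) i (f x)).symm
  have hstep : ∀ i < (c x).len, ∃ τ ≤ C (x.size + B x.size + 1),
      BigStep p (pairStep^[i] (.node x (f x))) (pairStep^[i + 1] (.node x (f x))) τ := by
    intro i hi
    rw [Function.iterate_succ_apply', hpair]
    obtain ⟨⟨ρ, hρ, h⟩, -⟩ := hp (.node x ((S x)^[i] (f x)))
    refine ⟨ρ, hρ.trans (hC.1 ?_), h⟩
    have := hsize x i hi.le
    simp only [size_node]
    omega
  obtain ⟨σ, hσ, hiter⟩ := BigStep.iterLeft _ _ hstep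
  rw [hpair] at hiter
  refine ⟨⟨_, ?_, .seq hqx (.seq hiter (.assign _ _))⟩,
    (hsize x _ le_rfl).trans (by simp only; omega)⟩
  have hlen : (c x).len ≤ D x.size := by
    have := (c x).len_lt_size
    simp only [size_node] at hstart
    omega
  have := Nat.mul_le_mul_right (C (x.size + B x.size + 1) + 3) hlen
  simp only
  omega

/-- One step of a left fold, on a pair of the remaining list and the accumulator. -/
def foldStep (F : BTree → BTree → BTree) (y : BTree) : BTree :=
  .node y.left.right (F y.right y.left.left)

theorem foldStep_iterate (F : BTree → BTree → BTree) {i : ℕ} {l : List BTree} (h : i ≤ l.length)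
    (acc : BTree) : (foldStep F)^[i] (.node (ofList l) acc) =
      .node (ofList (l.drop i)) ((l.take i).foldl F acc) := by
  induction i generalizing l acc with
  | zero => simp
  | succ i ih =>
    cases l with
    | nil => simp at h
    | cons a l => simpa [foldStep] using ih (Nat.le_of_succ_le_succ h) (F acc a)

theorem foldl {F : BTree → BTree → BTree → BTree} {l f : BTree → BTree}
    (hF : FP fun z => F z.left z.right.left z.right.right) (hl : FP l) (hf : FP f)
    (hB : ∃ B, PolyBdd B ∧ ∀ x l', l' <+: (l x).toList →
      (l'.foldl (F x) (f x)).size ≤ B x.size) :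
    FP fun x => (l x).toList.foldl (F x) (f x) := by
  obtain ⟨B, hB, hfold⟩ := hB
  obtain ⟨C, hC, hsize⟩ := hl.exists_size_le
  have hiter : ∀ x, ∀ i ≤ (l x).len, (foldStep (F x))^[i] (.node (l x) (f x)) =
      .node (ofList ((l x).toList.drop i)) (((l x).toList.take i).foldl (F x) (f x)) := by
    intro x i hi
    simpa using foldStep_iterate (F x) hi (f x)
  have hstep : FP fun z => foldStep (F z.left) z.right :=
    FP.id.right.left.right.node (comp₃ hF FP.id.left FP.id.right.right FP.id.right.left.left)
  have := (iterate (S := fun x => foldStep (F x)) hstep hl (hl.node hf)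
    ⟨fun n => C n + B n + 1, (hC.add hB).add (.const 1), fun x i hi => by
      rw [hiter x i hi]
      have hdrop := size_ofList_le_of_sublist (List.drop_sublist i (l x).toList)
      have htake := hfold x _ (List.take_prefix i (l x).toList)
      have := hsize x
      simp only [ofList_toList, size_node] at hdrop ⊢
      omega⟩).right
  convert this using 2 with x
  rw [hiter x _ le_rfl]
  simp [len]

/-! ### List operations in polynomial time -/

theorem reverseAppend {f g : BTree → BTree} (hf : FP f) (hg : FP g) :
    FP fun x => ofList ((f x).toList.reverse ++ (g x).toList) := by
  obtain ⟨B, hB, hfB⟩ := hf.exists_size_le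
  obtain ⟨C, hC, hgC⟩ := hg.exists_size_le
  have hfold : ∀ (l : List BTree) (acc : BTree), l.foldl (fun acc a => BTree.node a acc) acc =
      ofList (l.reverse ++ acc.toList) := by
    intro l
    induction l with
    | nil => simp
    | cons a l ih => intro acc; simp [ih]
  have := foldl (F := fun _ acc a => .node a acc) (l := f) (f := g)
    (FP.id.right.right.node FP.id.right.left) hf hg ⟨fun n => B n + C n, hB.add hC, by
      intro x l' hl'
      have hsub := size_ofList_le_of_sublist hl'.sublist
      have happend := size_ofList_append l'.reverse (g x).toList
      have := hfB x
      have := hgC x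
      rw [size_ofList_reverse] at happend
      simp only [hfold, ofList_toList] at *
      omega⟩
  simpa only [hfold] using this

theorem reverse {f : BTree → BTree} (hf : FP f) : FP fun x => ofList (f x).toList.reverse := by
  simpa using hf.reverseAppend (const .leaf)

theorem append {f g : BTree → BTree} (hf : FP f) (hg : FP g) :
    FP fun x => ofList ((f x).toList ++ (g x).toList) := by
  simpa using hf.reverse.reverseAppend hg

theorem flatMap {F : BTree → BTree → BTree} {l : BTree → BTree}
    (hF : FP fun z => F z.left z.right) (hl : FP l) :
    FP fun x => ofList ((l x).toList.flatMap fun a => (F x a).toList) := by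
  obtain ⟨B, hB, hFB⟩ := hF.exists_size_le
  obtain ⟨C, hC, hlC⟩ := hl.exists_size_le
  have hbound : ∀ x l', l' <+: (l x).toList →
      (l'.foldl (fun acc a => ofList ((F x a).toList.reverse ++ acc.toList)) .leaf).size ≤
        C x.size * B (x.size + C x.size + 1) + 1 := by
    intro x l' hl'
    have hsize := hlC x
    have hvalues : ∀ a ∈ l', (F x a).size ≤ B (x.size + C x.size + 1) := fun a ha => by
      refine (hFB (.node x a)).trans (hB.1 ?_)
      have := size_lt_of_mem_toList (hl'.subset ha)
      simp only [size_node]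
      omega
    have hlength : l'.length ≤ C x.size :=
      hl'.length_le.trans ((l x).len_lt_size.le.trans hsize)
    rw [foldl_reverse_append, toList_leaf, List.append_nil, size_ofList_reverse]
    exact (size_ofList_flatMap_le hvalues).trans (by gcongr)
  have hF' : FP fun z => F z.left z.right.right := comp₂ hF FP.id.left FP.id.right.right
  have := foldl (F := fun x acc a => ofList ((F x a).toList.reverse ++ acc.toList))
    (l := l) (f := fun _ => .leaf) (hF'.reverseAppend FP.id.right.left) hl (const _)
    ⟨_, (hC.mul (hB.comp ((PolyBdd.id.add hC).add (.const 1)))).add (.const 1), hbound⟩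
  simpa [foldl_reverse_append] using this.reverse

theorem map {F : BTree → BTree → BTree} {l : BTree → BTree}
    (hF : FP fun z => F z.left z.right) (hl : FP l) :
    FP fun x => ofList ((l x).toList.map (F x)) := by
  have := flatMap (F := fun x a => .node (F x a) .leaf) (hF.node (const .leaf)) hl
  simpa [← List.map_eq_flatMap] using this

theorem filter {F : BTree → BTree → Bool} {l : BTree → BTree}
    (hF : FP fun z => ofBool (F z.left z.right)) (hl : FP l) :
    FP fun x => ofList ((l x).toList.filter (F x)) := by
  have := flatMap (F := fun x a => if F x a then .node a .leaf else .leaf)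
    (hF.ite (FP.id.right.node (const .leaf)) (const .leaf)) hl
  convert this using 3 with x
  induction (l x).toList with
  | nil => rfl
  | cons a l ih => by_cases h : F x a = true <;> simp_all

theorem any {F : BTree → BTree → Bool} {l : BTree → BTree}
    (hF : FP fun z => ofBool (F z.left z.right)) (hl : FP l) :
    FP fun x => ofBool ((l x).toList.any (F x)) := by
  convert (filter (F := F) hF hl).truth using 3 with x
  induction (l x).toList with
  | nil => rfl
  | cons a l ih => by_cases h : F x a = true <;> simp_all

theorem all {F : BTree → BTree → Bool} {l : BTree → BTree}
    (hF : FP fun z => ofBool (F z.left z.right)) (hl : FP l) :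
    FP fun x => ofBool ((l x).toList.all (F x)) := by
  simpa [List.all_eq_not_any_not] using (any (F := fun x a => !F x a) hF.not hl).not

/-! ### Arithmetic in polynomial time -/

theorem len {f : BTree → BTree} (hf : FP f) : FP fun x => num (f x).len := by
  simpa [BTree.len, ← ofList_replicate] using map (F := fun _ _ => .leaf) (const _) hf

theorem sum_map {F : BTree → BTree → ℕ} {l : BTree → BTree}
    (hF : FP fun z => num (F z.left z.right)) (hl : FP l) :
    FP fun x => num ((l x).toList.map (F x)).sum := by
  convert (flatMap (F := fun x a => num (F x a)) hF hl).len using 2 with x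
  simp [toList_num]

theorem add {m n : BTree → ℕ} (hm : FP fun x => num (m x)) (hn : FP fun x => num (n x)) :
    FP fun x => num (m x + n x) := by
  simpa [toList_num, ofList_replicate] using hm.append hn

theorem mul {m n : BTree → ℕ} (hm : FP fun x => num (m x)) (hn : FP fun x => num (n x)) :
    FP fun x => num (m x * n x) := by
  simpa [toList_num] using sum_map (F := fun x _ => n x) (hn.comp FP.id.left) hm

theorem drop {n : BTree → ℕ} {f : BTree → BTree} (hn : FP fun x => num (n x)) (hf : FP f) :
    FP fun x => ofList ((f x).toList.drop (n x)) := by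
  have hiter : ∀ (i : ℕ) (y : BTree), BTree.right^[i] y = ofList (y.toList.drop i) := by
    intro i
    induction i with
    | zero => simp
    | succ i ih => intro y; cases y <;> simp [Function.iterate_succ_apply, ih]
  obtain ⟨B, hB, hfB⟩ := hf.exists_size_le
  have := iterate (S := fun _ => BTree.right) FP.id.right.right hn hf
    ⟨B, hB, fun x i _ => by
      rw [hiter]
      refine (size_ofList_le_of_sublist (List.drop_sublist _ _)).trans ?_
      simpa using hfB x⟩
  simpa only [hiter, len_num] using this

theorem take {n : BTree → ℕ} {f : BTree → BTree} (hn : FP fun x => num (n x)) (hf : FP f) :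
    FP fun x => ofList ((f x).toList.take (n x)) := by
  convert ((hn.drop hf).len.drop hf.reverse).reverse using 2 with x
  simp only [len_ofList, toList_ofList, List.length_drop, List.drop_reverse, List.reverse_reverse]
  congr 1
  rw [List.take_eq_take_iff]
  omega

theorem getD {n : BTree → ℕ} {f : BTree → BTree} (hn : FP fun x => num (n x)) (hf : FP f) :
    FP fun x => (f x).toList.getD (n x) .leaf := by
  convert (hn.drop hf).left using 2 with x
  rw [List.getD_eq_getElem?_getD, ← List.head?_drop]
  cases (f x).toList.drop (n x) <;> rfl

theorem lt {m n : BTree → ℕ} (hm : FP fun x => num (m x)) (hn : FP fun x => num (n x)) :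
    FP fun x => ofBool (decide (m x < n x)) := by
  convert (hm.drop hn).truth using 3 with x
  rw [Bool.eq_iff_iff, decide_eq_true_iff, truth_ofList, Ne, List.drop_eq_nil_iff, not_le,
    ← BTree.len, len_num]

theorem le {m n : BTree → ℕ} (hm : FP fun x => num (m x)) (hn : FP fun x => num (n x)) :
    FP fun x => ofBool (decide (m x ≤ n x)) := by
  simpa [← decide_not] using (hn.lt hm).not

theorem eq {m n : BTree → ℕ} (hm : FP fun x => num (m x)) (hn : FP fun x => num (n x)) :
    FP fun x => ofBool (decide (m x = n x)) := by
  convert (hm.le hn).and (hn.le hm) using 3 with x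
  rw [← Bool.decide_and, decide_eq_decide]
  omega

theorem min {m n : BTree → ℕ} (hm : FP fun x => num (m x)) (hn : FP fun x => num (n x)) :
    FP fun x => num (min (m x) (n x)) := by
  simpa [toList_num, ofList_replicate] using hm.take hn

theorem range {n : BTree → ℕ} (hn : FP fun x => num (n x)) :
    FP fun x => ofList ((List.range (n x)).map num) := by
  have hcount : ∀ (l : List BTree), l.foldl (fun acc _ => BTree.node (num acc.len) acc) .leaf =
      ofList ((List.range l.length).map num).reverse := by
    intro l
    induction l using List.reverseRecOn with
    | nil => rfl
    | append_singleton l a ih => simp [ih, List.range_succ]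
  have hsize : ∀ (i : ℕ), (ofList ((List.range i).map num).reverse).size ≤
      i * (2 * i + 1) + 1 := by
    intro i
    rw [size_ofList_reverse, size_ofList, List.map_map]
    gcongr
    refine (List.sum_le_card_nsmul _ (2 * i) fun a ha => ?_).trans ?_
    · obtain ⟨j, hj, rfl⟩ := List.mem_map.1 ha
      simp only [List.mem_range, Function.comp_apply, size_num] at hj ⊢
      omega
    · simp only [List.length_map, List.length_range, smul_eq_mul]
      gcongr
      omega
  obtain ⟨B, hB, hnB⟩ := hn.exists_size_le
  have := foldl (F := fun _ acc _ => .node (num acc.len) acc) (f := fun _ => .leaf)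
    (FP.id.right.left.len.node FP.id.right.left) hn (const _)
    ⟨fun x => B x * (2 * B x + 1) + 1, (hB.mul (((PolyBdd.const 2).mul hB).add (.const 1))).add
      (.const 1), fun x l' hl' => by
      have hlength : l'.length ≤ B x.size :=
        hl'.length_le.trans ((num (n x)).len_lt_size.le.trans (hnB x))
      rw [hcount]
      refine (hsize _).trans ?_
      beta_reduce
      gcongr⟩
  simpa only [hcount, toList_num, List.length_replicate, toList_ofList, List.reverse_reverse] using
    this.reverse

theorem sum_range {F : BTree → ℕ → ℕ} {n : BTree → ℕ}
    (hF : FP fun z => num (F z.left z.right.len)) (hn : FP fun x => num (n x)) :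
    FP fun x => num (∑ i ∈ Finset.range (n x), F x i) := by
  convert sum_map (F := fun x a => F x a.len) hF hn.range using 3 with x
  simp only [toList_ofList, List.map_map, Function.comp_def, len_num]
  rfl

end FP

/-! ### Loop-free programs -/

/-- Programs without loops and coin tosses. -/
def Prog.LoopFree : Prog → Prop
  | .assign _ => True
  | .flip => False
  | .seq p q => p.LoopFree ∧ q.LoopFree
  | .ite _ p q => p.LoopFree ∧ q.LoopFree
  | .loop _ _ => False

/-- The function computed by a loop-free program. Loops and coin tosses, which do not occur in such
programs, get the identity. -/
def Prog.evalLoopFree : Prog → BTree → BTree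
  | .assign e, s => e.eval s
  | .flip, s => s
  | .seq p q, s => q.evalLoopFree (p.evalLoopFree s)
  | .ite e p q, s => if (e.eval s).truth then p.evalLoopFree s else q.evalLoopFree s
  | .loop _ _, s => s

theorem Prog.LoopFree.exists_bigStep {p : Prog} (hp : p.LoopFree) :
    ∃ C, ∀ s, ∃ τ ≤ C, BigStep p s (p.evalLoopFree s) τ := by
  induction p with
  | assign e => exact ⟨1, fun s => ⟨1, le_rfl, .assign e s⟩⟩
  | flip => exact hp.elim
  | seq p q ihp ihq =>
    obtain ⟨C, hC⟩ := ihp hp.1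
    obtain ⟨D, hD⟩ := ihq hp.2
    refine ⟨1 + C + D, fun s => ?_⟩
    obtain ⟨τ, hτ, hps⟩ := hC s
    obtain ⟨σ, hσ, hqs⟩ := hD (p.evalLoopFree s)
    exact ⟨_, by omega, .seq hps hqs⟩
  | ite e p q ihp ihq =>
    obtain ⟨C, hC⟩ := ihp hp.1
    obtain ⟨D, hD⟩ := ihq hp.2
    refine ⟨1 + C + D, fun s => ?_⟩
    obtain ⟨τ, hτ, hps⟩ := hC s
    obtain ⟨σ, hσ, hqs⟩ := hD s
    by_cases h : (e.eval s).truth = true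
    · rw [show (Prog.ite e p q).evalLoopFree s = p.evalLoopFree s from if_pos h]
      exact ⟨_, by omega, .ite_true h hps⟩
    · rw [show (Prog.ite e p q).evalLoopFree s = q.evalLoopFree s from if_neg h]
      exact ⟨_, by omega, .ite_false (by simpa using h) hqs⟩
  | loop _ _ => exact hp.elim

/-- Only the value read off by `q` has to be small: sharing keeps each step of `p` cheap, no matter
how large the trees become in between. -/
theorem FP.evalLoopFree_iterate {p q : Prog} (hp : p.LoopFree) (hq : q.LoopFree) {a : ℕ}
    (ha : ∀ s, (q.evalLoopFree s).size ≤ a) {c f : BTree → BTree} (hc : FP c) (hf : FP f) :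
    FP fun x => q.evalLoopFree (p.evalLoopFree^[(c x).len] (f x)) := by
  obtain ⟨C, hC⟩ := hp.exists_bigStep
  obtain ⟨D, hD⟩ := hq.exists_bigStep
  obtain ⟨r, B, hB, hr⟩ := hf.node hc
  refine ⟨.seq r (.seq p.iterLeft (.seq (.assign (.left .var)) q)),
    fun n => B n + B n * (C + 3) + (D + 5 + a),
    (hB.add (hB.mul (.const (C + 3)))).add (.const _), fun x => ?_⟩
  obtain ⟨⟨τ, hτ, hrx⟩, hstart⟩ := hr x
  obtain ⟨σ, hσ, hiter⟩ := BigStep.iterLeft (p := p) (F := p.evalLoopFree) (C := C) (c x) (f x)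
    fun i _ => by
      rw [Function.iterate_succ_apply']
      exact hC _
  obtain ⟨ρ, hρ, hread⟩ := hD (p.evalLoopFree^[(c x).len] (f x))
  refine ⟨⟨_, ?_, .seq hrx (.seq hiter (.seq (.assign _ _) hread))⟩,
    (ha _).trans (by simp only; omega)⟩
  have hlen : (c x).len ≤ B x.size := by
    have := (c x).len_lt_size
    simp only [size_node] at hstart
    omega
  have := Nat.mul_le_mul_right (C + 3) hlen
  simp only
  omega

/-! ### A universal machine -/

/-- A machine instruction: an instruction number with its arguments. -/
def instr (i : ℕ) (args : BTree) : BTree := .node (num i) args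

namespace Instr

/-- Push the program variable. -/
def pushVar : BTree := instr 0 .leaf

/-- Push a leaf. -/
def pushLeaf : BTree := instr 1 .leaf

/-- Replace the two topmost values by their pair. -/
def pair : BTree := instr 2 .leaf

/-- Replace the topmost value by its left subtree. -/
def left : BTree := instr 3 .leaf

/-- Replace the topmost value by its right subtree. -/
def right : BTree := instr 4 .leaf

/-- Pop the topmost value into the program variable. -/
def store : BTree := instr 5 .leaf

/-- Consume a coin and attach it on the left of the program variable. -/
def flip : BTree := instr 6 .leaf

/-- Run two pieces of code in succession. -/
def seq (p q : BTree) : BTree := instr 7 (.node p q)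

/-- Pop the topmost value and run `p` or `q` depending on its truth value. -/
def branch (p q : BTree) : BTree := instr 8 (.node p q)

/-- Run `p` as long as the code `e` pushes a true value. -/
def loop (e p : BTree) : BTree := instr 9 (.node e p)

/-- Do nothing. -/
def nop : BTree := instr 10 .leaf

end Instr

/-- Machine code that pushes the value of an expression. -/
def Expr.code : Expr → BTree
  | .var => Instr.pushVar
  | .leaf => Instr.pushLeaf
  | .node a b => Instr.seq a.code (Instr.seq b.code Instr.pair)
  | .left a => Instr.seq a.code Instr.left
  | .right a => Instr.seq a.code Instr.right

/-- Machine code of a program. -/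
def Prog.code : Prog → BTree
  | .assign e => Instr.seq e.code Instr.store
  | .flip => Instr.flip
  | .seq p q => Instr.seq p.code q.code
  | .ite e p q => Instr.seq e.code (Instr.branch p.code q.code)
  | .loop e p => Instr.loop e.code p.code

/-- States of the universal machine: a list of instructions, a stack of values, the content of
the program variable and a list of coins. -/
def machineState (code stack s coins : BTree) : BTree := .node code (.node stack (.node s coins))

/-- The expression denoting the machine state with the given components. -/
def Expr.machineState (code stack s coins : Expr) : Expr :=
  .node code (.node stack (.node s coins))

/-- Case distinction on a unary number: run the program with that index in the list, and `q` if
there is none. -/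
def Prog.switch : List Prog → Prog → Expr → Prog
  | [], q, _ => q
  | p :: l, q, e => .ite e (switch l q (.right e)) p

/-- One step of the universal machine; the alternatives are in the order of the instruction
numbers. -/
def machineStep : Prog :=
  let code : Expr := .left .var
  let V : Expr := .left (.right .var)
  let s : Expr := .left (.right (.right .var))
  let ρ : Expr := .right (.right (.right .var))
  let C : Expr := .right code
  let args : Expr := .right (.left code)
  .ite code
    (Prog.switch [
      .assign (.machineState C (.node s V) s ρ),
      .assign (.machineState C (.node .leaf V) s ρ),
      .assign (.machineState C
        (.node (.node (.left (.right V)) (.left V)) (.right (.right V))) s ρ),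
      .assign (.machineState C (.node (.left (.left V)) (.right V)) s ρ),
      .assign (.machineState C (.node (.right (.left V)) (.right V)) s ρ),
      .assign (.machineState C (.right V) (.left V) ρ),
      .assign (.machineState C V (.node (.left ρ) s) (.right ρ)),
      .assign (.machineState (.node (.left args) (.node (.right args) C)) V s ρ),
      .ite (.left V) (.assign (.machineState (.node (.left args) C) (.right V) s ρ))
        (.assign (.machineState (.node (.right args) C) (.right V) s ρ)),
      .assign (.machineState (.node (.left args) (.node (.node (.lit (num 8)) (.node
        (.node (.lit (num 7)) (.node (.right args) (.left code))) (.lit Instr.nop))) C)) V s ρ)]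
      (.assign (.machineState C V s ρ)) (.left (.left code)))
    (.assign .var)

/-- Test whether the machine has halted with the answer `true`. -/
def machineAnswer : Prog :=
  .ite (.left .var) (.assign .leaf) (.ite (.left (.right (.right .var)))
    (.assign (.lit (ofBool true))) (.assign .leaf))

/-- Whether the universal machine halts with the answer `true` on the given code, input and coins
within as many machine steps as the length of the clock. -/
def interpret (code x coins clock : BTree) : BTree :=
  machineAnswer.evalLoopFree
    (machineStep.evalLoopFree^[clock.len] (machineState (.node code .leaf) .leaf x coins))

theorem FP.interpret {f g h k : BTree → BTree} (hf : FP f) (hg : FP g) (hh : FP h) (hk : FP k) :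
    FP fun x => interpret (f x) (g x) (h x) (k x) := by
  refine FP.evalLoopFree_iterate (a := 3) ?_ ?_ ?_ hk
    ((hf.node (const .leaf)).node ((const .leaf).node (hg.node hh)))
  · simp [machineStep, Prog.switch, Prog.LoopFree]
  · simp [machineAnswer, Prog.LoopFree]
  · intro s
    simp only [machineAnswer, Prog.evalLoopFree, Expr.eval, Expr.eval_lit]
    split_ifs <;> simp [ofBool]

/-- The number of machine steps evaluating an expression. -/
def Expr.cost : Expr → ℕ
  | .var => 1
  | .leaf => 1
  | .node a b => 1 + a.cost + 1 + b.cost + 1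
  | .left a => 1 + a.cost + 1
  | .right a => 1 + a.cost + 1

/-- A bound for the number of machine steps simulating one step of a program, monotone under
passing to subprograms. -/
def Prog.cost : Prog → ℕ
  | .assign e => 1 + e.cost + 1
  | .flip => 1
  | .seq p q => 1 + p.cost + q.cost
  | .ite e p q => 1 + e.cost + 1 + p.cost + q.cost
  | .loop e p => 1 + e.cost + 1 + 1 + p.cost

theorem iterate_add_eq {α : Type*} {f : α → α} {m n : ℕ} {x y z : α} (hm : f^[m] x = y)
    (hn : f^[n] y = z) : f^[m + n] x = z := by
  rw [Nat.add_comm, Function.iterate_add_apply, hm, hn]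

theorem machineStep_branch (a p q C V s ρ : BTree) :
    machineStep.evalLoopFree^[1]
        (machineState (.node (Instr.branch p q) C) (.node a V) s ρ) =
      machineState (.node (if a.truth then p else q) C) V s ρ := by
  cases a <;> rfl

theorem machineStep_iterate_cost (e : Expr) (C V s ρ : BTree) :
    machineStep.evalLoopFree^[e.cost] (machineState (.node e.code C) V s ρ) =
      machineState C (.node (e.eval s) V) s ρ := by
  induction e generalizing C V with
  | var => rfl
  | leaf => rfl
  | node a b iha ihb =>
    exact iterate_add_eq (iterate_add_eq (iterate_add_eq (iterate_add_eq rfl (iha _ _)) rfl)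
      (ihb _ _)) rfl
  | left a ih => exact iterate_add_eq (iterate_add_eq rfl (ih _ _)) rfl
  | right a ih => exact iterate_add_eq (iterate_add_eq rfl (ih _ _)) rfl

/-- One step of the computation with the coins given in advance; missing coins show `false`. -/
def coinStep : Config × List Bool → Config × List Bool
  | (([], s), ρ) => (([], s), ρ)
  | ((.assign e :: c, s), ρ) => ((c, e.eval s), ρ)
  | ((.flip :: c, s), ρ) => ((c, .node (ofBool (ρ.headD false)) s), ρ.tail)
  | ((.seq p q :: c, s), ρ) => ((p :: q :: c, s), ρ)
  | ((.ite e p q :: c, s), ρ) => (if (e.eval s).truth then (p :: c, s) else (q :: c, s), ρ)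
  | ((.loop e p :: c, s), ρ) =>
      (if (e.eval s).truth then (p :: .loop e p :: c, s) else (c, s), ρ)

/-- The state of the universal machine that represents a configuration. -/
def machineConfig (x : Config × List Bool) : BTree :=
  machineState (ofList (x.1.1.map Prog.code)) .leaf x.1.2 (ofList (x.2.map ofBool))

theorem cost_le_of_mem_coinStep {K : ℕ} {x : Config × List Bool} (hx : ∀ q ∈ x.1.1, q.cost ≤ K) :
    ∀ q ∈ (coinStep x).1.1, q.cost ≤ K := by
  obtain ⟨⟨_ | ⟨p, c⟩, s⟩, ρ⟩ := x
  · exact hx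
  have hp : p.cost ≤ K := hx p List.mem_cons_self
  have hc : ∀ q ∈ c, q.cost ≤ K := fun q hq => hx q (List.mem_cons_of_mem p hq)
  cases p with
  | assign e => exact hc
  | flip => cases ρ <;> exact hc
  | seq p q =>
    have := hp
    simp only [Prog.cost] at this
    exact List.forall_mem_cons.2 ⟨by omega, List.forall_mem_cons.2 ⟨by omega, hc⟩⟩
  | ite e p q =>
    simp only [Prog.cost] at hp
    simp only [coinStep]
    split_ifs <;> exact List.forall_mem_cons.2 ⟨by omega, hc⟩
  | loop e p =>
    have := hp
    simp only [Prog.cost] at this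
    simp only [coinStep]
    split_ifs
    · exact List.forall_mem_cons.2 ⟨by omega, List.forall_mem_cons.2 ⟨hp, hc⟩⟩
    · exact hc

theorem exists_machineStep_iterate_eq_coinStep {K : ℕ} {x : Config × List Bool}
    (hx : ∀ q ∈ x.1.1, q.cost ≤ K) :
    ∃ n ≤ K, machineStep.evalLoopFree^[n] (machineConfig x) = machineConfig (coinStep x) := by
  obtain ⟨⟨c, s⟩, ρ⟩ := x
  cases c with
  | nil => exact ⟨0, Nat.zero_le _, rfl⟩
  | cons p c =>
    have hp : p.cost ≤ K := hx p List.mem_cons_self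
    cases p with
    | assign e =>
      exact ⟨_, hp, iterate_add_eq (iterate_add_eq rfl (machineStep_iterate_cost e _ _ _ _)) rfl⟩
    | flip => exact ⟨1, hp, by cases ρ <;> rfl⟩
    | seq p q => exact ⟨1, by simp only [Prog.cost] at hp; omega, rfl⟩
    | ite e p q =>
      refine ⟨1 + e.cost + 1, by simp only [Prog.cost] at hp; omega,
        (iterate_add_eq (iterate_add_eq rfl (machineStep_iterate_cost e _ _ _ _))
          (machineStep_branch (e.eval s) p.code q.code _ _ _ _)).trans ?_⟩
      simp only [coinStep]
      split_ifs <;> rfl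
    | loop e p =>
      refine ⟨1 + e.cost + 1 + 1, by simp only [Prog.cost] at hp; omega, iterate_add_eq
        (iterate_add_eq (iterate_add_eq rfl (machineStep_iterate_cost e _ _ _ _))
          (machineStep_branch (e.eval s) (Instr.seq p.code (Prog.loop e p).code) Instr.nop
            _ _ _ _)) ?_⟩
      simp only [coinStep]
      split_ifs <;> rfl

theorem exists_machineStep_iterate_eq_coinStep_iterate {K : ℕ} (T : ℕ) {x : Config × List Bool}
    (hx : ∀ q ∈ x.1.1, q.cost ≤ K) :
    ∃ n ≤ K * T,
      machineStep.evalLoopFree^[n] (machineConfig x) = machineConfig (coinStep^[T] x) := by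
  induction T generalizing x with
  | zero => exact ⟨0, by simp, rfl⟩
  | succ T ih =>
    obtain ⟨n, hn, hfirst⟩ := exists_machineStep_iterate_eq_coinStep hx
    obtain ⟨m, hm, hrest⟩ := ih (cost_le_of_mem_coinStep hx)
    exact ⟨n + m, by rw [mul_add, mul_one]; omega, iterate_add_eq hfirst hrest⟩

theorem interpret_code {P : Prog} {T : ℕ} {x clock : BTree} {ρ : List Bool} {b : Bool}
    (h : answer (coinStep^[T] (([P], x), ρ)).1 = some b) (hT : P.cost * T ≤ clock.len) :
    interpret P.code x (ofList (ρ.map ofBool)) clock = ofBool b := by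
  obtain ⟨n, hn, hrun⟩ :=
    exists_machineStep_iterate_eq_coinStep_iterate (K := P.cost) T (x := (([P], x), ρ)) (by simp)
  generalize coinStep^[T] (([P], x), ρ) = y at h hrun
  obtain ⟨⟨c, s⟩, ρ'⟩ := y
  cases c with
  | cons p c => simp [answer] at h
  | nil =>
    obtain ⟨m, hm⟩ := Nat.exists_eq_add_of_le (hn.trans hT)
    have hhalted : machineStep.evalLoopFree^[clock.len]
        (machineConfig (([P], x), ρ)) = machineConfig (([], s), ρ') := by
      rw [hm]
      exact iterate_add_eq hrun (Function.iterate_fixed rfl m)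
    obtain rfl : s.truth = b := by simpa [answer] using h
    refine (congrArg machineAnswer.evalLoopFree hhalted).trans ?_
    cases s <;> rfl

/-! ### Randomized runs -/

/-- The probability of a given answer within `T` steps. -/
noncomputable def answerProb (T : ℕ) (x : Config) (o : Option Bool) : ℝ≥0∞ :=
  ((run T x).map answer) o

/-- The probability of the answer `true` within `T` steps. -/
noncomputable def acceptProb (T : ℕ) (x : Config) : ℝ≥0∞ := answerProb T x (some true)

theorem answerProb_zero (x : Config) (o : Option Bool) :
    answerProb 0 x o = if answer x = o then 1 else 0 := by
  simp [answerProb, run, PMF.pure_map, PMF.pure_apply, eq_comm]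

theorem answerProb_succ_of_step_eq_pure {x y : Config} (h : step x = PMF.pure y) (T : ℕ)
    (o : Option Bool) : answerProb (T + 1) x o = answerProb T y o := by
  simp [answerProb, run, h]

theorem answerProb_succ_flip (c : List Prog) (s : BTree) (T : ℕ) (o : Option Bool) :
    answerProb (T + 1) (.flip :: c, s) o =
      mean fun b => answerProb T (c, .node (ofBool b) s) o := by
  simp only [answerProb, run, step, PMF.map_bind, PMF.bind_map, PMF.bind_apply, tsum_bool,
    PMF.uniformOfFintype_apply, Function.comp_apply, mean_bool, Fintype.card_bool, Nat.cast_ofNat,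
    ← mul_add, div_eq_mul_inv]
  ring

theorem answerProb_halted (T : ℕ) (s : BTree) : answerProb T ([], s) (some s.truth) = 1 := by
  induction T with
  | zero => simp [answerProb_zero, answer]
  | succ T ih => rw [answerProb_succ_of_step_eq_pure (by rfl), ih]

theorem answerProb_le_succ (T : ℕ) (x : Config) (b : Bool) :
    answerProb T x (some b) ≤ answerProb (T + 1) x (some b) := by
  induction T generalizing x with
  | zero =>
    rw [answerProb_zero]
    split_ifs with h
    · obtain ⟨_ | ⟨p, c⟩, s⟩ := x
      · obtain rfl : s.truth = b := by simpa [answer] using h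
        rw [answerProb_halted]
      · simp [answer] at h
    · exact zero_le
  | succ T ih =>
    obtain ⟨_ | ⟨p, c⟩, s⟩ := x
    · rw [answerProb_succ_of_step_eq_pure (by rfl), answerProb_succ_of_step_eq_pure (by rfl)]
      exact ih _
    cases p with
    | flip =>
      simp only [answerProb_succ_flip c s]
      exact mean_mono fun b => ih _
    | _ =>
      rw [answerProb_succ_of_step_eq_pure (by rfl), answerProb_succ_of_step_eq_pure (by rfl)]
      exact ih _

theorem acceptProb_mono {T T' : ℕ} (h : T ≤ T') (x : Config) :
    acceptProb T x ≤ acceptProb T' x :=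
  monotone_nat_of_le_succ (fun T => answerProb_le_succ T x true) h

theorem acceptProb_zero_cons (p : Prog) (c : List Prog) (s : BTree) :
    acceptProb 0 (p :: c, s) = 0 := by
  simp [acceptProb, answerProb_zero, answer]

theorem answerProb_eq_prob_coinStep {T t : ℕ} (h : T ≤ t) (x : Config) (o : Option Bool) :
    answerProb T x o = ENNReal.ofReal
      (prob fun ρ : Fin t → Bool => answer (coinStep^[T] (x, List.ofFn ρ)).1 = o) := by
  classical
  rw [← mean_indicator]
  induction T generalizing x t with
  | zero =>
    rw [answerProb_zero]
    by_cases hx : answer x = o <;> simp [hx, mean_const]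
  | succ T ih =>
    obtain ⟨_ | ⟨p, c⟩, s⟩ := x
    · rw [answerProb_succ_of_step_eq_pure (by rfl), ih (t := t) (by omega)]
      rfl
    cases p with
    | flip =>
      obtain ⟨t, rfl⟩ := Nat.exists_eq_add_of_le' (Nat.one_le_of_lt h)
      rw [answerProb_succ_flip, ← mean_equiv (Fin.consEquiv fun _ : Fin (t + 1) => Bool),
        ← mean_mean]
      congr 1
      funext b
      rw [ih (t := t) (by omega)]
      congr 1
      funext ρ
      simp [Function.iterate_succ_apply, coinStep, Fin.consEquiv, List.ofFn_succ]
    | _ =>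
      rw [answerProb_succ_of_step_eq_pure (by rfl), ih (t := t) (by omega)]
      rfl

/-- From the configuration `x` the machine arrives after exactly `τ` steps at the configuration
`Y ω`, with `ω` uniformly random, without having accepted before. -/
def ReachesRandom {Ω : Type} [Fintype Ω] (τ : ℕ) (x : Config) (Y : Ω → Config) : Prop :=
  (∀ T, acceptProb (T + τ) x = mean fun ω => acceptProb T (Y ω)) ∧ ∀ T < τ, acceptProb T x = 0

/-- From the configuration `x` the machine arrives after exactly `τ` steps at the configuration
`y`, without having accepted before. -/
def Reaches (τ : ℕ) (x y : Config) : Prop := ReachesRandom τ x fun _ : Unit => y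

section Reaches

variable {Ω Ω' : Type} [Fintype Ω] [Fintype Ω'] {x y z : Config} {τ σ : ℕ}

theorem ReachesRandom.trans {Y : Ω → Config} {Z : Ω → Ω' → Config}
    (h : ReachesRandom τ x Y) (h' : ∀ ω, ReachesRandom σ (Y ω) (Z ω)) :
    ReachesRandom (τ + σ) x fun ω : Ω × Ω' => Z ω.1 ω.2 := by
  refine ⟨fun T => ?_, fun T hT => ?_⟩
  · rw [show T + (τ + σ) = T + σ + τ by omega, h.1, ← mean_mean]
    simp only [(h' _).1]
  · rcases lt_or_ge T τ with hlt | hge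
    · exact h.2 T hlt
    · obtain ⟨T, rfl⟩ := Nat.exists_eq_add_of_le' hge
      rw [h.1]
      simp [(h' _).2 T (by omega), mean]

theorem ReachesRandom.equiv {Y : Ω → Config} (h : ReachesRandom τ x Y) (e : Ω' ≃ Ω) :
    ReachesRandom τ x fun ω => Y (e ω) :=
  ⟨fun T => by rw [h.1, ← mean_equiv e], h.2⟩

theorem Reaches.trans_random {Z : Ω → Config} (h : Reaches τ x y) (h' : ReachesRandom σ y Z) :
    ReachesRandom (τ + σ) x Z :=
  (ReachesRandom.trans h fun _ => h').equiv (Equiv.punitProd Ω).symm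

theorem ReachesRandom.trans_reaches {Y Z : Ω → Config} (h : ReachesRandom τ x Y)
    (h' : ∀ ω, Reaches σ (Y ω) (Z ω)) : ReachesRandom (τ + σ) x Z :=
  (h.trans h').equiv (Equiv.prodPUnit Ω).symm

theorem Reaches.trans (h : Reaches τ x y) (h' : Reaches σ y z) : Reaches (τ + σ) x z :=
  h.trans_random h'

theorem Reaches.acceptProb_add (h : Reaches τ x y) (T : ℕ) :
    acceptProb (T + τ) x = acceptProb T y :=
  (h.1 T).trans (mean_const _)

theorem Reaches.of_step {p : Prog} {c : List Prog} {s : BTree} (h : step (p :: c, s) = PMF.pure y) :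
    Reaches 1 (p :: c, s) y :=
  ⟨fun T => (answerProb_succ_of_step_eq_pure h T _).trans (mean_const _).symm,
    by simp [acceptProb_zero_cons]⟩

theorem Reaches.assign (e : Expr) (c : List Prog) (s : BTree) :
    Reaches 1 (.assign e :: c, s) (c, e.eval s) := .of_step rfl

theorem Reaches.seq (p q : Prog) (c : List Prog) (s : BTree) :
    Reaches 1 (.seq p q :: c, s) (p :: q :: c, s) := .of_step rfl

theorem Reaches.loop_true {e : Expr} {p : Prog} {c : List Prog} {s : BTree}
    (h : (e.eval s).truth = true) : Reaches 1 (.loop e p :: c, s) (p :: .loop e p :: c, s) :=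
  .of_step (by simp [step, h])

theorem Reaches.loop_false {e : Expr} {p : Prog} {c : List Prog} {s : BTree}
    (h : (e.eval s).truth = false) : Reaches 1 (.loop e p :: c, s) (c, s) :=
  .of_step (by simp [step, h])

theorem ReachesRandom.flip (c : List Prog) (s : BTree) :
    ReachesRandom 1 (.flip :: c, s) fun b : Bool => (c, .node (ofBool b) s) :=
  ⟨fun T => answerProb_succ_flip c s T _, by simp [acceptProb_zero_cons]⟩

theorem BigStep.reaches {p : Prog} {s s' : BTree} (h : BigStep p s s' τ) (c : List Prog) :
    Reaches τ (p :: c, s) (c, s') := by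
  induction h generalizing c with
  | assign e s => exact .assign e c s
  | seq _ _ ihp ihq => exact ((Reaches.seq _ _ _ _).trans (ihp _)).trans (ihq _)
  | ite_true he _ ih => exact (Reaches.of_step (by simp [step, he])).trans (ih _)
  | ite_false he _ ih => exact (Reaches.of_step (by simp [step, he])).trans (ih _)
  | loop_false he => exact .loop_false he
  | loop_true he _ _ ihbody ihloop =>
    exact ((Reaches.loop_true he).trans (ihbody _)).trans (ihloop _)

end Reaches

/-! ### Sampling arrays -/

/-- Repeat the sampling program `p` while a clock runs, and collect the results in a list. -/
def Prog.sampleLoop (p : Prog) : Prog :=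
  .loop (.left (.right .var)) (.seq p
    (.assign (.node (.node (.left .var) (.left (.right .var)))
      (.node (.right (.left (.right (.right .var)))) (.right (.right (.right .var)))))))

/-- Repeat the sampling program `p` once for each element of the value of `e`, and attach the list
of the results on the left of the current tree. -/
def Prog.sampleList (e : Expr) (p : Prog) : Prog :=
  .seq (.assign (.node .leaf (.node e .var)))
    (.seq p.sampleLoop (.assign (.node (.left .var) (.right (.right .var)))))

section Sampling

variable {Ω : Type} [Fintype Ω] {p : Prog} {s : BTree} {F : Ω → BTree} {τ m : ℕ}

theorem ReachesRandom.sampleLoop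
    (hp : ∀ acc clk c, ReachesRandom τ (p :: c, .node acc (.node clk s))
      fun ω => (c, .node (F ω) (.node acc (.node clk s)))) (clk acc : BTree) (c : List Prog)
    (hm : clk.len = m) :
    ReachesRandom (m * (τ + 3) + 1) (p.sampleLoop :: c, .node acc (.node clk s))
      fun ω : Fin m → Ω => (c, .node (ofList ((List.ofFn fun i => F (ω i)) ++ acc.toList))
        (.node .leaf s)) := by
  induction m generalizing clk acc with
  | zero =>
    cases clk with
    | node a clk => simp at hm
    | leaf =>
      have hexit : Reaches 1 (p.sampleLoop :: c, .node acc (.node .leaf s))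
        (c, .node acc (.node .leaf s)) := .loop_false rfl
      simpa using ReachesRandom.equiv hexit (Equiv.equivPUnit (Fin 0 → Ω))
  | succ m ih =>
    cases clk with
    | leaf => simp at hm
    | node a clk =>
      have henter : Reaches 1 (p.sampleLoop :: c, .node acc (.node (.node a clk) s)) _ :=
        Reaches.loop_true rfl
      have hround := ((henter.trans (Reaches.seq _ _ _ _)).trans_random
        (hp acc (.node a clk) (_ :: p.sampleLoop :: c))).trans_reaches fun ω => Reaches.assign _ _ _
      have hall := (hround.trans fun ω => ih clk (.node (F ω) acc) (by simpa using hm)).equiv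
        (Fin.snocEquiv fun _ : Fin (m + 1) => Ω).symm
      convert hall using 1
      · ring
      · funext ω
        rw [List.ofFn_succ', List.concat_eq_append]
        simp [Fin.snocEquiv, Fin.init]

theorem ReachesRandom.sampleList
    (hp : ∀ acc clk c, ReachesRandom τ (p :: c, .node acc (.node clk s))
      fun ω => (c, .node (F ω) (.node acc (.node clk s)))) (e : Expr) (c : List Prog)
    (hm : (e.eval s).len = m) :
    ReachesRandom (m * (τ + 3) + 5) (.sampleList e p :: c, s)
      fun ω : Fin m → Ω => (c, .node (ofList (List.ofFn fun i => F (ω i))) s) := by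
  have hinit : Reaches 3 (.sampleList e p :: c, s) (p.sampleLoop ::
      .assign (.node (.left .var) (.right (.right .var))) :: c, .node .leaf (.node (e.eval s) s)) :=
    ((Reaches.seq _ _ c s).trans (Reaches.assign _ _ _)).trans (Reaches.seq _ _ _ _)
  have hloop := hinit.trans_random (ReachesRandom.sampleLoop hp (e.eval s) .leaf _ hm)
  have hall := hloop.trans_reaches fun ω => Reaches.assign _ _ _
  convert hall using 1
  · ring
  · funext ω
    simp [Expr.eval]

end Sampling

/-! ### Self-reduction -/

section Prune

variable {α β : Type*} {p q : List α → Bool}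

/-- The self-reduction: starting from `K ++ R`, drop each element of `R` in turn if the test `p`
remains true without it. The elements that turned out to be needed are collected in `K`. -/
def prune (p : List α → Bool) : List α → List α → List α
  | K, [] => K
  | K, a :: R => if p (K ++ R) then prune p K R else prune p (a :: K) R

/-- The lists on which the self-reduction evaluates the test `p`. -/
def tested (p : List α → Bool) : List α → List α → List (List α)
  | _, [] => []
  | K, a :: R => (K ++ R) :: if p (K ++ R) then tested p K R else tested p (a :: K) R

theorem prune_map (p : List β → Bool) (f : α → β) (K R : List α) :
    prune p (K.map f) (R.map f) = (prune (fun l => p (l.map f)) K R).map f := by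
  induction R generalizing K with
  | nil => rfl
  | cons a R ih =>
    simp only [List.map_cons, prune, ← List.map_append, apply_ite (List.map f), ← ih]

theorem prune_congr {K R : List α} (h : ∀ l ∈ tested q K R, p l = q l) :
    prune p K R = prune q K R := by
  induction R generalizing K with
  | nil => rfl
  | cons a R ih =>
    rw [tested, List.forall_mem_cons] at h
    rw [prune, prune, h.1]
    split_ifs at h ⊢
    · exact ih h.2
    · exact ih h.2

theorem length_tested (K R : List α) : (tested p K R).length = R.length := by
  induction R generalizing K with
  | nil => rfl
  | cons a R ih => rw [tested]; split_ifs <;> simp [ih]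

theorem nodup_prune {K R : List α} (h : (K ++ R).Nodup) : (prune p K R).Nodup := by
  induction R generalizing K with
  | nil => simpa [prune] using h
  | cons a R ih =>
    rw [prune]
    split_ifs
    · exact ih (h.sublist (by simp))
    · exact ih (by simpa using List.nodup_middle.1 h)

theorem nodup_and_length_lt_of_mem_tested {K R : List α} (h : (K ++ R).Nodup) {l : List α}
    (hl : l ∈ tested p K R) : l.Nodup ∧ l.length < (K ++ R).length := by
  induction R generalizing K with
  | nil => simp [tested] at hl
  | cons a R ih =>
    rw [tested, List.mem_cons] at hl
    rcases hl with rfl | hl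
    · exact ⟨h.sublist (by simp), by simp⟩
    · split_ifs at hl
      · exact (ih (h.sublist (by simp)) hl).imp_right (·.trans (by simp))
      · exact (ih (by simpa using List.nodup_middle.1 h) hl).imp_right
          (·.trans_eq (by simp; omega))

theorem exists_cons_of_mem_tested (hp : ∀ l l', p l → l ⊆ l' → p l') {K R : List α}
    (h : p (K ++ R)) {l : List α} (hl : l ∈ tested p K R) : ∃ a, p (a :: l) := by
  induction R generalizing K with
  | nil => simp [tested] at hl
  | cons a R ih =>
    have hcons : p (a :: (K ++ R)) := hp _ _ h List.perm_middle.subset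
    rw [tested, List.mem_cons] at hl
    rcases hl with rfl | hl
    · exact ⟨a, hcons⟩
    · split_ifs at hl with hdrop
      · exact ih hdrop hl
      · exact ih hcons hl

theorem prune_minimal (hp : ∀ l l', p l → l ⊆ l' → p l') {K R : List α} (h : p (K ++ R))
    (hK : ∀ a ∈ K, ∀ l, l ⊆ K ++ R → a ∉ l → ¬ p l) :
    p (prune p K R) ∧ ∀ a ∈ prune p K R, ∀ l, l ⊆ prune p K R → a ∉ l → ¬ p l := by
  induction R generalizing K with
  | nil => rw [List.append_nil] at h hK; exact ⟨h, hK⟩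
  | cons a R ih =>
    rw [prune]
    split_ifs with hdrop
    · exact ih hdrop fun b hb l hl =>
        hK b hb l (List.Subset.trans hl ((List.sublist_cons_self a R).append_left K).subset)
    · refine ih (hp _ _ h List.perm_middle.subset) fun b hb l hl hbl => ?_
      rcases List.mem_cons.1 hb with rfl | hb
      · intro hpl
        refine hdrop (hp _ _ hpl fun x hx => ?_)
        exact (List.mem_cons.1 (hl hx)).resolve_left (ne_of_mem_of_not_mem hx hbl)
      · exact hK b hb l (List.Subset.trans hl List.perm_middle.symm.subset) hbl

end Prune

/-! ### Binary numbers and postfix notation -/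

/-- The number with the given binary digits, the least significant one first. -/
def binary (l : List Bool) : ℕ := Nat.ofDigits 2 (l.map Bool.toNat)

theorem binary_cons (b : Bool) (l : List Bool) : binary (b :: l) = b.toNat + 2 * binary l := by
  simp [binary, Nat.ofDigits_cons]

theorem binary_lt (l : List Bool) : binary l < 2 ^ l.length := by
  simpa [binary] using Nat.ofDigits_lt_base_pow_length (b := 2) (l := l.map Bool.toNat)
    one_lt_two (List.forall_mem_map.2 fun b _ => b.toNat_lt)

theorem binary_replicate_false_append (n : ℕ) :
    binary (List.replicate n false ++ [true]) = 2 ^ n := by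
  induction n with
  | zero => rfl
  | succ n ih => rw [List.replicate_succ, List.cons_append, binary_cons, ih, pow_succ']; simp

theorem binary_injOn_length {l l' : List Bool} (hl : l.length = l'.length)
    (h : binary l = binary l') : l = l' := by
  induction l generalizing l' with
  | nil => exact (List.length_eq_zero_iff.1 hl.symm).symm
  | cons b l ih =>
    obtain ⟨b', l', rfl⟩ := List.exists_cons_of_length_eq_add_one hl.symm
    rw [binary_cons, binary_cons] at h
    have hb : b = b' := by cases b <;> cases b' <;> simp at h ⊢ <;> omega
    subst hb
    rw [ih (Nat.succ_injective hl) (by omega)]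

theorem min_binary_eq_foldl (l : List Bool) (c : ℕ) :
    min (binary l) c = l.reverse.foldl (fun a b => min (b.toNat + 2 * a) c) 0 := by
  induction l with
  | nil => simp [binary]
  | cons b l ih =>
    rw [List.reverse_cons, List.foldl_append, ← ih, binary_cons]
    simp only [List.foldl_cons, List.foldl_nil]
    omega

/-- One step of the evaluation of a postfix notation, on the stack of the trees evaluated so far.
The bit `1` stands for a leaf and the bit `0` for the binary node. -/
def parseStep (stack : BTree) (b : Bool) : BTree :=
  if b then .node .leaf stack else .node (.node stack.right.left stack.left) stack.right.right

/-- The tree with a given postfix notation. -/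
def parse (l : List Bool) : BTree := (l.foldl parseStep .leaf).left

theorem size_foldl_parseStep_le (l : List Bool) (stack : BTree) :
    (l.foldl parseStep stack).size ≤ 4 * l.length + stack.size := by
  induction l generalizing stack with
  | nil => simp
  | cons b l ih =>
    refine (ih _).trans ?_
    rcases stack with _ | ⟨a, _ | ⟨a', s⟩⟩ <;> cases b <;> simp [parseStep] <;> omega

/-- The postfix notation of a tree, which `parse` reads. -/
def postfixCode : BTree → List Bool
  | .leaf => [true]
  | .node a b => postfixCode a ++ (postfixCode b ++ [false])

theorem length_postfixCode (x : BTree) : (postfixCode x).length = x.size := by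
  induction x with
  | leaf => rfl
  | node a b ha hb => simp [postfixCode, ha, hb, add_assoc]

theorem foldl_parseStep_postfixCode (x stack : BTree) :
    (postfixCode x).foldl parseStep stack = .node x stack := by
  induction x generalizing stack with
  | leaf => rfl
  | node a b ha hb => simp [postfixCode, ha, hb, parseStep]

theorem parse_append_postfixCode (l : List Bool) (x : BTree) : parse (l ++ postfixCode x) = x := by
  rw [parse, List.foldl_append, foldl_parseStep_postfixCode, left_node]

/-! ### Searching for a certificate

Throughout, `G` is an adjacency matrix, vertices are numbers in unary notation, and `clk` is a list
whose length bounds the running time. -/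

/-- Whether the adjacency matrix `G` joins `u` to `v`; false if `u` or `v` is out of range. -/
def entry (G : BTree) (u v : ℕ) : Bool := ((G.toList.getD u .leaf).toList.getD v .leaf).truth

/-- Whether all vertices in the block `B` are adjacent to all vertices in the block `B'`. -/
def blockAdj (G B B' : BTree) : Bool :=
  B.toList.all fun u => B'.toList.all fun v => entry G u.len v.len

/-- The adjacency matrix of the graph on a list of blocks. -/
def blockMatrix (G : BTree) (L : List BTree) : BTree :=
  ofList (L.map fun B => ofList (L.map fun B' => ofBool (blockAdj G B B')))

/-- Whether most of the coin sequences in `r` let the program `code` accept the input `M`. -/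
def majority (code M r clk : BTree) : Bool :=
  decide (r.toList.countP (fun ρ => !(interpret code M ρ clk).truth) <
    r.toList.countP fun ρ => (interpret code M ρ clk).truth)

/-- A minimal list of blocks that contains a copy of the pattern detected by `code`, provided that
the majority votes give the correct answers. -/
def search (G code r clk : BTree) (L : List BTree) : List BTree :=
  prune (fun l => majority code (blockMatrix G l) r clk) [] L

/-- Whether `u` and `v` lie in adjacent blocks of `L`. -/
def covered (G : BTree) (L : List BTree) (u v : ℕ) : Bool :=
  L.any fun B => B.toList.any (fun w => decide (w.len = u)) &&
    L.any fun B' => B'.toList.any (fun w => decide (w.len = v)) && blockAdj G B B'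

/-- The pairs of vertices in adjacent blocks of `L`. -/
def coveredPairs (G : BTree) (L : List BTree) : Finset (ℕ × ℕ) :=
  (Finset.range G.len ×ˢ Finset.range G.len).filter fun x => covered G L x.1 x.2

/-- Whether the blocks in `L` reveal more edges than a random graph would allow, given that
describing a vertex takes `b` bits. -/
def certified (G : BTree) (b : ℕ) (L : List BTree) : Bool :=
  decide (8 * (b * (L.map len).sum + L.length * L.length) < (coveredPairs G L).card) &&
    decide (G.len ≤ 2 ^ b)

/-- Random blocks: `2 ^ e` blocks of `ℓ` vertices each, where `r` holds the random bits and `b` of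
them determine a vertex. -/
def blocks (G clk : BTree) (e ℓ b : ℕ) (r : BTree) : List BTree :=
  (r.toList.take (min (2 ^ e) clk.len)).map fun row => ofList ((row.toList.take ℓ).map fun bits =>
    num (min (binary ((bits.toList.take b).map truth)) G.len))

/-- The search on given random bits: `r₁` encodes a program and the sizes of the blocks, `r₂`
consists of the bits for the blocks, and `r₃` of the coins for the program. -/
def accepts (G clk r₁ r₂ r₃ : BTree) : Bool :=
  let guess := parse (r₁.toList.map truth)
  let b := guess.right.right.right.len
  certified G b (search G guess.left r₃ clk
    (blocks G clk guess.right.left.len guess.right.right.left.len b r₂))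

/-! ### The search takes polynomial time -/

/-- One step of the self-reduction, on a pair of the lists `K` and `R`. -/
def pruneStep (p : List BTree → Bool) (y : BTree) : BTree :=
  if p (y.left.toList ++ y.right.right.toList) then .node y.left y.right.right
  else .node (.node y.right.left y.left) y.right.right

theorem pruneStep_iterate (p : List BTree → Bool) (K R : List BTree) :
    (pruneStep p)^[R.length] (.node (ofList K) (ofList R)) =
      .node (ofList (prune p K R)) .leaf := by
  induction R generalizing K with
  | nil => rfl
  | cons a R ih =>
    rw [List.length_cons, Function.iterate_succ_apply, prune]
    by_cases h : p (K ++ R) = true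
    · simp [pruneStep, h, ih]
    · simpa [pruneStep, h] using ih (a :: K)

theorem size_pruneStep_iterate_le (p : List BTree → Bool) (i : ℕ) (y : BTree) :
    ((pruneStep p)^[i] y).size ≤ y.size + 4 * i := by
  have hstep : ∀ y, (pruneStep p y).size ≤ y.size + 4 := by
    intro y
    unfold pruneStep
    rcases y with _ | ⟨a, _ | ⟨b, c⟩⟩ <;> split_ifs <;> simp <;> omega
  induction i with
  | zero => simp
  | succ i ih =>
    rw [Function.iterate_succ_apply']
    exact (hstep _).trans (by omega)

theorem ofBool_eq_num (b : Bool) : ofBool b = num b.toNat := by cases b <;> rfl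

namespace FP

theorem prune {p : BTree → List BTree → Bool} {l : BTree → BTree}
    (hp : FP fun z => ofBool (p z.left z.right.toList)) (hl : FP l) :
    FP fun x => ofList (prune (p x) [] (l x).toList) := by
  obtain ⟨B, hB, hlB⟩ := hl.exists_size_le
  have hp' : FP fun z => ofBool (p z.left (z.right.left.toList ++ z.right.right.right.toList)) := by
    simpa using comp₂ (F := fun x y => ofBool (p x y.toList)) hp FP.id.left
      (FP.id.right.left.append FP.id.right.right.right)
  have hstep : FP fun z => pruneStep (p z.left) z.right :=
    hp'.ite (FP.id.right.left.node FP.id.right.right.right)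
      ((FP.id.right.right.left.node FP.id.right.left).node FP.id.right.right.right)
  have := (iterate (S := fun x => pruneStep (p x)) hstep hl ((const .leaf).node hl)
    ⟨fun n => 2 + B n + 4 * B n, ((PolyBdd.const 2).add hB).add ((PolyBdd.const 4).mul hB),
      fun x i hi => by
        have hiter := size_pruneStep_iterate_le (p x) i (.node .leaf (l x))
        have hlen := (l x).len_lt_size
        have := hlB x
        simp only [size_node, size_leaf] at hiter ⊢
        omega⟩).left
  convert this using 2 with x
  simpa [BTree.len] using (congrArg BTree.left (pruneStep_iterate (p x) [] (l x).toList)).symm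

theorem min_binary {f : BTree → BTree} {c : BTree → ℕ} (hf : FP f) (hc : FP fun x => num (c x)) :
    FP fun x => num (Min.min (binary ((f x).toList.map BTree.truth)) (c x)) := by
  obtain ⟨B, hB, hcB⟩ := hc.exists_size_le
  have hfold : ∀ (c : ℕ) (l : List BTree) (a : ℕ),
      l.foldl (fun acc b => num (Min.min (b.truth.toNat + 2 * acc.len) c)) (num a) =
        num (l.foldl (fun a b => Min.min (b.truth.toNat + 2 * a) c) a) := by
    intro c l
    induction l with
    | nil => simp
    | cons b l ih => intro a; simp [ih]
  have hbit : FP fun z => num z.right.right.truth.toNat := by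
    simpa only [ofBool_eq_num] using FP.id.right.right.truth
  have := foldl (F := fun x acc b => num (Min.min (b.truth.toNat + 2 * acc.len) (c x)))
    ((hbit.add ((const (num 2)).mul FP.id.right.left.len)).min (hc.comp FP.id.left)) hf.reverse
    (const (num 0)) ⟨B, hB, fun x l _ => by
      rw [hfold]
      refine le_trans ?_ (hcB x)
      rw [size_num, size_num]
      rcases List.eq_nil_or_concat' l with rfl | ⟨l, b, rfl⟩ <;> simp⟩
  convert this using 2 with x
  rw [hfold, min_binary_eq_foldl, ← List.map_reverse, List.foldl_map, toList_ofList]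

theorem min_two_pow {n c : BTree → ℕ} (hn : FP fun x => num (n x)) (hc : FP fun x => num (c x)) :
    FP fun x => num (Min.min (2 ^ n x) (c x)) := by
  convert min_binary (hn.append (const (ofList [ofBool true]))) hc using 3 with x
  rw [← binary_replicate_false_append]
  simp [toList_num]

theorem le_two_pow {m n : BTree → ℕ} (hm : FP fun x => num (m x)) (hn : FP fun x => num (n x)) :
    FP fun x => ofBool (decide (m x ≤ 2 ^ n x)) := by
  convert hm.le (min_two_pow hn hm) using 4
  simp

theorem parse {f : BTree → BTree} (hf : FP f) :
    FP fun x => parse ((f x).toList.map BTree.truth) := by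
  obtain ⟨B, hB, hfB⟩ := hf.exists_size_le
  have hstep : FP fun z => parseStep z.right.left z.right.right.truth :=
    FP.id.right.right.truth.ite ((const .leaf).node FP.id.right.left)
      ((FP.id.right.left.right.left.node FP.id.right.left.left).node
        FP.id.right.left.right.right)
  have := (foldl (F := fun _ stack b => parseStep stack b.truth) (f := fun _ => .leaf) hstep hf
    (const _) ⟨fun n => 4 * B n + 1, ((PolyBdd.const 4).mul hB).add (.const 1), fun x l hl => by
      have hsize := size_foldl_parseStep_le (l.map BTree.truth) .leaf
      have hlen := hl.length_le.trans_lt (f x).len_lt_size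
      have := hfB x
      rw [List.foldl_map, List.length_map, size_leaf] at hsize
      beta_reduce
      omega⟩).left
  simpa only [PatternDetection.parse, List.foldl_map] using this

theorem entry {G : BTree → BTree} {u v : BTree → ℕ} (hG : FP G) (hu : FP fun x => num (u x))
    (hv : FP fun x => num (v x)) : FP fun x => ofBool (entry (G x) (u x) (v x)) :=
  (hv.getD (hu.getD hG)).truth

theorem blockAdj {G B B' : BTree → BTree} (hG : FP G) (hB : FP B) (hB' : FP B') :
    FP fun x => ofBool (blockAdj (G x) (B x) (B' x)) :=
  all (F := fun x u => (B' x).toList.all fun v => PatternDetection.entry (G x) u.len v.len)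
    (all (F := fun z v => PatternDetection.entry (G z.left) z.right.len v.len)
      (entry (hG.comp FP.id.left.left) FP.id.left.right.len FP.id.right.len)
      (hB'.comp FP.id.left)) hB

theorem blockMatrix {G L : BTree → BTree} (hG : FP G) (hL : FP L) :
    FP fun x => blockMatrix (G x) (L x).toList :=
  map (F := fun x B => ofList ((L x).toList.map fun B' =>
      ofBool (PatternDetection.blockAdj (G x) B B')))
    (map (F := fun z B' => ofBool (PatternDetection.blockAdj (G z.left) z.right B'))
      (blockAdj (hG.comp FP.id.left.left) FP.id.left.right FP.id.right)
      (hL.comp FP.id.left)) hL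

theorem countP {F : BTree → BTree → Bool} {l : BTree → BTree}
    (hF : FP fun z => ofBool (F z.left z.right)) (hl : FP l) :
    FP fun x => num ((l x).toList.countP (F x)) := by
  simpa [List.countP_eq_length_filter] using (filter hF hl).len

theorem majority {code M r clk : BTree → BTree} (hcode : FP code) (hM : FP M) (hr : FP r)
    (hclk : FP clk) : FP fun x => ofBool (majority (code x) (M x) (r x) (clk x)) := by
  have hvote : FP fun z =>
      ofBool (PatternDetection.interpret (code z.left) (M z.left) z.right (clk z.left)).truth :=
    (interpret (hcode.comp FP.id.left) (hM.comp FP.id.left) FP.id.right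
      (hclk.comp FP.id.left)).truth
  exact (countP (F := fun x ρ => !(PatternDetection.interpret (code x) (M x) ρ (clk x)).truth)
    hvote.not hr).lt (countP (F := fun x ρ => (PatternDetection.interpret (code x) (M x) ρ
      (clk x)).truth) hvote hr)

theorem search {G code r clk L : BTree → BTree} (hG : FP G) (hcode : FP code) (hr : FP r)
    (hclk : FP clk) (hL : FP L) :
    FP fun x => ofList (search (G x) (code x) (r x) (clk x) (L x).toList) :=
  prune (p := fun x l => PatternDetection.majority (code x)
      (PatternDetection.blockMatrix (G x) l) (r x) (clk x))
    (majority (hcode.comp FP.id.left) (blockMatrix (hG.comp FP.id.left) FP.id.right)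
      (hr.comp FP.id.left) (hclk.comp FP.id.left)) hL

theorem covered {G L : BTree → BTree} {u v : BTree → ℕ} (hG : FP G) (hL : FP L)
    (hu : FP fun x => num (u x)) (hv : FP fun x => num (v x)) :
    FP fun x => ofBool (covered (G x) (L x).toList (u x) (v x)) := by
  have hmem : ∀ {B : BTree → BTree} {w : BTree → ℕ}, FP B → (FP fun x => num (w x)) →
      FP fun x => ofBool ((B x).toList.any fun y => decide (y.len = w x)) := fun {_ w} hB hw =>
    any (F := fun x y => decide (y.len = w x)) (FP.id.right.len.eq (hw.comp FP.id.left)) hB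
  refine any (F := fun x B => B.toList.any (fun w => decide (w.len = u x)) &&
    (L x).toList.any fun B' => B'.toList.any (fun w => decide (w.len = v x)) &&
      PatternDetection.blockAdj (G x) B B') ?_ hL
  refine (hmem FP.id.right (hu.comp FP.id.left)).and ?_
  refine any (F := fun z B' => B'.toList.any (fun w => decide (w.len = v z.left)) &&
    PatternDetection.blockAdj (G z.left) z.right B') ?_ (hL.comp FP.id.left)
  exact (hmem FP.id.right (hv.comp FP.id.left.left)).and
    (blockAdj (hG.comp FP.id.left.left) FP.id.left.right FP.id.right)

theorem card_coveredPairs {G L : BTree → BTree} (hG : FP G) (hL : FP L) :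
    FP fun x => num (coveredPairs (G x) (L x).toList).card := by
  have hcovered : FP fun z => num (PatternDetection.covered (G z.left.left)
      (L z.left.left).toList z.left.right.len z.right.len).toNat := by
    simpa only [ofBool_eq_num] using covered (hG.comp FP.id.left.left) (hL.comp FP.id.left.left)
      FP.id.left.right.len FP.id.right.len
  have := sum_range (F := fun x u => ∑ v ∈ Finset.range (G x).len,
      (PatternDetection.covered (G x) (L x).toList u v).toNat)
    (sum_range (F := fun z v => (PatternDetection.covered (G z.left) (L z.left).toList
      z.right.len v).toNat) hcovered (hG.comp FP.id.left).len) hG.len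
  convert this using 3 with x
  simp only [coveredPairs, Finset.card_filter, Finset.sum_product, Bool.toNat, Bool.cond_eq_ite]

theorem certified {G L : BTree → BTree} {b : BTree → ℕ} (hG : FP G) (hb : FP fun x => num (b x))
    (hL : FP L) : FP fun x => ofBool (certified (G x) (b x) (L x).toList) := by
  have hsum : FP fun x => num ((L x).toList.map BTree.len).sum :=
    sum_map (F := fun _ B => B.len) FP.id.right.len hL
  exact (((const (num 8)).mul ((hb.mul hsum).add (hL.len.mul hL.len))).lt
    (card_coveredPairs hG hL)).and (le_two_pow hG.len hb)

theorem blocks {G clk r : BTree → BTree} {e ℓ b : BTree → ℕ} (hG : FP G) (hclk : FP clk)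
    (he : FP fun x => num (e x)) (hℓ : FP fun x => num (ℓ x)) (hb : FP fun x => num (b x))
    (hr : FP r) : FP fun x => ofList (blocks (G x) (clk x) (e x) (ℓ x) (b x) (r x)) := by
  have hvertex : FP fun z => num (Min.min
      (binary ((z.right.toList.take (b z.left.left)).map BTree.truth)) (G z.left.left).len) := by
    simpa using min_binary ((hb.comp FP.id.left.left).take FP.id.right)
      (hG.comp FP.id.left.left).len
  have hblock : FP fun z => ofList ((z.right.toList.take (ℓ z.left)).map fun bits => num (Min.min
      (binary ((bits.toList.take (b z.left)).map BTree.truth)) (G z.left).len)) := by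
    simpa using map (F := fun z bits => num (Min.min
      (binary ((bits.toList.take (b z.left)).map BTree.truth)) (G z.left).len)) hvertex
      ((hℓ.comp FP.id.left).take FP.id.right)
  simpa only [toList_ofList, PatternDetection.blocks] using map (F := fun x row =>
    ofList ((row.toList.take (ℓ x)).map fun bits => num (Min.min
    (binary ((bits.toList.take (b x)).map BTree.truth)) (G x).len))) hblock
    ((min_two_pow he hclk.len).take hr)

theorem accepts {G clk r₁ r₂ r₃ : BTree → BTree} (hG : FP G) (hclk : FP clk) (hr₁ : FP r₁)
    (hr₂ : FP r₂) (hr₃ : FP r₃) :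
    FP fun x => ofBool (accepts (G x) (clk x) (r₁ x) (r₂ x) (r₃ x)) := by
  have hguess := parse hr₁
  have hb := hguess.right.right.right.len
  have hblocks := blocks hG hclk hguess.right.left.len hguess.right.right.left.len hb hr₂
  simpa only [toList_ofList, PatternDetection.accepts] using
    certified hG hb (search hG hguess.left hr₃ hclk hblocks)

end FP

/-! ### The universal search algorithm -/

/-- A list of bits as a tree. -/
def bits₁ {t : ℕ} (ω : Fin t → Bool) : BTree := ofList (List.ofFn fun i => ofBool (ω i))

/-- A two-dimensional array of bits as a tree. -/
def bits₂ {t : ℕ} (ω : Fin t → Fin t → Bool) : BTree := ofList (List.ofFn fun i => bits₁ (ω i))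

/-- A three-dimensional array of bits as a tree. -/
def bits₃ {t : ℕ} (ω : Fin t → Fin t → Fin t → Bool) : BTree :=
  ofList (List.ofFn fun i => bits₂ (ω i))

/-- Sample a list of bits whose length is given by `e`. -/
def sample₁ (e : Expr) : Prog := .sampleList e .flip

/-- Sample a two-dimensional array of bits whose side length is given by `e`. -/
def sample₂ (e : Expr) : Prog := .sampleList e (sample₁ (e.subst (.right (.right .var))))

/-- Sample a three-dimensional array of bits whose side length is given by `e`. -/
def sample₃ (e : Expr) : Prog := .sampleList e (sample₂ (e.subst (.right (.right .var))))

/-- The running time of sampling a `d`-dimensional array of bits of side length `t`. -/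
def sampleTime (t : ℕ) : ℕ → ℕ
  | 0 => 1
  | d + 1 => t * (sampleTime t d + 3) + 5

/-- A bound for the size of a `d`-dimensional array of bits of side length `t`. -/
def arraySize (t : ℕ) : ℕ → ℕ
  | 0 => 3
  | d + 1 => t * (arraySize t d + 1) + 1

theorem polyBdd_sampleTime (d : ℕ) : PolyBdd fun t => sampleTime t d := by
  induction d with
  | zero => exact .const 1
  | succ d ih => exact (PolyBdd.id.mul (ih.add (.const 3))).add (.const 5)

theorem polyBdd_arraySize (d : ℕ) : PolyBdd fun t => arraySize t d := by
  induction d with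
  | zero => exact .const 3
  | succ d ih => exact (PolyBdd.id.mul (ih.add (.const 1))).add (.const 1)

namespace ReachesRandom

variable {t : ℕ} {e : Expr} {s : BTree}

theorem sample₁ (h : (e.eval s).len = t) (c : List Prog) :
    ReachesRandom (sampleTime t 1) (sample₁ e :: c, s)
      fun ω : Fin t → Bool => (c, .node (bits₁ ω) s) :=
  .sampleList (fun _ _ c => .flip c _) e c h

theorem sample₂ (h : (e.eval s).len = t) (c : List Prog) :
    ReachesRandom (sampleTime t 2) (sample₂ e :: c, s)
      fun ω : Fin t → Fin t → Bool => (c, .node (bits₂ ω) s) :=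
  .sampleList (fun _ _ c => .sample₁ (by simpa [Expr.eval_subst, Expr.eval] using h) c) e c h

theorem sample₃ (h : (e.eval s).len = t) (c : List Prog) :
    ReachesRandom (sampleTime t 3) (sample₃ e :: c, s)
      fun ω : Fin t → Fin t → Fin t → Bool => (c, .node (bits₃ ω) s) :=
  .sampleList (fun _ _ c => .sample₂ (by simpa [Expr.eval_subst, Expr.eval] using h) c) e c h

end ReachesRandom

theorem size_ofList_ofFn_le {t b : ℕ} {F : Fin t → BTree} (h : ∀ i, (F i).size ≤ b) :
    (ofList (List.ofFn F)).size ≤ t * (b + 1) + 1 := by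
  rw [size_ofList]
  gcongr
  refine (List.sum_le_card_nsmul _ (b + 1) fun a ha => ?_).trans (by simp)
  obtain ⟨_, ⟨i, rfl⟩, rfl⟩ := by simpa only [List.mem_map, List.mem_ofFn] using ha
  exact Nat.add_le_add_right (h i) 1

theorem size_bits₁_le {t : ℕ} (ω : Fin t → Bool) : (bits₁ ω).size ≤ arraySize t 1 :=
  size_ofList_ofFn_le fun _ => size_ofBool_le _

theorem size_bits₂_le {t : ℕ} (ω : Fin t → Fin t → Bool) : (bits₂ ω).size ≤ arraySize t 2 :=
  size_ofList_ofFn_le fun _ => size_bits₁_le _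

theorem size_bits₃_le {t : ℕ} (ω : Fin t → Fin t → Fin t → Bool) :
    (bits₃ ω).size ≤ arraySize t 3 :=
  size_ofList_ofFn_le fun _ => size_bits₂_le _

/-- The random bits of stage `t` of the algorithm: for the guesses, for the blocks, and for the
coins of the guessed program. -/
abbrev Coins (t : ℕ) : Type :=
  ((Fin t → Bool) × (Fin t → Fin t → Fin t → Bool)) × (Fin t → Fin t → Bool)

/-- The event that stage `t` finds a certificate in `G`. -/
def Succeeds (G : BTree) (t : ℕ) (ω : Coins t) : Prop :=
  accepts G (num t) (bits₁ ω.1.1) (bits₃ ω.1.2) (bits₂ ω.2) = true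

/-- The content of the program variable at the beginning of stage `t`. -/
def stageState (G : BTree) (t : ℕ) : BTree := .node (ofBool true) (.node (num t) G)

/-- The content of the program variable once the random bits of stage `t` have been sampled. -/
def sampledState (G : BTree) (t : ℕ) (ω : Coins t) : BTree :=
  .node (bits₂ ω.2) (.node (bits₃ ω.1.2) (.node (bits₁ ω.1.1) (stageState G t)))

/-- The deterministic part of a stage: it leads either to a state whose left subtree is a leaf or to
the next stage. -/
def update (z : BTree) : BTree :=
  if accepts z.right.right.right.right.right z.right.right.right.right.left
    z.right.right.left z.right.left z.left then .node .leaf .leaf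
  else .node (ofBool true) (.node (.node .leaf z.right.right.right.right.left)
    z.right.right.right.right.right)

theorem FP.update : FP update :=
  (FP.accepts FP.id.right.right.right.right.right FP.id.right.right.right.right.left
    FP.id.right.right.left FP.id.right.left FP.id.left).ite (const _)
    ((const _).node (((const .leaf).node FP.id.right.right.right.right.left).node
      FP.id.right.right.right.right.right))

theorem update_of_succeeds {G : BTree} {t : ℕ} {ω : Coins t} (h : Succeeds G t ω) :
    update (sampledState G t ω) = .node .leaf .leaf := if_pos h

theorem update_of_not_succeeds {G : BTree} {t : ℕ} {ω : Coins t} (h : ¬ Succeeds G t ω) :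
    update (sampledState G t ω) = stageState G (t + 1) := if_neg h

theorem exists_size_sampledState_le : ∃ Z, PolyBdd Z ∧
    ∀ (G : BTree) (t : ℕ) (ω : Coins t), (sampledState G t ω).size ≤ Z (G.size + t) := by
  refine ⟨fun n => arraySize n 1 + arraySize n 2 + arraySize n 3 + (2 * n + 9),
    (((polyBdd_arraySize 1).add (polyBdd_arraySize 2)).add (polyBdd_arraySize 3)).add
      (((PolyBdd.const 2).mul .id).add (.const 9)), fun G t ω => ?_⟩
  have hmono : ∀ d, arraySize t d ≤ arraySize (G.size + t) d := fun d =>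
    (polyBdd_arraySize d).1 (Nat.le_add_left t G.size)
  have h₁ := (size_bits₁_le ω.1.1).trans (hmono 1)
  have h₂ := (size_bits₂_le ω.2).trans (hmono 2)
  have h₃ := (size_bits₃_le ω.1.2).trans (hmono 3)
  have hnum := size_num t
  have htrue := size_ofBool_le true
  simp only [sampledState, stageState, size_node]
  omega

/-- The random part of a stage. -/
def sampling : Prog :=
  .seq (sample₁ (.left (.right .var))) (.seq (sample₃ (.left (.right (.right .var))))
    (sample₂ (.left (.right (.right (.right .var))))))

/-- The loop through the stages, for a program `p` that computes `update`. -/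
def mainLoop (p : Prog) : Prog := .loop (.left .var) (.seq sampling p)

/-- The running time of the random part of stage `t`. -/
def samplingTime (t : ℕ) : ℕ := 4 + sampleTime t 1 + sampleTime t 3 + sampleTime t 2

theorem polyBdd_samplingTime : PolyBdd samplingTime :=
  (((PolyBdd.const 4).add (polyBdd_sampleTime 1)).add (polyBdd_sampleTime 3)).add
    (polyBdd_sampleTime 2)

theorem ReachesRandom.sampling (p : Prog) (G : BTree) (t : ℕ) :
    ReachesRandom (samplingTime t) ([mainLoop p], stageState G t)
      fun ω : Coins t => (p :: [mainLoop p], sampledState G t ω) := by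
  have henter : Reaches 3 ([mainLoop p], stageState G t) (_, stageState G t) :=
    ((Reaches.loop_true rfl).trans (Reaches.seq _ _ _ _)).trans (Reaches.seq _ _ _ _)
  have hguess := (henter.trans_random (.sample₁ (t := t) (by exact len_num t) _)).trans_reaches
    fun ω => Reaches.seq _ _ _ _
  have hall := (hguess.trans fun ω => .sample₃ (t := t) (by exact len_num t) _).trans
    fun ω => .sample₂ (t := t) (by exact len_num t) (p :: [mainLoop p])
  convert hall using 1
  · simp only [samplingTime]
    ring
  · rfl

theorem acceptProb_mainLoop_eq_zero {p : Prog} (hp : ∀ x, ∃ τ, BigStep p x (update x) τ)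
    {G : BTree} (hG : ∀ t ω, ¬ Succeeds G t ω) (T t : ℕ) :
    acceptProb T ([mainLoop p], stageState G t) = 0 := by
  induction T using Nat.strong_induction_on generalizing t with
  | _ T ih =>
    have hsampling := ReachesRandom.sampling p G t
    rcases lt_or_ge T (samplingTime t) with hlt | hge
    · exact hsampling.2 T hlt
    obtain ⟨T, rfl⟩ := Nat.exists_eq_add_of_le' hge
    have hupdate : ∀ ω : Coins t, acceptProb T (p :: [mainLoop p], sampledState G t ω) = 0 := by
      intro ω
      obtain ⟨τ, hτ⟩ := hp (sampledState G t ω)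
      have hreach := hτ.reaches [mainLoop p]
      rcases lt_or_ge T τ with hlt | hge
      · exact hreach.2 T hlt
      · obtain ⟨T, rfl⟩ := Nat.exists_eq_add_of_le' hge
        rw [hreach.acceptProb_add, update_of_not_succeeds (hG t ω)]
        exact ih _ (by simp only [samplingTime]; omega) _
    simp [hsampling.1, hupdate, mean]

theorem le_acceptProb_mainLoop_succ {p : Prog} {G : BTree} {t S T : ℕ} {a : ℝ}
    (hp : ∀ ω : Coins t, ∃ τ, samplingTime t + τ + 2 ≤ S ∧
      BigStep p (sampledState G t ω) (update (sampledState G t ω)) τ) (ha : 0 ≤ a)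
    (hnext : ENNReal.ofReal a ≤ acceptProb T ([mainLoop p], stageState G (t + 1))) :
    ENNReal.ofReal (prob (Succeeds G t) + (1 - prob (Succeeds G t)) * a) ≤
      acceptProb (T + S) ([mainLoop p], stageState G t) := by
  classical
  have hS : samplingTime t ≤ S := by
    obtain ⟨τ, hτ, -⟩ := hp ((fun _ => true, fun _ _ _ => true), fun _ _ => true)
    omega
  have hupdate : ∀ ω : Coins t, ENNReal.ofReal (if Succeeds G t ω then 1 else a) ≤
      acceptProb (T + (S - samplingTime t)) (p :: [mainLoop p], sampledState G t ω) := by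
    intro ω
    obtain ⟨τ, hτ, hstep⟩ := hp ω
    rw [show T + (S - samplingTime t) = T + (S - samplingTime t - τ) + τ by omega,
      (hstep.reaches [mainLoop p]).acceptProb_add]
    split_ifs with h
    · have hexit : Reaches 1 ([mainLoop p], .node .leaf .leaf) ([], .node .leaf .leaf) :=
        .loop_false rfl
      rw [update_of_succeeds h, show T + (S - samplingTime t - τ) =
        T + (S - samplingTime t - τ - 1) + 1 by omega, hexit.acceptProb_add]
      exact (ENNReal.ofReal_one.trans (answerProb_halted _ (.node .leaf .leaf)).symm).le
    · rw [update_of_not_succeeds h]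
      exact hnext.trans (acceptProb_mono (by omega) _)
  rw [show T + S = T + (S - samplingTime t) + samplingTime t by omega,
    (ReachesRandom.sampling p G t).1, ← mean_ite_one _ ha]
  exact mean_mono hupdate

theorem le_acceptProb_mainLoop {p : Prog} {G : BTree} {S m t : ℕ}
    (hp : ∀ i < m, ∀ ω : Coins (t + i), ∃ τ, samplingTime (t + i) + τ + 2 ≤ S ∧
      BigStep p (sampledState G (t + i) ω) (update (sampledState G (t + i) ω)) τ) :
    ENNReal.ofReal (1 - ∏ i ∈ Finset.range m, (1 - prob (Succeeds G (t + i)))) ≤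
      acceptProb (m * S) ([mainLoop p], stageState G t) := by
  induction m generalizing t with
  | zero => simp
  | succ m ih =>
    have hprob : ∀ i, 0 ≤ 1 - prob (Succeeds G i) ∧ 1 - prob (Succeeds G i) ≤ 1 := fun i =>
      ⟨sub_nonneg.2 (prob_le_one _), sub_le_self _ (prob_nonneg _)⟩
    have hshift : ∀ i, t + 1 + i = t + (i + 1) := fun i => by omega
    have hnext := ih (t := t + 1) fun i hi => by
      rw [hshift]
      exact hp (i + 1) (Nat.succ_lt_succ hi)
    have hstage := le_acceptProb_mainLoop_succ (t := t) (hp 0 m.succ_pos)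
      (sub_nonneg.2 (Finset.prod_le_one (fun i _ => (hprob _).1) fun i _ => (hprob _).2)) hnext
    have hprod : ∏ i ∈ Finset.range (m + 1), (1 - prob (Succeeds G (t + i))) =
        (∏ i ∈ Finset.range m, (1 - prob (Succeeds G (t + 1 + i)))) *
          (1 - prob (Succeeds G t)) := by
      rw [Finset.prod_range_succ']
      exact congrArg (· * _) (Finset.prod_congr rfl fun i _ => by rw [hshift])
    rw [hprod, Nat.add_one_mul]
    convert hstage using 2
    ring

theorem exists_universal_search : ∃ (A : Prog) (B : ℕ → ℕ), PolyBdd B ∧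
    (∀ G, (∀ t ω, ¬ Succeeds G t ω) → ∀ T, acceptProb T ([A], G) = 0) ∧
    ∀ (G : BTree) (m : ℕ),
      ENNReal.ofReal (1 - ∏ t ∈ Finset.range m, (1 - prob (Succeeds G t))) ≤
        acceptProb (B (G.size + m)) ([A], G) := by
  obtain ⟨p, B, hB, hp⟩ := FP.update
  obtain ⟨Z, hZ, hsize⟩ := exists_size_sampledState_le
  let init : Prog := .assign (.node (.lit (ofBool true)) (.node .leaf .var))
  have hinit : ∀ G, Reaches 2 ([.seq init (mainLoop p)], G) ([mainLoop p], stageState G 0) :=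
    fun G => (Reaches.seq init (mainLoop p) [] G).trans (Reaches.assign _ _ _)
  let S : ℕ → ℕ := fun n => samplingTime n + B (Z n) + 2
  have hS : PolyBdd S := (polyBdd_samplingTime.add (hB.comp hZ)).add (.const 2)
  refine ⟨.seq init (mainLoop p), fun n => n * S n + 2, (PolyBdd.id.mul hS).add (.const 2),
    fun G hG T => ?_, fun G m => ?_⟩
  · rcases lt_or_ge T 2 with hlt | hge
    · exact (hinit G).2 T hlt
    · obtain ⟨T, rfl⟩ := Nat.exists_eq_add_of_le' hge
      rw [(hinit G).acceptProb_add]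
      exact acceptProb_mainLoop_eq_zero (fun x => (hp x).1.imp fun τ h => h.2) hG _ _
  · have hstages := le_acceptProb_mainLoop (p := p) (G := G) (S := S (G.size + m)) (m := m) (t := 0)
      fun i hi ω => by
        obtain ⟨⟨τ, hτ, hstep⟩, -⟩ := hp (sampledState G (0 + i) ω)
        have hi' : 0 + i ≤ G.size + m := by omega
        have hcost := hτ.trans (hB.1 ((hsize G _ ω).trans (hZ.1 (by omega :
          G.size + (0 + i) ≤ G.size + m))))
        have hsampling := polyBdd_samplingTime.1 hi'
        exact ⟨τ, by simp only [S]; omega, hstep⟩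
    have hstage : ∀ i, prob (Succeeds G (0 + i)) = prob (Succeeds G i) := fun i => by rw [zero_add]
    simp only [hstage] at hstages
    rw [(hinit G).acceptProb_add]
    exact hstages.trans (acceptProb_mono (Nat.mul_le_mul_right _ (Nat.le_add_left _ _)) _)

/-! ### Correctness of the search -/

section Encode

variable {n : ℕ} (G : SimpleGraph (Fin n))

theorem len_encode : (encode G).len = n := by
  simp [encode]

theorem getD_ofFn (F : Fin n → BTree) (i : ℕ) :
    (List.ofFn F).getD i .leaf = if h : i < n then F ⟨i, h⟩ else .leaf := by
  split_ifs with h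
  · rw [List.getD_eq_getElem _ _ (by simpa using h), List.getElem_ofFn]
  · rw [List.getD_eq_default _ _ (by simpa using h)]

theorem entry_encode (u v : ℕ) :
    entry (encode G) u v ↔ ∃ (hu : u < n) (hv : v < n), G.Adj ⟨u, hu⟩ ⟨v, hv⟩ := by
  classical
  rw [entry, encode, toList_ofList, getD_ofFn]
  by_cases hu : u < n
  · rw [dif_pos hu, toList_ofList, getD_ofFn]
    by_cases hv : v < n
    · simp [hu, hv]
    · simp [hv, truth]
  · simp [hu, truth]

theorem blockAdj_iff (M B B' : BTree) :
    blockAdj M B B' ↔ ∀ u ∈ B.toList, ∀ v ∈ B'.toList, entry M u.len v.len := by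
  simp only [blockAdj, List.all_eq_true]

theorem blockAdj_encode_symm {B B' : BTree} (h : blockAdj (encode G) B B') :
    blockAdj (encode G) B' B := by
  simp only [blockAdj_iff, entry_encode] at h ⊢
  intro u hu v hv
  obtain ⟨hvn, hun, hadj⟩ := h v hv u hu
  exact ⟨hun, hvn, hadj.symm⟩

theorem not_blockAdj_encode_self {B : BTree} (hB : B.toList ≠ []) :
    ¬ blockAdj (encode G) B B := by
  simp only [blockAdj_iff, entry_encode]
  intro h
  obtain ⟨u, hu⟩ := List.exists_mem_of_ne_nil _ hB
  obtain ⟨_, _, hadj⟩ := h u hu u hu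
  exact G.irrefl hadj

end Encode

/-- The vertices in the block `B` of a graph on `n` vertices. -/
def vertices (n : ℕ) (B : BTree) : Finset (Fin n) :=
  Finset.univ.filter fun v => v.1 ∈ B.toList.map len

theorem mem_vertices {n : ℕ} {B : BTree} {v : Fin n} :
    v ∈ vertices n B ↔ ∃ w ∈ B.toList, w.len = v := by
  simp [vertices]

theorem card_vertices_le (n : ℕ) (B : BTree) : (vertices n B).card ≤ B.len := by
  rw [← Finset.card_image_of_injective _ Fin.val_injective]
  calc ((vertices n B).image Fin.val).card
      ≤ (B.toList.map len).toFinset.card := Finset.card_le_card fun x hx => by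
        obtain ⟨v, hv, rfl⟩ := Finset.mem_image.1 hx
        exact List.mem_toFinset.2 (Finset.mem_filter.1 hv).2
    _ ≤ B.len := (List.toFinset_card_le _).trans_eq (List.length_map _)

section Certified

variable {n : ℕ} {G : SimpleGraph (Fin n)}

theorem adj_of_blockAdj_encode {B B' : BTree} (h : blockAdj (encode G) B B') {u v : Fin n}
    (hu : u ∈ vertices n B) (hv : v ∈ vertices n B') : G.Adj u v := by
  obtain ⟨w, hw, hwu⟩ := mem_vertices.1 hu
  obtain ⟨w', hw', hwv⟩ := mem_vertices.1 hv
  obtain ⟨_, _, hadj⟩ := (entry_encode G _ _).1 ((blockAdj_iff _ _ _).1 h w hw w' hw')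
  simpa only [hwu, hwv] using hadj

theorem covered_iff {M : BTree} {L : List BTree} {u v : Fin n} :
    covered M L u v ↔ ∃ B ∈ L, ∃ B' ∈ L, u ∈ vertices n B ∧ v ∈ vertices n B' ∧
      blockAdj M B B' := by
  simp only [covered, List.any_eq_true, Bool.and_eq_true, decide_eq_true_eq, mem_vertices]
  grind

theorem card_coveredPairs_encode (L : List BTree) : (coveredPairs (encode G) L).card =
    (Finset.univ.filter fun x : Fin n × Fin n => covered (encode G) L x.1 x.2).card := by
  rw [← Finset.card_image_of_injective _
    (Fin.val_injective.prodMap (Fin.val_injective (n := n)))]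
  congr 1
  ext ⟨u, v⟩
  simp only [coveredPairs, len_encode, Finset.mem_filter, Finset.mem_product, Finset.mem_range,
    Finset.mem_image, Finset.mem_univ, true_and, Prod.exists, Prod.map_apply, Prod.mk.injEq]
  constructor
  · rintro ⟨⟨hu, hv⟩, h⟩
    exact ⟨⟨u, hu⟩, ⟨v, hv⟩, h, rfl, rfl⟩
  · rintro ⟨u, v, h, rfl, rfl⟩
    exact ⟨⟨u.2, v.2⟩, h⟩

theorem certified_encode_iff {b : ℕ} {L : List BTree} :
    certified (encode G) b L ↔ 8 * (b * (L.map len).sum + L.length ^ 2) <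
      (Finset.univ.filter fun x : Fin n × Fin n => covered (encode G) L x.1 x.2).card ∧
      n ≤ 2 ^ b := by
  rw [certified, Bool.and_eq_true, decide_eq_true_iff, decide_eq_true_iff,
    card_coveredPairs_encode, len_encode, sq]

theorem HasCertificate.of_certified {b : ℕ} {L : List BTree}
    (h : certified (encode G) b L) : HasCertificate G := by
  obtain ⟨hcard, hn⟩ := certified_encode_iff.1 h
  refine ⟨b, L.length, fun i => vertices n L[i], by rwa [Fintype.card_fin],
    (Nat.mul_le_mul_left 8 ?_).trans_lt (hcard.trans_le (Finset.card_le_card fun x hx => ?_))⟩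
  · rw [← Fin.sum_univ_fun_getElem L len]
    gcongr
    exact card_vertices_le _ _
  · obtain ⟨B, hB, B', hB', hu, hv, hadj⟩ := covered_iff.1 (Finset.mem_filter.1 hx).2
    obtain ⟨i, hi, rfl⟩ := List.getElem_of_mem hB
    obtain ⟨j, hj, rfl⟩ := List.getElem_of_mem hB'
    exact mem_blockPairs.2 ⟨⟨i, hi⟩, ⟨j, hj⟩, hu, hv, fun _ hu _ hv =>
      adj_of_blockAdj_encode hadj hu hv⟩

theorem certified_of_perm {k b ℓ : ℕ} {L : List BTree} {B : Fin k → BTree}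
    (hL : L.Perm (List.ofFn B)) (hB : ∀ i, (B i).len = ℓ) (hn : n ≤ 2 ^ b)
    {X : Finset (Fin n × Fin n)} (hX : ∀ x ∈ X, ∃ i j, x.1 ∈ vertices n (B i) ∧
      x.2 ∈ vertices n (B j) ∧ blockAdj (encode G) (B i) (B j))
    (hcard : 8 * (b * (k * ℓ) + k ^ 2) < X.card) : certified (encode G) b L := by
  have hsum : (L.map len).sum = k * ℓ := by
    rw [(hL.map _).sum_eq, List.map_ofFn, List.sum_ofFn]
    simp [hB]
  have hlen : L.length = k := by rw [hL.length_eq, List.length_ofFn]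
  refine certified_encode_iff.2 ⟨?_, hn⟩
  rw [hsum, hlen]
  refine hcard.trans_le (Finset.card_le_card fun x hx => ?_)
  obtain ⟨i, j, hi, hj, hadj⟩ := hX x hx
  have hmem : ∀ i, B i ∈ L := fun i => hL.mem_iff.2 (List.mem_ofFn.2 ⟨i, rfl⟩)
  exact Finset.mem_filter.2 ⟨Finset.mem_univ _,
    covered_iff.2 ⟨B i, hmem i, B j, hmem j, hi, hj, hadj⟩⟩

end Certified

section BlockGraph

variable {n k m : ℕ}

/-- The graph on a family of blocks in which two blocks are adjacent if all their vertices are. -/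
def blockGraph (G : SimpleGraph (Fin n)) (S : Fin m → BTree) : SimpleGraph (Fin m) where
  Adj i j := i ≠ j ∧ blockAdj (encode G) (S i) (S j)
  symm := ⟨fun _ _ h => ⟨h.1.symm, blockAdj_encode_symm G h.2⟩⟩
  loopless := ⟨fun _ h => h.1 rfl⟩

theorem blockMatrix_encode (G : SimpleGraph (Fin n)) {S : Fin m → BTree}
    (hS : ∀ i, (S i).toList ≠ []) :
    blockMatrix (encode G) (List.ofFn S) = encode (blockGraph G S) := by
  have hadj : ∀ i j, blockAdj (encode G) (S i) (S j) ↔ (blockGraph G S).Adj i j := by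
    refine fun i j => ⟨fun h => ⟨?_, h⟩, fun h => h.2⟩
    rintro rfl
    exact not_blockAdj_encode_self G (hS i) h
  rw [blockMatrix, encode.eq_def (blockGraph G S), List.map_ofFn]
  simp only [Function.comp_def, List.map_ofFn, ← hadj, Bool.decide_eq_true]

/-- The blocks with indices in `l` contain a copy of `H`. -/
def HasCopy (G : SimpleGraph (Fin n)) (H : SimpleGraph (Fin k)) (S : Fin m → BTree)
    (l : List (Fin m)) : Prop :=
  ∃ f : Fin k → Fin m, Function.Injective f ∧ (∀ i, f i ∈ l) ∧
    ∀ i j, H.Adj i j → blockAdj (encode G) (S (f i)) (S (f j))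

variable {G : SimpleGraph (Fin n)} {H : SimpleGraph (Fin k)} {S : Fin m → BTree}

theorem HasCopy.mono {l l' : List (Fin m)} (h : HasCopy G H S l) (hl : l ⊆ l') :
    HasCopy G H S l' := by
  obtain ⟨f, hf, hfl, hadj⟩ := h
  exact ⟨f, hf, fun i => hl (hfl i), hadj⟩

theorem hasCopy_iff_isContained {l : List (Fin m)} (hl : l.Nodup) :
    HasCopy G H S l ↔ H.IsContained (blockGraph G (S ∘ l.get)) := by
  constructor
  · rintro ⟨f, hf, hfl, hadj⟩
    choose φ hφ using fun i => List.mem_iff_get.1 (hfl i)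
    have hinj : Function.Injective φ := fun i j h =>
      hf (by rw [← hφ i, ← hφ j, h])
    refine ⟨⟨⟨φ, fun {i j} h => ⟨hinj.ne h.ne, ?_⟩⟩, hinj⟩⟩
    simpa only [Function.comp_apply, hφ] using hadj i j h
  · rintro ⟨φ⟩
    exact ⟨fun i => l.get (φ i), (List.nodup_iff_injective_get.1 hl).comp φ.injective,
      fun i => List.get_mem _ _, fun i j h => (φ.toHom.map_adj h).2⟩

open Classical in
/-- The vote decides correctly whether a list of blocks contains a copy of the pattern, for all
lists occurring in the pruning that uses the correct decisions. -/
def VotesCorrect (G : SimpleGraph (Fin n)) (H : SimpleGraph (Fin k)) (S : Fin m → BTree)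
    (code r clk : BTree) : Prop :=
  ∀ l ∈ tested (fun l => decide (HasCopy G H S l)) [] (List.finRange m),
    majority code (blockMatrix (encode G) (l.map S)) r clk = decide (HasCopy G H S l)

open Classical in
theorem search_eq_prune {code r clk : BTree} (h : VotesCorrect G H S code r clk) :
    search (encode G) code r clk (List.ofFn S) =
      (prune (fun l => decide (HasCopy G H S l)) [] (List.finRange m)).map S := by
  rw [search, List.ofFn_eq_map, ← prune_congr h, ← List.map_nil (f := S), prune_map]

theorem search_perm_copy {code r clk : BTree} (hcopy : HasCopy G H S (List.finRange m))
    (h : VotesCorrect G H S code r clk) :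
    ∃ f : Fin k → Fin m, Function.Injective f ∧
      (∀ i j, H.Adj i j → blockAdj (encode G) (S (f i)) (S (f j))) ∧
      (search (encode G) code r clk (List.ofFn S)).Perm (List.ofFn (S ∘ f)) := by
  classical
  obtain ⟨hfound, hminimal⟩ := prune_minimal (p := fun l => decide (HasCopy G H S l)) (K := [])
    (R := List.finRange m) (by simpa using fun l l' => HasCopy.mono) (by simpa using hcopy)
    (by simp)
  rw [search_eq_prune h]
  set l := prune (fun l => decide (HasCopy G H S l)) [] (List.finRange m)
  have hl : l.Nodup := nodup_prune (by simpa using List.nodup_finRange m)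
  obtain ⟨f, hf, hfl, hadj⟩ := of_decide_eq_true hfound
  have hsub : List.ofFn f ⊆ l := by
    intro a ha
    obtain ⟨i, rfl⟩ := List.mem_ofFn.1 ha
    exact hfl i
  refine ⟨f, hf, hadj, ?_⟩
  rw [← List.map_ofFn]
  refine ((List.perm_ext_iff_of_nodup hl (List.nodup_ofFn.2 hf)).2 fun a =>
    ⟨fun ha => ?_, fun ha => hsub ha⟩).map S
  by_contra hunused
  exact hminimal a ha (List.ofFn f) hsub hunused
    (decide_eq_true ⟨f, hf, fun i => List.mem_ofFn.2 ⟨i, rfl⟩, hadj⟩)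

end BlockGraph

/-! ### Random blocks -/

theorem map_truth_toList_bits₁ {t : ℕ} (ω : Fin t → Bool) :
    (bits₁ ω).toList.map truth = List.ofFn ω := by
  simp [bits₁, List.map_ofFn, Function.comp_def]

theorem take_ofFn {α : Type*} {t N : ℕ} (h : N ≤ t) (F : Fin t → α) :
    (List.ofFn F).take N = List.ofFn fun i : Fin N => F (Fin.castLE h i) :=
  List.ext_getElem (by simpa using h) fun i _ _ => by simp

/-- The number with the binary digits `y`, as an element of `Fin (2 ^ b)`. -/
def digits {b : ℕ} (y : Fin b → Bool) : Fin (2 ^ b) :=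
  ⟨binary (List.ofFn y), by simpa using binary_lt (List.ofFn y)⟩

theorem isUniform_digits (b : ℕ) : IsUniform (digits (b := b)) := by
  refine .of_bijective ((Fintype.bijective_iff_injective_and_card _).2 ⟨fun y y' h => ?_, by simp⟩)
  exact List.ofFn_injective (binary_injOn_length (by simp) (congrArg Fin.val h))

/-- The block of the vertices with the numbers `x`. A number that is not a vertex of the graph on
`n` vertices is replaced by `n`, which is not a vertex either. -/
def block (n : ℕ) {m ℓ : ℕ} (x : Fin ℓ → Fin m) : BTree :=
  ofList (List.ofFn fun j => num (min (x j) n))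

/-- The numbers given by the initial part of a three-dimensional array of random bits. -/
def sampled {t N ℓ b : ℕ} (hN : N ≤ t) (hℓ : ℓ ≤ t) (hb : b ≤ t)
    (r : Fin t → Fin t → Fin t → Bool) : Fin N → Fin ℓ → Fin (2 ^ b) := fun i j =>
  digits fun c => r (Fin.castLE hN i) (Fin.castLE hℓ j) (Fin.castLE hb c)

theorem blocks_bits₃ {n t e ℓ b : ℕ} (G : SimpleGraph (Fin n)) (he : 2 ^ e ≤ t) (hℓ : ℓ ≤ t)
    (hb : b ≤ t) (r : Fin t → Fin t → Fin t → Bool) :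
    blocks (encode G) (num t) e ℓ b (bits₃ r) =
      List.ofFn fun i => block n (sampled he hℓ hb r i) := by
  rw [blocks, len_num, min_eq_left he, bits₃, toList_ofList, take_ofFn he, List.map_ofFn]
  congr 1 with i
  simp only [Function.comp_apply, bits₂, bits₁, toList_ofList, take_ofFn hℓ, take_ofFn hb,
    List.map_ofFn, len_encode, Function.comp_def, truth_ofBool, block, sampled, digits]

theorem isUniform_sampled {t N ℓ b : ℕ} (hN : N ≤ t) (hℓ : ℓ ≤ t) (hb : b ≤ t) :
    IsUniform (sampled hN hℓ hb) := by
  have hdigits : IsUniform fun y : Fin t → Bool => digits fun c => y (Fin.castLE hb c) :=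
    (isUniform_digits b).comp (.restrict (Fin.castLE_injective hb))
  have hrow := (hdigits.pi (ι := Fin ℓ)).comp
    (.restrict (Ω := Fin t → Bool) (Fin.castLE_injective hℓ))
  exact (hrow.pi (ι := Fin N)).comp
    (.restrict (Ω := Fin t → Fin t → Bool) (Fin.castLE_injective hN))

theorem half_pow_size_le_prob_parse {t : ℕ} (x : BTree) (ht : x.size ≤ t) :
    (1 / 2 : ℝ) ^ x.size ≤
      prob fun ω : Fin t → Bool => parse ((bits₁ ω).toList.map truth) = x := by
  obtain ⟨s, rfl⟩ := Nat.exists_eq_add_of_le' ht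
  let code : Fin x.size → Bool := fun i => (postfixCode x)[i]'(by simp [length_postfixCode])
  have hcode : List.ofFn code = postfixCode x :=
    List.ext_getElem (by simp [length_postfixCode]) fun i _ _ => by simp [code]
  calc (1 / 2 : ℝ) ^ x.size
      = prob fun ω : Fin (s + x.size) → Bool => (fun i => ω (Fin.natAdd s i)) = code := by
        rw [(IsUniform.restrict (Fin.natAdd_injective _ s)).prob_comp (· = code), prob_eq_const]
        simp
    _ ≤ _ := prob_mono fun ω hω => by
        rw [map_truth_toList_bits₁, List.ofFn_add, hω, hcode, parse_append_postfixCode]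

theorem mem_toList_block {n m ℓ : ℕ} (x : Fin ℓ → Fin m) (w : BTree) :
    w ∈ (block n x).toList ↔ ∃ j, num (min (x j) n) = w := by
  simp [block]

theorem mem_vertices_block {n m ℓ : ℕ} (x : Fin ℓ → Fin m) (v : Fin n) :
    v ∈ vertices n (block n x) ↔ ∃ j, (x j : ℕ) = v := by
  simp only [mem_vertices, mem_toList_block, exists_exists_eq_and, len_num]
  exact exists_congr fun j => by have := v.2; omega

theorem blockAdj_block {n m ℓ : ℕ} (G : SimpleGraph (Fin n)) (x y : Fin ℓ → Fin m) :
    blockAdj (encode G) (block n x) (block n y) ↔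
      ∀ i j, ∃ (h : (x i : ℕ) < n) (h' : (y j : ℕ) < n), G.Adj ⟨x i, h⟩ ⟨y j, h'⟩ := by
  have hmin : ∀ a : ℕ, min a n < n ↔ a < n := fun a => by omega
  simp only [blockAdj_iff, mem_toList_block, forall_exists_index, forall_apply_eq_imp_iff,
    entry_encode, len_num]
  refine forall₂_congr fun i j => ⟨fun ⟨h, h', hadj⟩ => ?_, fun ⟨h, h', hadj⟩ => ?_⟩
  · rw [hmin] at h h'
    simp only [min_eq_left h.le, min_eq_left h'.le] at hadj
    exact ⟨h, h', hadj⟩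
  · simp only [min_eq_left h.le, min_eq_left h'.le]
    exact ⟨h, h', hadj⟩

theorem Dense.certified_of_perm_block {n k a s b : ℕ} {G : SimpleGraph (Fin n)}
    {H : SimpleGraph (Fin k)} (hH : Dense a H) (hs : 1 ≤ s) (hn : n ≤ 2 ^ b)
    (hnum : 32768 * a ^ 2 * (4 * a * b * s + k) < k * s ^ 2)
    {x : Fin k → Fin (4 * a * s) → Fin (2 ^ b)}
    (hx : k * s ≤ (Finset.univ.biUnion fun i => Finset.univ.image (x i)).card)
    (hadj : ∀ i j, H.Adj i j → blockAdj (encode G) (block n (x i)) (block n (x j)))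
    {L : List BTree} (hL : L.Perm (List.ofFn fun i => block n (x i))) :
    certified (encode G) b L := by
  obtain ⟨X, hX, hcard⟩ := hH.exists_pairs hs (B := fun i => Finset.univ.image (x i))
    (fun i => Finset.card_image_le.trans (by simp)) (by simpa using hx)
  let cast : Fin n × Fin n → Fin (2 ^ b) × Fin (2 ^ b) := Prod.map (Fin.castLE hn) (Fin.castLE hn)
  let Y : Finset (Fin n × Fin n) := Finset.univ.filter fun y => cast y ∈ X
  have hXY : X ⊆ Y.image cast := by
    intro z hz
    obtain ⟨i, j, hij, hi, hj⟩ := hX z hz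
    obtain ⟨c, -, hc⟩ := Finset.mem_image.1 hi
    obtain ⟨d, -, hd⟩ := Finset.mem_image.1 hj
    obtain ⟨hc', hd', -⟩ := (blockAdj_block G _ _).1 (hadj i j hij) c d
    rw [hc] at hc'
    rw [hd] at hd'
    exact Finset.mem_image.2 ⟨(⟨z.1, hc'⟩, ⟨z.2, hd'⟩), by simpa [Y, cast] using hz, rfl⟩
  refine certified_of_perm (X := Y) (ℓ := 4 * a * s) hL (fun i => by simp [block]) hn
    (fun y hy => ?_) ?_
  · obtain ⟨i, j, hij, hi, hj⟩ := hX _ (Finset.mem_filter.1 hy).2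
    obtain ⟨c, -, hc⟩ := Finset.mem_image.1 hi
    obtain ⟨d, -, hd⟩ := Finset.mem_image.1 hj
    exact ⟨i, j, (mem_vertices_block _ _).2 ⟨c, congrArg Fin.val hc⟩,
      (mem_vertices_block _ _).2 ⟨d, congrArg Fin.val hd⟩, hadj i j hij⟩
  · refine lt_of_lt_of_le ?_ ((Finset.card_le_card hXY).trans Finset.card_image_le)
    have hk : 0 < k := Nat.pos_of_ne_zero fun h => by simp [h] at hnum
    refine lt_of_mul_lt_mul_left (a := 4096 * a ^ 2) ?_ (Nat.zero_le _)
    calc 4096 * a ^ 2 * (8 * (b * (k * (4 * a * s)) + k ^ 2))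
        = k * (32768 * a ^ 2 * (4 * a * b * s + k)) := by ring
      _ < k * (k * s ^ 2) := Nat.mul_lt_mul_of_pos_left hnum hk
      _ = k ^ 2 * s ^ 2 := by ring
      _ ≤ 4096 * a ^ 2 * X.card := by simpa using hcard

/-! ### Majority votes -/

theorem countP_ofFn {α : Type*} {t : ℕ} (F : Fin t → α) (p : α → Bool) :
    (List.ofFn F).countP p = (Finset.univ.filter fun i => p (F i)).card := by
  rw [List.ofFn_eq_map, List.countP_map, List.countP_eq_length_filter,
    ← List.toFinset_card_of_nodup ((List.nodup_finRange t).filter _), List.toFinset_filter]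
  simp

open Classical in
/-- The program `P` detects the pattern `H` in graphs on `n` vertices, in a time such that a stage
`t` of the search has time to interpret it. -/
def DetectsWithin {k : ℕ} (P : Prog) (H : SimpleGraph (Fin k)) (t n : ℕ) : Prop :=
  ∀ Γ : SimpleGraph (Fin n), ∃ T, T ≤ t ∧ P.cost * T ≤ t ∧
    2 / 3 ≤ output P T (encode Γ) (some (decide (H.IsContained Γ)))

theorem two_thirds_le_prob_interpret {P : Prog} {M : BTree} {T t : ℕ} {b : Bool} (hT : T ≤ t)
    (hcost : P.cost * T ≤ t) (h : 2 / 3 ≤ output P T M (some b)) :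
    2 / 3 ≤ prob fun ρ : Fin t → Bool =>
      (interpret P.code M (bits₁ ρ) (num t)).truth = b := by
  change 2 / 3 ≤ answerProb T ([P], M) (some b) at h
  rw [answerProb_eq_prob_coinStep hT, show (2 / 3 : ℝ≥0∞) = ENNReal.ofReal (2 / 3) by
    rw [ENNReal.ofReal_div_of_pos (by norm_num)]; simp,
    ENNReal.ofReal_le_ofReal_iff (prob_nonneg _)] at h
  refine h.trans (prob_mono fun ρ hρ => ?_)
  have hrun := interpret_code hρ (clock := num t) (by rwa [len_num])
  rw [List.map_ofFn] at hrun
  rw [bits₁]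
  exact (congrArg truth hrun).trans (truth_ofBool b)

open Classical in
theorem DetectsWithin.prob_majority_ne_le {k n t : ℕ} {P : Prog} {H : SimpleGraph (Fin k)}
    (hP : DetectsWithin P H t n) (Γ : SimpleGraph (Fin n)) :
    prob (fun ω : Fin t → Fin t → Bool =>
      majority P.code (encode Γ) (bits₂ ω) (num t) ≠ decide (H.IsContained Γ)) ≤
        (17 / 18) ^ t := by
  obtain ⟨T, hT, hcost, hout⟩ := hP Γ
  have hvote := prob_majority_wrong_le (ι := Fin t) (two_thirds_le_prob_interpret hT hcost hout)
  rw [Fintype.card_fin] at hvote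
  refine (prob_mono fun ω hω => ?_).trans hvote
  rw [majority, bits₂, toList_ofList, countP_ofFn, countP_ofFn] at hω
  generalize decide (H.IsContained Γ) = b at hω ⊢
  cases b
  · simpa using (of_not_not fun h => hω (decide_eq_false h)).le
  · simpa using le_of_not_gt fun h => hω (decide_eq_true h)

section Votes

variable {n k N t : ℕ} {G : SimpleGraph (Fin n)} {H : SimpleGraph (Fin k)} {S : Fin N → BTree}
  {P : Prog}

theorem HasCopy.one_lt_length {l : List (Fin N)} (h : HasCopy G H S l) (hk : 2 ≤ k) :
    1 < l.length := by
  obtain ⟨f, hf, hfl, -⟩ := h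
  calc 1 < (List.ofFn f).length := by rw [List.length_ofFn]; omega
    _ ≤ l.length := ((List.nodup_ofFn.2 hf).subperm fun a ha => by
        obtain ⟨i, rfl⟩ := List.mem_ofFn.1 ha
        exact hfl i).length_le

open Classical in
theorem prob_vote_ne_le (hP : ∀ m, 1 ≤ m → m ≤ N → DetectsWithin P H t m) (hk : 2 ≤ k)
    (hS : ∀ i, (S i).toList ≠ []) (hcopy : HasCopy G H S (List.finRange N)) {l : List (Fin N)}
    (hl : l ∈ tested (fun l => decide (HasCopy G H S l)) [] (List.finRange N)) :
    prob (fun ω : Fin t → Fin t → Bool =>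
      majority P.code (blockMatrix (encode G) (l.map S)) (bits₂ ω) (num t) ≠
        decide (HasCopy G H S l)) ≤ (17 / 18) ^ t := by
  obtain ⟨hnodup, hlt⟩ := nodup_and_length_lt_of_mem_tested
    (by simpa using List.nodup_finRange N) hl
  obtain ⟨i, hi⟩ := exists_cons_of_mem_tested (by simpa using fun l l' => HasCopy.mono)
    (by simpa using hcopy) hl
  have hpos : 1 ≤ l.length := by
    have := (of_decide_eq_true hi).one_lt_length hk
    rw [List.length_cons] at this
    omega
  rw [show l.map S = List.ofFn (S ∘ l.get) by rw [← List.map_ofFn, List.ofFn_get],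
    blockMatrix_encode G (S := S ∘ l.get) fun i => hS _]
  simp only [hasCopy_iff_isContained hnodup]
  exact (hP _ hpos (by simpa using hlt.le)).prob_majority_ne_le _

theorem three_quarters_le_prob_votesCorrect (hP : ∀ m, 1 ≤ m → m ≤ N → DetectsWithin P H t m)
    (hk : 2 ≤ k) (hS : ∀ i, (S i).toList ≠ []) (hcopy : HasCopy G H S (List.finRange N))
    (ht : 72 * N ≤ t) :
    3 / 4 ≤ prob fun ω : Fin t → Fin t → Bool =>
      VotesCorrect G H S P.code (bits₂ ω) (num t) := by
  classical
  let lists := tested (fun l => decide (HasCopy G H S l)) [] (List.finRange N)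
  have hlists : (lists.toFinset.card : ℝ) ≤ t / 72 := by
    rw [le_div_iff₀ (by norm_num), mul_comm]
    have : lists.toFinset.card ≤ N := by
      simpa [lists, length_tested] using List.toFinset_card_le lists
    exact_mod_cast (Nat.mul_le_mul_left 72 this).trans ht
  have hdecay : (17 / 18 : ℝ) ^ t * (1 + t * (1 / 18)) ≤ 1 := by
    simpa only [show (1 - 1 / 18 : ℝ) = 17 / 18 by norm_num] using
      one_sub_pow_mul_le (q := 1 / 18) (by norm_num) (by norm_num) t
  have hwrong : prob (fun ω : Fin t → Fin t → Bool =>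
      ¬ VotesCorrect G H S P.code (bits₂ ω) (num t)) ≤ 1 / 4 := by
    calc prob (fun ω : Fin t → Fin t → Bool =>
          ¬ VotesCorrect G H S P.code (bits₂ ω) (num t))
        ≤ ∑ l ∈ lists.toFinset, prob fun ω : Fin t → Fin t → Bool =>
            majority P.code (blockMatrix (encode G) (l.map S)) (bits₂ ω) (num t) ≠
              decide (HasCopy G H S l) := by
          refine (prob_mono fun ω hω => ?_).trans (prob_exists_le _ _)
          simpa [VotesCorrect, lists] using hω
      _ ≤ lists.toFinset.card * (17 / 18) ^ t := by
          rw [← nsmul_eq_mul]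
          exact Finset.sum_le_card_nsmul _ _ _ fun l hl =>
            prob_vote_ne_le hP hk hS hcopy (List.mem_toFinset.1 hl)
      _ ≤ t / 72 * (17 / 18) ^ t := by gcongr
      _ ≤ 1 / 4 := by
          have : (0 : ℝ) ≤ (17 / 18) ^ t := by positivity
          linarith
  linarith [one_sub_le_prob_of_prob_not_le hwrong]

end Votes

/-! ### The success probability of a stage -/

/-- The guess of a successful stage: the program, the binary logarithm of the number of blocks,
the number of vertices of a block, and the number of bits of a vertex. -/
def params (P : Prog) (e ℓ b : ℕ) : BTree :=
  .node P.code (.node (num e) (.node (num ℓ) (num b)))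

/-- The blocks with the vertices `x` contain a copy of the pattern, and any `k` of them have more
than `u` vertices in total. -/
def GoodBlocks {n k N ℓ m : ℕ} (G : SimpleGraph (Fin n)) (H : SimpleGraph (Fin k)) (u : ℕ)
    (x : Fin N → Fin ℓ → Fin m) : Prop :=
  HasCopy G H (fun i => block n (x i)) (List.finRange N) ∧
    ∀ f : Fin k → Fin N, Function.Injective f →
      u < (Finset.univ.biUnion fun i => Finset.univ.image (x (f i))).card

theorem toList_block_ne_nil {n m ℓ : ℕ} (hℓ : 1 ≤ ℓ) (x : Fin ℓ → Fin m) :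
    (block n x).toList ≠ [] := by
  simpa [block, List.ofFn_eq_nil_iff] using Nat.one_le_iff_ne_zero.1 hℓ

section Clique

variable {n k N ℓ m κ : ℕ} {G : SimpleGraph (Fin n)} {K : Finset (Fin n)}

theorem hasCopy_of_clique (H : SimpleGraph (Fin k)) (hℓ : 1 ≤ ℓ) (hK : G.IsClique (K : Set (Fin n)))
    {C : Fin k → Finset (Fin m)} (hC : ∀ i, ∀ x ∈ C i, ∃ h : (x : ℕ) < n, ⟨x, h⟩ ∈ K)
    (hdisj : Pairwise (Function.onFun Disjoint C)) {x : Fin N → Fin ℓ → Fin m}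
    (hx : ∀ i, ∃ c, ∀ j, x c j ∈ C i) :
    HasCopy G H (fun i => block n (x i)) (List.finRange N) := by
  choose f hf using hx
  refine ⟨f, fun i j hij => ?_, by simp, fun i j hij => (blockAdj_block G _ _).2 fun c d => ?_⟩
  · by_contra hne
    exact Finset.disjoint_left.1 (hdisj hne) (hf i ⟨0, hℓ⟩) (hij ▸ hf j _)
  · obtain ⟨hc, hcK⟩ := hC i _ (hf i c)
    obtain ⟨hd, hdK⟩ := hC j _ (hf j d)
    refine ⟨hc, hd, hK hcK hdK fun h => ?_⟩
    exact Finset.disjoint_left.1 (hdisj (H.ne_of_adj hij)) (hf i c)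
      (Fin.ext (Fin.mk.inj_iff.1 h) ▸ hf j d)

theorem exists_disjoint_parts (hn : n ≤ m) (hK : k * κ ≤ K.card) :
    ∃ C : Fin k → Finset (Fin m), (∀ i, (C i).card = κ) ∧
      (∀ i, ∀ x ∈ C i, ∃ h : (x : ℕ) < n, ⟨x, h⟩ ∈ K) ∧
      Pairwise (Function.onFun Disjoint C) := by
  let φ : Fin k × Fin κ → Fin m := fun p =>
    Fin.castLE hn (K.equivFin.symm (Fin.castLE hK (finProdFinEquiv p)))
  have hφ : Function.Injective φ :=
    (Fin.castLE_injective hn).comp (Subtype.val_injective.comp (K.equivFin.symm.injective.comp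
      ((Fin.castLE_injective hK).comp finProdFinEquiv.injective)))
  refine ⟨fun i => Finset.univ.image fun c => φ (i, c), fun i => ?_, fun i x hx => ?_,
    fun i j hij => ?_⟩
  · rw [Finset.card_image_of_injective _ fun c d h => (Prod.ext_iff.1 (hφ h)).2]
    simp
  · obtain ⟨c, -, rfl⟩ := Finset.mem_image.1 hx
    exact ⟨(K.equivFin.symm _).1.2, (K.equivFin.symm (Fin.castLE hK (finProdFinEquiv (i, c)))).2⟩
  · refine Finset.disjoint_left.2 fun x hx hx' => ?_
    obtain ⟨c, -, rfl⟩ := Finset.mem_image.1 hx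
    obtain ⟨d, -, h⟩ := Finset.mem_image.1 hx'
    exact hij (Prod.ext_iff.1 (hφ h)).1.symm

theorem prob_not_hasCopy_le (H : SimpleGraph (Fin k)) (hk : 1 ≤ k) (hℓ : 1 ≤ ℓ) (hm : 1 ≤ m)
    (hn : n ≤ m) (hK : G.IsClique (K : Set (Fin n))) (hκ : k * κ ≤ K.card)
    (hN : (8 * k : ℝ) ≤ N * (κ / m) ^ ℓ) :
    prob (fun x : Fin N → Fin ℓ → Fin m =>
      ¬ HasCopy G H (fun i => block n (x i)) (List.finRange N)) ≤ 1 / 8 := by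
  have : NeZero m := ⟨by omega⟩
  have : (0 : ℝ) < k := by exact_mod_cast hk
  obtain ⟨C, hCκ, hCK, hdisj⟩ := exists_disjoint_parts hn hκ
  have hmiss : ∀ i, prob (fun x : Fin N → Fin ℓ → Fin m => ¬ ∃ c, ∀ j, x c j ∈ C i) ≤
      1 / (8 * k) := by
    intro i
    have hle := prob_forall_not_block_subset_mul_le (κ := Fin N) (ι := Fin ℓ) (C i)
    simp only [hCκ, Fintype.card_fin] at hle
    rw [le_div_iff₀ (by positivity)]
    refine le_trans ?_ hle
    gcongr
    · exact prob_nonneg _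
    · linarith
  calc prob (fun x : Fin N → Fin ℓ → Fin m =>
        ¬ HasCopy G H (fun i => block n (x i)) (List.finRange N))
      ≤ prob fun x : Fin N → Fin ℓ → Fin m =>
          ∃ i ∈ (Finset.univ : Finset (Fin k)), ¬ ∃ c, ∀ j, x c j ∈ C i := by
        refine prob_mono fun x hx => ?_
        by_contra! hhit
        exact hx (hasCopy_of_clique H hℓ hK hCK hdisj fun i => hhit i (Finset.mem_univ i))
    _ ≤ ∑ _i : Fin k, 1 / (8 * (k : ℝ)) :=
        (prob_exists_le _ _).trans (Finset.sum_le_sum fun i _ => hmiss i)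
    _ = 1 / 8 := by
        rw [Finset.sum_const, Finset.card_univ, Fintype.card_fin, nsmul_eq_mul]
        field_simp

theorem three_quarters_le_prob_goodBlocks (H : SimpleGraph (Fin k)) (hk : 1 ≤ k) (hℓ : 1 ≤ ℓ)
    (hm : 1 ≤ m) (hn : n ≤ m) (hK : G.IsClique (K : Set (Fin n))) (hκ : k * κ ≤ K.card)
    (hN : (8 * k : ℝ) ≤ N * (κ / m) ^ ℓ) {u : ℕ}
    (hu : (N : ℝ) ^ k * m ^ u * (u / m) ^ (ℓ * k) ≤ 1 / 8) :
    3 / 4 ≤ prob fun x : Fin N → Fin ℓ → Fin m => GoodBlocks G H u x := by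
  have : NeZero m := ⟨by omega⟩
  have hcopy := prob_not_hasCopy_le H hk hℓ hm hn hK hκ hN
  have hunion := prob_exists_card_union_le_le (Ω := Fin m) (κ := Fin N) (ι := Fin ℓ) k u
  simp only [Fintype.card_fin] at hunion
  have hbad : prob (fun x : Fin N → Fin ℓ → Fin m => ¬ GoodBlocks G H u x) ≤ 1 / 8 + 1 / 8 := by
    refine (prob_mono fun x hx => ?_).trans ((prob_or_le _ _).trans
      (add_le_add hcopy (hunion.trans hu)))
    simpa [GoodBlocks, imp_iff_not_or] using not_and_or.1 hx
  linarith [one_sub_le_prob_of_prob_not_le hbad]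

end Clique

theorem mul_div_pow_eq {a c s : ℕ} (hc : 4 * a = c + 2) {m : ℝ} (hm : m ≠ 0) (κ : ℝ) :
    m ^ (c * s) * (κ / m) ^ (4 * a * s) = (κ ^ (2 * a) / m) ^ (2 * s) := by
  rw [div_pow, div_pow, ← pow_mul, show 2 * a * (2 * s) = 4 * a * s by ring, hc,
    show (c + 2) * s = c * s + 2 * s by ring, pow_add m]
  field_simp

theorem pow_mul_pow_mul_div_pow_eq {a c s k : ℕ} (hc : 4 * a = c + 2) {m : ℝ} (hm : m ≠ 0)
    (u : ℝ) : (m ^ (c * s)) ^ k * m ^ (k * s) * (u / m) ^ (4 * a * s * k) =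
      (u ^ (4 * a) / m) ^ (k * s) := by
  rw [div_pow, div_pow, ← pow_mul, ← pow_mul, show 4 * a * s * k = 4 * a * (k * s) by ring, hc,
    show (c + 2) * (k * s) = c * s * k + k * s + k * s by ring, pow_add m, pow_add m]
  field_simp

theorem three_quarters_le_prob_goodBlocks_two_pow {n k a s b κ : ℕ} {G : SimpleGraph (Fin n)}
    (H : SimpleGraph (Fin k)) (ha : 1 ≤ a) (hs : 1 ≤ s) (hk : 1 ≤ k) (hn : n ≤ 2 ^ b)
    {K : Finset (Fin n)} (hK : G.IsClique (K : Set (Fin n))) (hκ : k * κ ≤ K.card)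
    (hκb : 8 * k * 2 ^ b ≤ κ ^ (2 * a)) (hu : 8 * (k * s) ^ (4 * a) ≤ 2 ^ b) :
    3 / 4 ≤ prob fun x : Fin (2 ^ (b * ((4 * a - 2) * s))) → Fin (4 * a * s) → Fin (2 ^ b) =>
      GoodBlocks G H (k * s) x := by
  obtain ⟨c, hc⟩ : ∃ c, 4 * a = c + 2 := ⟨4 * a - 2, by omega⟩
  rw [show 4 * a - 2 = c by omega, pow_mul]
  have hm : (0 : ℝ) < (2 ^ b : ℕ) := by positivity
  refine three_quarters_le_prob_goodBlocks H hk (Nat.mul_pos (by omega) hs) Nat.one_le_two_pow hn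
    hK hκ ?_ ?_
  · have hbase : (8 * k : ℝ) ≤ (κ : ℝ) ^ (2 * a) / (2 ^ b : ℕ) := by
      rw [le_div_iff₀ hm]
      exact_mod_cast hκb
    have hone : (1 : ℝ) ≤ 8 * k := by
      have : (1 : ℝ) ≤ k := by exact_mod_cast hk
      linarith
    rw [Nat.cast_pow (2 ^ b), mul_div_pow_eq hc hm.ne']
    exact hbase.trans (le_self_pow₀ (hone.trans hbase) (by omega))
  · have hbase : ((k * s : ℕ) : ℝ) ^ (4 * a) / (2 ^ b : ℕ) ≤ 1 / 8 := by
      rw [div_le_div_iff₀ hm (by norm_num), one_mul, mul_comm]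
      exact_mod_cast hu
    rw [Nat.cast_pow (2 ^ b), pow_mul_pow_mul_div_pow_eq hc hm.ne']
    exact (pow_le_pow_left₀ (by positivity) hbase _).trans
      (pow_le_of_le_one (by norm_num) (by norm_num) (Nat.mul_pos hk hs).ne')

section Stage

variable {n k a s b t : ℕ} {G : SimpleGraph (Fin n)} {H : SimpleGraph (Fin k)} {P : Prog}

theorem Dense.succeeds {e : ℕ} (hH : Dense a H) (hs : 1 ≤ s) (hn : n ≤ 2 ^ b)
    (hnum : 32768 * a ^ 2 * (4 * a * b * s + k) < k * s ^ 2)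
    (he : 2 ^ e ≤ t) (hℓ : 4 * a * s ≤ t) (hb : b ≤ t) {ω : Coins t}
    (hparse : parse ((bits₁ ω.1.1).toList.map truth) = params P e (4 * a * s) b)
    (hgood : GoodBlocks G H (k * s) (sampled he hℓ hb ω.1.2))
    (hvotes : VotesCorrect G H (fun i => block n (sampled he hℓ hb ω.1.2 i)) P.code (bits₂ ω.2)
      (num t)) :
    Succeeds (encode G) t ω := by
  obtain ⟨f, hf, hadj, hperm⟩ := search_perm_copy hgood.1 hvotes
  simp only [Succeeds, accepts, hparse, params, left_node, right_node, len_num,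
    blocks_bits₃ G he hℓ hb]
  exact hH.certified_of_perm_block hs hn hnum (hgood.2 f hf).le hadj hperm

theorem Dense.half_pow_mul_half_le_prob_succeeds {e : ℕ} (hH : Dense a H) (ha : 1 ≤ a)
    (hs : 1 ≤ s) (hk : 2 ≤ k) (hn : n ≤ 2 ^ b)
    (hnum : 32768 * a ^ 2 * (4 * a * b * s + k) < k * s ^ 2)
    (hP : ∀ m, 1 ≤ m → m ≤ 2 ^ e → DetectsWithin P H t m)
    (hgood : 3 / 4 ≤ prob fun x : Fin (2 ^ e) → Fin (4 * a * s) → Fin (2 ^ b) =>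
      GoodBlocks G H (k * s) x)
    (he : 72 * 2 ^ e ≤ t) (hℓ : 4 * a * s ≤ t) (hb : b ≤ t)
    (hsize : (params P e (4 * a * s) b).size ≤ t) :
    (1 / 2) ^ (params P e (4 * a * s) b).size * (1 / 2) ≤ prob (Succeeds (encode G) t) := by
  have he' : 2 ^ e ≤ t := by omega
  rw [← (isUniform_sampled he' hℓ hb).prob_comp (GoodBlocks G H (k * s))] at hgood
  have hblocks := prob_mul_le_prob_and
    (p := fun r : Fin t → Bool => parse ((bits₁ r).toList.map truth) = params P e (4 * a * s) b)
    (q := fun _ r => GoodBlocks G H (k * s) (sampled he' hℓ hb r)) fun _ _ => hgood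
  have hvotes := prob_mul_le_prob_and
    (p := fun r : (Fin t → Bool) × (Fin t → Fin t → Fin t → Bool) =>
      parse ((bits₁ r.1).toList.map truth) = params P e (4 * a * s) b ∧
        GoodBlocks G H (k * s) (sampled he' hℓ hb r.2))
    (q := fun r ω => VotesCorrect G H (fun i => block n (sampled he' hℓ hb r.2 i)) P.code
      (bits₂ ω) (num t)) fun r hr => three_quarters_le_prob_votesCorrect hP hk
        (fun i => toList_block_ne_nil (Nat.mul_pos (by omega) hs) _) hr.2.1 he
  have hsucceeds := hvotes.trans (prob_mono fun ω hω =>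
    hH.succeeds hs hn hnum he' hℓ hb hω.1.1 hω.1.2 hω.2)
  have hparse := half_pow_size_le_prob_parse (params P e (4 * a * s) b) hsize
  have hpos : (0 : ℝ) ≤ (1 / 2) ^ (params P e (4 * a * s) b).size := by positivity
  linarith

end Stage

/-! ### The number of stages -/

theorem size_encode_le {n : ℕ} (G : SimpleGraph (Fin n)) : (encode G).size ≤ 8 * n ^ 2 + 1 := by
  classical
  have hrows : (encode G).size ≤ n * (n * (3 + 1) + 1 + 1) + 1 :=
    size_ofList_ofFn_le fun _ => size_ofList_ofFn_le fun _ => size_ofBool_le _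
  nlinarith [Nat.le_self_pow two_ne_zero n]

theorem size_params (P : Prog) (e ℓ b : ℕ) :
    (params P e ℓ b).size = P.code.size + 6 + 2 * e + 2 * ℓ + 2 * b := by
  simp only [params, size_node, size_num]
  omega

/-- The first stage with enough time for the blocks and for the interpretation of `P`, if `P` takes
at most `φ * m ^ γ` steps on graphs on `m` vertices. -/
def startStage (P : Prog) (φ γ e ℓ b : ℕ) : ℕ :=
  72 * 2 ^ e + ℓ + b + (params P e ℓ b).size + (P.cost + 1) * (φ * 2 ^ (e * γ))

/-- A number of stages after which the search has most likely succeeded: starting with `startStage`,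
every stage succeeds with probability at least `2 ^ (-σ - 1)`, where `σ` is the size of the guessed
parameters. -/
def stageBound (P : Prog) (φ γ e ℓ b : ℕ) : ℕ :=
  startStage P φ γ e ℓ b + 4 * 2 ^ (params P e ℓ b).size

theorem exists_stageBound_le (P : Prog) (φ γ : ℕ) : ∃ M : ℕ, 1 ≤ M ∧
    ∀ e ℓ b Z, e ≤ Z → ℓ ≤ Z → b ≤ Z →
      8 * (2 ^ b) ^ 2 + 1 + stageBound P φ γ e ℓ b + 2 ≤ M * 2 ^ ((6 + γ) * Z) := by
  refine ⟨85 + 5 * 2 ^ (P.code.size + 6) + (P.cost + 1) * φ, by omega, ?_⟩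
  intro e ℓ b Z he hℓ hb
  have hpow : ∀ i j : ℕ, i ≤ j → 2 ^ i ≤ 2 ^ j := fun i j h => Nat.pow_le_pow_right (by norm_num) h
  set Y := 2 ^ ((6 + γ) * Z)
  have hZ : Z ≤ (6 + γ) * Z := Nat.le_mul_of_pos_left _ (by omega)
  have hZ' : 6 * Z ≤ (6 + γ) * Z := Nat.mul_le_mul_right _ (by omega)
  have hone : 1 ≤ Y := Nat.one_le_two_pow
  have hinput : (2 ^ b) ^ 2 ≤ Y := by
    rw [← pow_mul]
    exact hpow _ _ (by omega)
  have hblocks : 2 ^ e ≤ Y := hpow _ _ (by omega)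
  have hZY : Z ≤ Y := Nat.lt_two_pow_self.le.trans (hpow _ _ hZ)
  have hguess : 2 ^ (params P e ℓ b).size ≤ 2 ^ (P.code.size + 6) * Y := by
    rw [size_params, ← pow_add]
    exact hpow _ _ (by omega)
  have hsize : (params P e ℓ b).size ≤ 2 ^ (P.code.size + 6) * Y :=
    Nat.lt_two_pow_self.le.trans hguess
  have htime : (P.cost + 1) * (φ * 2 ^ (e * γ)) ≤ (P.cost + 1) * φ * Y := by
    rw [mul_assoc]
    gcongr
    refine hpow _ _ ?_
    calc e * γ ≤ Z * γ := by gcongr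
      _ ≤ (6 + γ) * Z := by nlinarith
  rw [stageBound, startStage]
  nlinarith

theorem prod_one_sub_le {p : ℕ → ℝ} {q : ℝ} {t₀ : ℕ} (hp₀ : ∀ t, 0 ≤ p t) (hp₁ : ∀ t, p t ≤ 1)
    (hq : ∀ t, t₀ ≤ t → q ≤ p t) (m : ℕ) :
    ∏ t ∈ Finset.range (t₀ + m), (1 - p t) ≤ (1 - q) ^ m := by
  have hnonneg : ∀ t, 0 ≤ 1 - p t := fun t => sub_nonneg.2 (hp₁ t)
  rw [Finset.prod_range_add]
  calc (∏ t ∈ Finset.range t₀, (1 - p t)) * ∏ t ∈ Finset.range m, (1 - p (t₀ + t))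
      ≤ 1 * ∏ _t ∈ Finset.range m, (1 - q) := by
        gcongr with t
        · exact Finset.prod_nonneg fun t _ => hnonneg _
        · exact Finset.prod_le_one (fun t _ => hnonneg t) fun t _ => by linarith [hp₀ t]
        · exact fun t _ => hnonneg _
        · exact hq _ (Nat.le_add_right _ _)
    _ = (1 - q) ^ m := by simp

theorem two_thirds_le_one_sub_prod {p : ℕ → ℝ} {t₀ σ : ℕ} (hp₀ : ∀ t, 0 ≤ p t)
    (hp₁ : ∀ t, p t ≤ 1) (hp : ∀ t, t₀ ≤ t → (1 / 2) ^ σ * (1 / 2) ≤ p t) :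
    2 / 3 ≤ 1 - ∏ t ∈ Finset.range (t₀ + 4 * 2 ^ σ), (1 - p t) := by
  have hprod := prod_one_sub_le hp₀ hp₁ hp (4 * 2 ^ σ)
  have hle : (1 / 2 : ℝ) ^ σ ≤ 1 := pow_le_one₀ (by norm_num) (by norm_num)
  have hdecay := one_sub_pow_mul_le (q := (1 / 2) ^ σ * (1 / 2)) (by positivity) (by linarith)
    (4 * 2 ^ σ)
  have hmean : ((4 * 2 ^ σ : ℕ) : ℝ) * ((1 / 2) ^ σ * (1 / 2)) = 2 := by
    push_cast
    rw [one_div_pow]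
    field_simp
    norm_num
  rw [hmean] at hdecay
  linarith

theorem floor_mul_rpow_le (f g : ℝ) {m e : ℕ} (hm : 1 ≤ m) (hme : m ≤ 2 ^ e) :
    ⌊f * (m : ℝ) ^ g⌋₊ ≤ ⌈|f|⌉₊ * 2 ^ (e * ⌈|g|⌉₊) := by
  refine Nat.floor_le_of_le ?_
  have hm' : (1 : ℝ) ≤ m := by exact_mod_cast hm
  have hpow : (m : ℝ) ^ g ≤ 2 ^ (e * ⌈|g|⌉₊) := by
    calc (m : ℝ) ^ g ≤ (m : ℝ) ^ ((⌈|g|⌉₊ : ℕ) : ℝ) :=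
          Real.rpow_le_rpow_of_exponent_le hm' ((le_abs_self g).trans (Nat.le_ceil _))
      _ = (m : ℝ) ^ ⌈|g|⌉₊ := Real.rpow_natCast _ _
      _ ≤ (2 ^ e) ^ ⌈|g|⌉₊ := by
          gcongr
          exact_mod_cast hme
      _ = 2 ^ (e * ⌈|g|⌉₊) := (pow_mul _ _ _).symm
  push_cast
  exact mul_le_mul ((le_abs_self f).trans (Nat.le_ceil _)) hpow (by positivity) (by positivity)

theorem SolvesPattern.detectsWithin {k m t e : ℕ} {P : Prog} {H : SimpleGraph (Fin k)} {f g : ℝ}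
    (hP : SolvesPattern P H fun n : ℕ => f * (n : ℝ) ^ g) (hm : 1 ≤ m) (hme : m ≤ 2 ^ e)
    (ht : (P.cost + 1) * (⌈|f|⌉₊ * 2 ^ (e * ⌈|g|⌉₊)) ≤ t) : DetectsWithin P H t m := by
  have hT := (Nat.mul_le_mul_left (P.cost + 1) (floor_mul_rpow_le f g hm hme)).trans ht
  exact fun Γ => ⟨⌊f * (m : ℝ) ^ g⌋₊, (Nat.le_mul_of_pos_left _ (Nat.succ_pos _)).trans hT,
    (Nat.mul_le_mul_right _ (Nat.le_succ _)).trans hT, hP m hm Γ⟩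

/-! ### The size of the blocks -/

/-- A quarter of the number of vertices of a block divided by `a`, for `2 ^ b` vertex numbers and a
pattern with `k` vertices. The factor `b / k` makes the search fast for large patterns. -/
def blockSize (a k b : ℕ) : ℕ := 262144 * a ^ 3 * (b / k + 1)

theorem blockSize_pos {a : ℕ} (ha : 1 ≤ a) (k b : ℕ) : 1 ≤ blockSize a k b :=
  Nat.mul_pos (Nat.mul_pos (by norm_num) (Nat.pow_pos ha)) (Nat.succ_pos _)

theorem lt_mul_blockSize_sq {a k b : ℕ} (ha : 1 ≤ a) (hk : 1 ≤ k) :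
    32768 * a ^ 2 * (4 * a * b * blockSize a k b + k) < k * blockSize a k b ^ 2 := by
  set s := blockSize a k b with hs
  have hb : 262144 * a ^ 3 * b ≤ k * s := by
    have hdiv := (Nat.lt_mul_div_succ b (show 0 < k by omega)).le
    calc 262144 * a ^ 3 * b ≤ 262144 * a ^ 3 * (k * (b / k + 1)) := by gcongr
      _ = k * s := by rw [hs, blockSize]; ring
  have ha' : 262144 * a ^ 3 ≤ s := Nat.le_mul_of_pos_right _ (Nat.succ_pos _)
  have hbs : 262144 * a ^ 3 * b * s ≤ k * s * s := Nat.mul_le_mul_right _ hb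
  have hss : 65536 * a ^ 2 < s * s := by
    have hpos : 1 ≤ a ^ 3 := Nat.one_le_pow _ _ ha
    have hle : a ^ 2 ≤ a ^ 3 := Nat.pow_le_pow_right ha (by norm_num)
    nlinarith
  have hks : k * (65536 * a ^ 2) < k * (s * s) := Nat.mul_lt_mul_of_pos_left hss (by omega)
  nlinarith

theorem mul_blockSize_le {a k b : ℕ} (hkb : k ≤ b) : k * blockSize a k b ≤ 524288 * a ^ 3 * b := by
  have hdiv : k * (b / k) ≤ b := Nat.mul_div_le b k
  calc k * blockSize a k b = 262144 * a ^ 3 * (k * (b / k) + k) := by rw [blockSize]; ring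
    _ ≤ 262144 * a ^ 3 * (b + b) := by gcongr
    _ = 524288 * a ^ 3 * b := by ring

theorem eventually_blockSize_pow_le_two_pow (a k : ℕ) :
    ∀ᶠ b : ℕ in atTop, 8 * (k * blockSize a k b) ^ (4 * a) ≤ 2 ^ b := by
  set D : ℝ := 8 * (524288 * (a : ℝ) ^ 3) ^ (4 * a) with hD
  have hlim := tendsto_pow_const_div_const_pow_of_one_lt (4 * a) (r := 2) (by norm_num)
  have hsmall : ∀ᶠ b : ℕ in atTop, (b : ℝ) ^ (4 * a) / 2 ^ b < 1 / (D + 1) :=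
    hlim.eventually (gt_mem_nhds (by positivity))
  filter_upwards [hsmall, eventually_ge_atTop k] with b hb hkb
  rw [div_lt_div_iff₀ (by positivity) (by positivity), one_mul] at hb
  have hle : ((8 * (524288 * a ^ 3 * b) ^ (4 * a) : ℕ) : ℝ) ≤ ((2 ^ b : ℕ) : ℝ) := by
    push_cast
    rw [mul_pow, ← mul_assoc, ← hD]
    have : (0 : ℝ) ≤ (b : ℝ) ^ (4 * a) := by positivity
    linarith
  calc 8 * (k * blockSize a k b) ^ (4 * a) ≤ 8 * (524288 * a ^ 3 * b) ^ (4 * a) := by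
        gcongr 8 * ?_ ^ (4 * a)
        exact mul_blockSize_le hkb
    _ ≤ 2 ^ b := by exact_mod_cast hle

theorem mul_two_pow_le_div_pow {a k n b κ : ℕ} (hk : 1 ≤ k) (hn : n ≤ κ ^ a)
    (hb : 2 ^ b ≤ 2 * n) (hkn : k ^ a < n) (hkn' : 16 * k * (2 * k) ^ (2 * a) ≤ n) :
    8 * k * 2 ^ b ≤ (κ / k) ^ (2 * a) := by
  have hkκ : k ≤ κ := (lt_of_pow_lt_pow_left₀ a (Nat.zero_le _) (hkn.trans_le hn)).le
  have hκ : κ ≤ 2 * k * (κ / k) := by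
    have hlt := Nat.lt_mul_div_succ κ (show 0 < k by omega)
    have hdiv : 1 ≤ κ / k := (Nat.one_le_div_iff (by omega)).2 hkκ
    nlinarith
  have hnn : n * n ≤ (2 * k) ^ (2 * a) * (κ / k) ^ (2 * a) := by
    calc n * n ≤ κ ^ a * κ ^ a := Nat.mul_le_mul hn hn
      _ = κ ^ (2 * a) := by ring
      _ ≤ (2 * k * (κ / k)) ^ (2 * a) := Nat.pow_le_pow_left hκ _
      _ = (2 * k) ^ (2 * a) * (κ / k) ^ (2 * a) := mul_pow _ _ _
  have hpos : 0 < (2 * k) ^ (2 * a) := by positivity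
  refine Nat.le_of_mul_le_mul_left (le_trans ?_ hnn) hpos
  calc (2 * k) ^ (2 * a) * (8 * k * 2 ^ b) ≤ (2 * k) ^ (2 * a) * (8 * k * (2 * n)) := by gcongr
    _ = 16 * k * (2 * k) ^ (2 * a) * n := by ring
    _ ≤ n * n := by gcongr

theorem Dense.two_thirds_le_one_sub_prod {n k a b : ℕ} {G : SimpleGraph (Fin n)}
    {H : SimpleGraph (Fin k)} {P : Prog} {f g : ℝ} (hH : Dense a H) (ha : 1 ≤ a) (hk : 2 ≤ k)
    (hP : SolvesPattern P H fun n : ℕ => f * (n : ℝ) ^ g) (hn : n ≤ 2 ^ b) (hb : 2 ^ b ≤ 2 * n)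
    (hkn : k ^ a < n) (hkn' : 16 * k * (2 * k) ^ (2 * a) ≤ n)
    (hu : 8 * (k * blockSize a k b) ^ (4 * a) ≤ 2 ^ b)
    {K : Finset (Fin n)} (hK : G.IsClique (K : Set (Fin n))) (hKn : n ≤ K.card ^ a) :
    2 / 3 ≤ 1 - ∏ t ∈ Finset.range (stageBound P ⌈|f|⌉₊ ⌈|g|⌉₊
      (b * ((4 * a - 2) * blockSize a k b)) (4 * a * blockSize a k b) b),
        (1 - prob (Succeeds (encode G) t)) := by
  refine PatternDetection.two_thirds_le_one_sub_prod (fun t => prob_nonneg _)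
    (fun t => prob_le_one _) fun t ht => ?_
  rw [startStage] at ht
  refine hH.half_pow_mul_half_le_prob_succeeds ha (blockSize_pos ha k b) hk hn
    (lt_mul_blockSize_sq ha (by omega)) (fun m hm hme => hP.detectsWithin hm hme (by omega))
    (three_quarters_le_prob_goodBlocks_two_pow H ha (blockSize_pos ha k b) (by omega) hn hK
      (Nat.mul_div_le _ _) (mul_two_pow_le_div_pow (by omega) hKn hb hkn hkn') hu)
    ?_ ?_ ?_ ?_ <;> omega

/-! ### The running time -/

theorem cast_mul_blockSize_mul_le {a k b : ℕ} {x : ℝ} (hb : (b : ℝ) ≤ 2 * x) :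
    ((4 * a * blockSize a k b * b : ℕ) : ℝ) ≤ 1048576 * a ^ 4 * (4 * x ^ 2 / k + 2 * x) := by
  have hx : 0 ≤ x := by linarith [b.cast_nonneg (α := ℝ)]
  have hdiv : ((b / k : ℕ) : ℝ) ≤ 2 * x / k := Nat.cast_div_le.trans (by gcongr)
  calc ((4 * a * blockSize a k b * b : ℕ) : ℝ)
      = 1048576 * a ^ 4 * ((((b / k : ℕ) : ℝ) + 1) * b) := by
        rw [blockSize]
        push_cast
        ring
    _ ≤ 1048576 * a ^ 4 * ((2 * x / k + 1) * (2 * x)) := by gcongr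
    _ = 1048576 * a ^ 4 * (4 * x ^ 2 / k + 2 * x) := by ring

theorem log_add_one_le {M w d τ : ℕ} (hM : 1 ≤ M) (hτ : τ ≤ (M * 2 ^ w) ^ d) :
    Real.log (τ + 1) ≤ 1 + d * (Real.log M + w) := by
  have : (0 : ℝ) < M := by exact_mod_cast hM
  have hlog : Real.log 2 ≤ 1 := by linarith [Real.log_two_lt_d9]
  have hle : (τ : ℝ) + 1 ≤ 2 * ((M : ℝ) * 2 ^ w) ^ d := by
    have hpos : 1 ≤ (M * 2 ^ w) ^ d := Nat.one_le_pow _ _ (Nat.mul_pos hM Nat.one_le_two_pow)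
    exact_mod_cast (show τ + 1 ≤ 2 * (M * 2 ^ w) ^ d by omega)
  calc Real.log (τ + 1) ≤ Real.log (2 * ((M : ℝ) * 2 ^ w) ^ d) :=
        Real.log_le_log (by positivity) hle
    _ = Real.log 2 + d * (Real.log M + w * Real.log 2) := by
        rw [Real.log_mul (by norm_num) (by positivity), Real.log_pow,
          Real.log_mul (by positivity) (by positivity), Real.log_pow]
    _ ≤ 1 + d * (Real.log M + w) := by
        gcongr
        exact mul_le_of_le_one_right (Nat.cast_nonneg _) hlog

theorem log_add_one_le_quadratic {a k b d γ M τ : ℕ} (hM : 1 ≤ M) {x : ℝ}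
    (hb : (b : ℝ) ≤ 2 * x)
    (hτ : τ ≤ (M * 2 ^ ((6 + γ) * (4 * a * blockSize a k b * b))) ^ d) :
    Real.log (τ + 1) ≤ (4194304 * a ^ 4 * d * (6 + γ) / k) * x ^ 2 +
      (2097152 * a ^ 4 * d * (6 + γ)) * x + (1 + d * Real.log M) := by
  refine (log_add_one_le hM hτ).trans ?_
  calc 1 + (d : ℝ) * (Real.log M + ((6 + γ) * (4 * a * blockSize a k b * b) : ℕ))
      ≤ 1 + d * (Real.log M + (6 + γ) * (1048576 * a ^ 4 * (4 * x ^ 2 / k + 2 * x))) := by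
        rw [Nat.cast_mul, Nat.cast_add, Nat.cast_ofNat]
        gcongr
        exact cast_mul_blockSize_mul_le hb
    _ = _ := by ring

theorem eventually_quadratic_le {A B D ε : ℝ} (h : A < ε) :
    ∀ᶠ x : ℝ in atTop, A * x ^ 2 + B * x + D ≤ ε * x ^ 2 := by
  filter_upwards [eventually_ge_atTop 1, eventually_ge_atTop ((|B| + |D|) / (ε - A))] with x h₁ hx
  rw [div_le_iff₀ (by linarith)] at hx
  have hD : D ≤ |D| * x := (le_abs_self D).trans (le_mul_of_one_le_right (abs_nonneg _) h₁)
  have hB : B * x ≤ |B| * x := by gcongr; exact le_abs_self B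
  nlinarith

theorem tendsto_clog_two : Tendsto (Nat.clog 2) atTop atTop :=
  tendsto_atTop.2 fun i => (eventually_ge_atTop (2 ^ i)).mono fun n hn =>
    (Nat.pow_le_pow_iff_right (by norm_num)).1 (hn.trans (Nat.le_pow_clog (by norm_num) n))

theorem two_pow_clog_le {n : ℕ} (hn : 2 ≤ n) : 2 ^ Nat.clog 2 n ≤ 2 * n := by
  have hlt := Nat.pow_pred_clog_lt_self (b := 2) (by norm_num) (x := n) (by omega)
  obtain ⟨b, hb⟩ := Nat.exists_eq_succ_of_ne_zero (Nat.clog_pos (b := 2) (by norm_num) hn).ne'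
  rw [hb, Nat.pred_succ] at hlt
  rw [hb, pow_succ]
  omega

theorem clog_two_le_two_mul_log {n : ℕ} (hn : 2 ≤ Real.log n) :
    (Nat.clog 2 n : ℝ) ≤ 2 * Real.log n := by
  have hn₀ : n ≠ 0 := by rintro rfl; norm_num at hn
  have hn₁ : n ≠ 1 := by rintro rfl; norm_num at hn
  have hlog : (Nat.clog 2 n : ℝ) * Real.log 2 ≤ Real.log 2 + Real.log n := by
    rw [← Real.log_pow, ← Real.log_mul (by norm_num) (by positivity)]
    refine Real.log_le_log (by positivity) ?_
    exact_mod_cast two_pow_clog_le (show 2 ≤ n by omega)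
  nlinarith [Real.log_two_gt_d9]

/-! ### Detecting cliques -/

/-- Within `τ` steps, `A` accepts with probability at least `2 / 3` every graph on `n` vertices that
contains a clique of size at least `n ^ (1 / a)`. -/
def DetectsCliques (A : Prog) (a n τ : ℕ) : Prop :=
  ∀ (G : SimpleGraph (Fin n)) (K : Finset (Fin n)), G.IsClique (K : Set (Fin n)) →
    n ≤ K.card ^ a → 2 / 3 ≤ acceptProb τ ([A], encode G)

/-- `A` detects cliques of size `n ^ (1 / a)` in time `n ^ (ε * log n)` for all large `n`. -/
def EventuallyDetectsCliques (A : Prog) (a : ℕ) (ε : ℝ) : Prop :=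
  ∀ᶠ n : ℕ in atTop, ∃ τ : ℕ, Real.log (τ + 1) ≤ ε * Real.log n ^ 2 ∧ DetectsCliques A a n τ

/-- Every graph that `A` accepts with positive probability has a certificate. -/
def CertifiesAcceptance (A : Prog) : Prop :=
  ∀ ⦃n : ℕ⦄ (G : SimpleGraph (Fin n)), ¬ HasCertificate G → ∀ T, acceptProb T ([A], encode G) = 0

/-- The program `A` runs at least `m` stages on the input `G` in time `B (G.size + m)`, with
independent coins, and accepts if one of them succeeds. -/
def RunsStages (A : Prog) (B : ℕ → ℕ) : Prop :=
  ∀ (G : BTree) (m : ℕ), ENNReal.ofReal (1 - ∏ t ∈ Finset.range m, (1 - prob (Succeeds G t))) ≤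
    acceptProb (B (G.size + m)) ([A], G)

theorem two_thirds_eq_ofReal : (2 / 3 : ℝ≥0∞) = ENNReal.ofReal (2 / 3) := by
  rw [ENNReal.ofReal_div_of_pos (by norm_num)]
  simp

section RunsStages

variable {A : Prog} {B : ℕ → ℕ} {a k : ℕ} {H : SimpleGraph (Fin k)} {P : Prog} {f g : ℝ}

theorem RunsStages.detectsCliques (hA : RunsStages A B) (hB : Monotone B) {n m : ℕ}
    (h : ∀ (G : SimpleGraph (Fin n)) (K : Finset (Fin n)), G.IsClique (K : Set (Fin n)) →
      n ≤ K.card ^ a → 2 / 3 ≤ 1 - ∏ t ∈ Finset.range m, (1 - prob (Succeeds (encode G) t))) :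
    DetectsCliques A a n (B (8 * n ^ 2 + 1 + m)) := fun G K hK hKn =>
  calc 2 / 3 = ENNReal.ofReal (2 / 3) := two_thirds_eq_ofReal
    _ ≤ ENNReal.ofReal (1 - ∏ t ∈ Finset.range m, (1 - prob (Succeeds (encode G) t))) :=
        ENNReal.ofReal_le_ofReal (h G K hK hKn)
    _ ≤ acceptProb (B ((encode G).size + m)) ([A], encode G) := hA _ _
    _ ≤ _ := acceptProb_mono (hB (Nat.add_le_add_right (size_encode_le G) m)) _

theorem RunsStages.eventuallyDetectsCliques (hA : RunsStages A B) (hB : Monotone B) {d : ℕ}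
    (hd : ∀ n, B n ≤ (n + 2) ^ d) (ha : 1 ≤ a) (hk : 2 ≤ k) (hH : Dense a H)
    (hP : SolvesPattern P H fun n : ℕ => f * (n : ℝ) ^ g) {ε : ℝ}
    (hε : 4194304 * a ^ 4 * d * (6 + ⌈|g|⌉₊) / k < ε) : EventuallyDetectsCliques A a ε := by
  obtain ⟨M, hM, hbound⟩ := exists_stageBound_le P ⌈|f|⌉₊ ⌈|g|⌉₊
  have hlog : Tendsto (fun n : ℕ => Real.log n) atTop atTop :=
    Real.tendsto_log_atTop.comp tendsto_natCast_atTop_atTop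
  filter_upwards [tendsto_clog_two.eventually (eventually_blockSize_pow_le_two_pow a k),
    eventually_gt_atTop (k ^ a), eventually_ge_atTop (16 * k * (2 * k) ^ (2 * a)),
    eventually_ge_atTop 2, hlog.eventually (eventually_ge_atTop 2),
    hlog.eventually (eventually_quadratic_le (B := 2097152 * a ^ 4 * d * (6 + ⌈|g|⌉₊))
      (D := 1 + d * Real.log M) hε)] with n hu hkn hkn' hn hlogn hquad
  set b := Nat.clog 2 n
  have hnb : n ≤ 2 ^ b := Nat.le_pow_clog (by norm_num) n
  have he : b * ((4 * a - 2) * blockSize a k b) ≤ 4 * a * blockSize a k b * b := by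
    rw [mul_comm b]
    gcongr
    omega
  have hstages := hbound _ _ b _ he (Nat.le_mul_of_pos_right _ (Nat.clog_pos (by norm_num) hn))
    (Nat.le_mul_of_pos_left _ (Nat.mul_pos (by omega) (blockSize_pos ha k b)))
  refine ⟨_, (log_add_one_le_quadratic hM (clog_two_le_two_mul_log hlogn) ?_).trans hquad,
    hA.detectsCliques hB fun G K hK hKn => hH.two_thirds_le_one_sub_prod ha hk hP hnb
      (two_pow_clog_le hn) hkn hkn' hu hK hKn⟩
  exact (hd _).trans (Nat.pow_le_pow_left (le_trans (by gcongr) hstages) d)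

end RunsStages

theorem exists_eventuallyDetectsCliques {a : ℕ} (ha : 1 ≤ a) : ∃ (A : Prog) (c : ℝ),
    CertifiesAcceptance A ∧ ∀ {k : ℕ}, 2 ≤ k → ∀ {H : SimpleGraph (Fin k)}, Dense a H →
      ∀ {f g : ℝ} {P : Prog}, SolvesPattern P H (fun n : ℕ => f * (n : ℝ) ^ g) →
        ∀ {ε}, c * (1 + |g|) / k < ε → EventuallyDetectsCliques A a ε := by
  obtain ⟨A, B, ⟨hmono, d, hd⟩, hsound, hstages⟩ := exists_universal_search
  refine ⟨A, 4194304 * a ^ 4 * d * 7, fun n G hG T => hsound _ (fun t ω hs => hG ?_) T,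
    fun {k} hk {H} hH {f g P} hP {ε} hε =>
      RunsStages.eventuallyDetectsCliques hstages hmono hd ha hk hH hP (lt_of_le_of_lt ?_ hε)⟩
  · exact HasCertificate.of_certified hs
  · have hceil : (⌈|g|⌉₊ : ℝ) ≤ |g| + 1 := (Nat.ceil_lt_add_one (abs_nonneg g)).le
    rw [mul_assoc _ (7 : ℝ)]
    gcongr
    linarith [abs_nonneg g]

/-! ### The planted clique problem -/

theorem DetectsCliques.mono {A : Prog} {a n τ τ' : ℕ} (h : DetectsCliques A a n τ) (hτ : τ ≤ τ') :
    DetectsCliques A a n τ' :=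
  fun G K hK hn => (h G K hK hn).trans (acceptProb_mono hτ _)

theorem isClique_addClique {n : ℕ} (G : SimpleGraph (Fin n)) (S : Finset (Fin n)) :
    (addClique G S).IsClique (S : Set (Fin n)) := by
  intro u hu v hv huv
  refine Or.inr ?_
  rw [SimpleGraph.fromRel_adj]
  exact ⟨huv, Or.inl ⟨hu, hv⟩⟩

theorem exists_isClique_of_mem_support_plantedClique {n κ : ℕ} {hκ : κ ≤ n}
    {G : SimpleGraph (Fin n)} (hG : G ∈ (plantedClique n κ hκ).support) :
    ∃ S : Finset (Fin n), G.IsClique (S : Set (Fin n)) ∧ S.card = κ := by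
  simp only [plantedClique, PMF.mem_support_bind_iff, PMF.mem_support_map_iff,
    PMF.mem_support_uniformOfFinset_iff, Finset.mem_powersetCard] at hG
  obtain ⟨G', -, S, ⟨-, hS⟩, rfl⟩ := hG
  exact ⟨S, isClique_addClique G' S, hS⟩

theorem DetectsCliques.two_thirds_le_plantedClique {A : Prog} {a n κ τ : ℕ}
    (h : DetectsCliques A a n τ) (hκ : κ ≤ n) (hn : n ≤ κ ^ a) :
    2 / 3 ≤ ((plantedClique n κ hκ).bind fun G => output A τ (encode G)) (some true) := by
  rw [PMF.bind_apply]
  calc (2 / 3 : ℝ≥0∞) = ∑' G, plantedClique n κ hκ G * (2 / 3) := by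
        rw [ENNReal.tsum_mul_right, PMF.tsum_coe, one_mul]
    _ ≤ _ := by
        refine ENNReal.tsum_le_tsum fun G => ?_
        by_cases hG : G ∈ (plantedClique n κ hκ).support
        · gcongr
          obtain ⟨S, hS, rfl⟩ := exists_isClique_of_mem_support_plantedClique hG
          exact h G S hS hn
        · rw [PMF.mem_support_iff, not_not] at hG
          simp [hG]

open Classical in
theorem tsum_erdosRenyi_mul (n : ℕ) (F : SimpleGraph (Fin n) → ℝ≥0∞) :
    ∑' G, erdosRenyi n G * F G = mean F := by
  rw [tsum_fintype, mean, div_eq_mul_inv, mul_comm, Finset.mul_sum]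
  simp [erdosRenyi]

theorem toOuterMeasure_erdosRenyi (k : ℕ) (p : SimpleGraph (Fin k) → Prop) :
    (erdosRenyi k).toOuterMeasure {H | p H} = ENNReal.ofReal (prob p) := by
  classical
  rw [← mean_indicator, ← tsum_erdosRenyi_mul, PMF.toOuterMeasure_apply]
  simp [Set.indicator_apply]

theorem toOuterMeasure_erdosRenyi_le_one (k : ℕ) (s : Set (SimpleGraph (Fin k))) :
    (erdosRenyi k).toOuterMeasure s ≤ 1 :=
  (toOuterMeasure_erdosRenyi k (· ∈ s)).trans_le (ENNReal.ofReal_le_one.2 (prob_le_one _))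

theorem CertifiesAcceptance.erdosRenyi_le_third {A : Prog} (hA : CertifiesAcceptance A)
    {n : ℕ} (hn : 3 ≤ n) (τ : ℕ) :
    ((erdosRenyi n).bind fun G => output A τ (encode G)) (some true) ≤ 1 / 3 := by
  classical
  have : Nonempty (Fin n) := ⟨⟨0, by omega⟩⟩
  have hle : ∀ G : SimpleGraph (Fin n), output A τ (encode G) (some true) ≤
      if HasCertificate G then 1 else 0 := by
    intro G
    split_ifs with hG
    · exact PMF.coe_le_one _ _
    · exact (hA G hG τ).le
  calc ((erdosRenyi n).bind fun G => output A τ (encode G)) (some true)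
      = ∑' G, erdosRenyi n G * output A τ (encode G) (some true) := PMF.bind_apply _ _ _
    _ ≤ ∑' G, erdosRenyi n G * if HasCertificate G then 1 else 0 := by
        gcongr with G
        exact hle G
    _ = ENNReal.ofReal (prob fun G : SimpleGraph (Fin n) => HasCertificate G) := by
        rw [tsum_erdosRenyi_mul, mean_indicator]
    _ ≤ ENNReal.ofReal (1 / 3) := by
        refine ENNReal.ofReal_le_ofReal (prob_hasCertificate_le.trans ?_)
        rw [Fintype.card_fin]
        gcongr
        exact_mod_cast hn
    _ = 1 / 3 := by
        rw [ENNReal.ofReal_div_of_pos (by norm_num)]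
        simp

/-- The least time in which `A` detects cliques of size `n ^ (1 / a)`, or `0` if there is none. -/
noncomputable def cliqueTime (A : Prog) (a n : ℕ) : ℕ := sInf {τ | DetectsCliques A a n τ}

theorem DetectsCliques.detectsCliques_cliqueTime {A : Prog} {a n τ : ℕ}
    (h : DetectsCliques A a n τ) : DetectsCliques A a n (cliqueTime A a n) :=
  Nat.sInf_mem (s := {τ | DetectsCliques A a n τ}) ⟨τ, h⟩

theorem isLittleO_log_cliqueTime_div_log {A : Prog} {a : ℕ}
    (hA : ∀ ε > 0, EventuallyDetectsCliques A a ε) :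
    (fun n : ℕ => Real.log (cliqueTime A a n + 1) / Real.log n) =o[atTop]
      fun n : ℕ => Real.log n := by
  refine isLittleO_iff.2 fun ε hε => ?_
  filter_upwards [hA ε hε, eventually_ge_atTop 2] with n ⟨τ, hτ, hdet⟩ hn
  have hlog : 0 < Real.log n := Real.log_pos (by exact_mod_cast hn)
  have hle : (cliqueTime A a n : ℝ) ≤ τ := by exact_mod_cast Nat.sInf_le hdet
  have hnonneg : 0 ≤ Real.log ((cliqueTime A a n : ℝ) + 1) := Real.log_nonneg (by simp)
  rw [Real.norm_of_nonneg (div_nonneg hnonneg hlog.le), Real.norm_of_nonneg hlog.le,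
    div_le_iff₀ hlog]
  calc Real.log (cliqueTime A a n + 1) ≤ Real.log (τ + 1) :=
        Real.log_le_log (by positivity) (by linarith)
    _ ≤ ε * Real.log n ^ 2 := hτ
    _ = ε * Real.log n * Real.log n := by ring

theorem floor_rpow_log_div_log {n : ℕ} (hn : 1 < n) (τ : ℕ) :
    ⌊(n : ℝ) ^ (Real.log (τ + 1) / Real.log n)⌋₊ = τ + 1 := by
  have hn' : (1 : ℝ) < n := by exact_mod_cast hn
  rw [Real.rpow_def_of_pos (by linarith), mul_div_cancel₀ _ (Real.log_pos hn').ne',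
    Real.exp_log (by positivity)]
  exact_mod_cast Nat.floor_natCast (τ + 1)

theorem le_ceil_rpow_pow {δ : ℝ} {a n : ℕ} (ha : 1 ≤ δ * a) (hn : 1 ≤ n) :
    n ≤ ⌈(n : ℝ) ^ δ⌉₊ ^ a := by
  have hn' : (1 : ℝ) ≤ n := by exact_mod_cast hn
  have hle : (n : ℝ) ≤ (⌈(n : ℝ) ^ δ⌉₊ : ℝ) ^ a := by
    calc (n : ℝ) = (n : ℝ) ^ (1 : ℝ) := (Real.rpow_one _).symm
      _ ≤ (n : ℝ) ^ (δ * a) := Real.rpow_le_rpow_of_exponent_le hn' ha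
      _ = ((n : ℝ) ^ δ) ^ a := by rw [Real.rpow_mul (by linarith), Real.rpow_natCast]
      _ ≤ (⌈(n : ℝ) ^ δ⌉₊ : ℝ) ^ a := by
          gcongr
          exact Nat.le_ceil _
  exact_mod_cast hle

theorem CertifiesAcceptance.distinguishes_plantedClique {A : Prog} (hA : CertifiesAcceptance A)
    {a : ℕ} {δ : ℝ} (h₀ : 0 < δ) (h₁ : δ < 1 / 2) (ha : 1 ≤ δ * a)
    (hfast : ∀ ε > 0, EventuallyDetectsCliques A a ε) :
    ∃ h : ℕ → ℝ, h =o[atTop] (fun n : ℕ => Real.log n) ∧ ∀ᶠ n : ℕ in atTop,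
      2 / 3 ≤ ((plantedClique n ⌈(n : ℝ) ^ δ⌉₊ (ceil_rpow_le n h₀ h₁)).bind
        fun G => output A ⌊(n : ℝ) ^ h n⌋₊ (encode G)) (some true) ∧
      ((erdosRenyi n).bind
        fun G => output A ⌊(n : ℝ) ^ h n⌋₊ (encode G)) (some true) ≤ 1 / 3 := by
  refine ⟨_, isLittleO_log_cliqueTime_div_log hfast, ?_⟩
  filter_upwards [hfast 1 one_pos, eventually_ge_atTop 3] with n ⟨τ, _, hdet⟩ hn
  rw [floor_rpow_log_div_log (by omega)]
  exact ⟨(hdet.detectsCliques_cliqueTime.mono (Nat.le_succ _)).two_thirds_le_plantedClique _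
    (le_ceil_rpow_pow ha (by omega)), hA.erdosRenyi_le_third hn _⟩

theorem eventually_mul_one_add_abs_div_lt {g : ℕ → ℝ} (hg : g =o[atTop] fun k : ℕ => (k : ℝ))
    (c : ℝ) {ε : ℝ} (hε : 0 < ε) : ∀ᶠ k : ℕ in atTop, c * (1 + |g k|) / k < ε := by
  have hlim : Tendsto (fun k : ℕ => c * (1 / (k : ℝ) + |g k / k|)) atTop (𝓝 (c * (0 + |0|))) :=
    (tendsto_one_div_atTop_nhds_zero_nat.add hg.tendsto_div_nhds_zero.abs).const_mul c
  rw [abs_zero, add_zero, mul_zero] at hlim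
  filter_upwards [hlim.eventually (gt_mem_nhds hε)] with k hk
  rwa [abs_div, Nat.abs_cast, ← add_div, ← mul_div_assoc] at hk

theorem SPCH.eventually_not_solvesPattern (h : SPCH) : ∃ a : ℕ, 1 ≤ a ∧ ∀ f g : ℕ → ℝ,
    g =o[atTop] (fun k : ℕ => (k : ℝ)) → ∀ᶠ k : ℕ in atTop, ∀ H : SimpleGraph (Fin k),
      Dense a H → ¬ ∃ P : Prog, SolvesPattern P H (fun n : ℕ => f k * (n : ℝ) ^ g k) := by
  obtain ⟨δ, h₀, h₁, hhard⟩ := h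
  obtain ⟨a, ha⟩ := exists_nat_ge (1 / δ)
  have ha₁ : 1 ≤ a := by exact_mod_cast (one_div_pos.2 h₀).trans_le ha
  rw [div_le_iff₀' h₀] at ha
  refine ⟨a, ha₁, fun f g hg => ?_⟩
  by_contra heasy
  obtain ⟨A, c, hA, hfast⟩ := exists_eventuallyDetectsCliques ha₁
  refine hhard ⟨A, hA.distinguishes_plantedClique h₀ h₁ ha fun ε hε => ?_⟩
  obtain ⟨k, hk, hkε, hk₂⟩ := ((not_eventually.1 heasy).and_eventually
    ((eventually_mul_one_add_abs_div_lt hg c hε).and (eventually_ge_atTop 2))).exists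
  push Not at hk
  obtain ⟨H, hH, P, hP⟩ := hk
  exact hfast hk₂ hH hP hkε

theorem tendsto_toOuterMeasure_erdosRenyi_dense {a : ℕ} (ha : 1 ≤ a) :
    Tendsto (fun k : ℕ => (erdosRenyi k).toOuterMeasure {H | Dense a H}) atTop (𝓝 1) := by
  have hlim : Tendsto (fun k : ℕ => ENNReal.ofReal (1 - (1 / 2) ^ k)) atTop (𝓝 1) := by
    simpa using ENNReal.tendsto_ofReal ((tendsto_pow_atTop_nhds_zero_of_lt_one
      (r := (1 / 2 : ℝ)) (by norm_num) (by norm_num)).const_sub 1)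
  refine tendsto_of_tendsto_of_tendsto_of_le_of_le' hlim tendsto_const_nhds ?_
    (.of_forall fun k => toOuterMeasure_erdosRenyi_le_one k _)
  filter_upwards [eventually_ge_atTop (3584 * a ^ 2)] with k hk
  rw [toOuterMeasure_erdosRenyi]
  refine ENNReal.ofReal_le_ofReal (one_sub_le_prob_of_prob_not_le ?_)
  simpa using prob_not_dense_le (V := Fin k) ha (by simpa using hk)

end PatternDetection

/-- Under the Strongish Planted Clique Hypothesis, for every function `f` and every `g k = o(k)`:
with probability tending to `1` over a random `k`-vertex pattern `H`, no algorithm (even one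
designed for that `H`) solves not-necessarily-induced detection of `H` in `n`-vertex graphs in time
`f k * n ^ g k`. -/
theorem mainTheorem5 (hSPCH : PatternDetection.SPCH) (f : ℕ → ℝ) (g : ℕ → ℝ)
    (hg : g =o[atTop] (fun k : ℕ => (k : ℝ))) :
    Tendsto
      (fun k : ℕ => (PatternDetection.erdosRenyi k).toOuterMeasure
        {H | ¬ ∃ P : PatternDetection.Prog,
          PatternDetection.SolvesPattern P H (fun n : ℕ => f k * (n : ℝ) ^ g k)})
      atTop (𝓝 1) := by
  obtain ⟨a, ha, hhard⟩ := hSPCH.eventually_not_solvesPattern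
  refine tendsto_of_tendsto_of_tendsto_of_le_of_le'
    (PatternDetection.tendsto_toOuterMeasure_erdosRenyi_dense ha) tendsto_const_nhds ?_
    (.of_forall fun k => PatternDetection.toOuterMeasure_erdosRenyi_le_one k _)
  filter_upwards [hhard f g hg] with k hk
  exact MeasureTheory.measure_mono hk
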